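/- **Notation.** Put $e(w)=e^{2\pi i w}$, $q=e(\tau)$ for $\tau=u+iv\in\mathbb H$, and $q^{r}=e(r\tau)$. For $\mathbf v\in\mathbb C^n$ and $\mathbf k\in\mathbb Z^n$ let $|\mathbf v|=\sum_j v_j$, $|\mathbf k|=\sum_j k_j$, $\|\mathbf k\|^2=\sum_j k_j^2$. Let $\theta(z;\tau)=\sum_{\nu\in\frac12+\mathbb Z}e^{\pi i\nu^2\tau+2\pi i\nu(z+\frac12)}$, $E(t)=2\int_0^t e^{-\pi x^2}\,dx$, $$R(z;\tau)=\sum_{\nu\in\frac12+\mathbb Z}\Big\{\operatorname{sgn}(\nu)-E\Big(\big(\nu+\tfrac{\operatorname{Im} z}{\operatorname{Im}\tau}\big)\sqrt{2\operatorname{Im}\tau}\Big)\Big\}(-1)^{\nu-\frac12}q^{-\frac{\nu^2}{2}}e(-\nu z),$$ and, for $n\ge 1$, $z\in\mathbb C$ and $v_1,\dots,v_n\in\mathbb C$, none of them in $\mathbb Z\tau+\mathbb Z$, $$\mu_n(z,\mathbf v;\tau)=\frac{e^{\pi i z}}{\prod_{j=1}^n\theta(v_j;\tau)}\sum_{\mathbf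 k\in\mathbb Z^n}\frac{(-1)^{|\mathbf k|}q^{\frac12\|\mathbf k\|^2+\frac12|\mathbf k|}e(\mathbf k\cdot\mathbf v)}{1-e(z)q^{|\mathbf k|}},$$ $$\widehat\mu_n(z,\mathbf v;\tau)=\mu_n(z,\mathbf v;\tau)-\tfrac i2 R\big(z-|\mathbf v|-\tfrac{n+1}2;n\tau\big),$$ $$\widehat\mu_{n,\ell}(z,\mathbf v;\tau)=(-1)^\ell q^{-\frac{\ell^2}{2n}}e\big(-\tfrac{\ell}{n}(z-|\mathbf v|)\big)\,\widehat\mu_n(z+\ell\tau,\mathbf v;\tau)\qquad(\ell\in\mathbb Z).$$ Fix an integer $M\ge1$ and let $\mathbf v=(-\frac12,\frac12,\dots,-\frac12,\frac12)\in\mathbb C^{2M}$ and $\mathbf w=\mathbf v+(\frac\tau2,0,\dots,0)$. For $\ell\in\mathbb Z$ and $s=(\alpha,\beta)\in\mathbb Q^2$ with $2Ms\notin\mathbb Z^2$ put $$\widehat\rho^{(s)}_{M,\ell}(\epsilon;\tau)=e(-M\alpha\beta)\,e(-2M\alpha\epsilon)\,q^{-M\alpha^2}\,\widehat\mu_{2M,\ell-M}\big(2M(\epsilon+\alpha\tau+\beta),\mathbf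 v;\tau\big),$$ and for $s=(0,0)$ put $\widehat\rho^{(0,0)}_{M,\ell}(\epsilon;\tau)=\widehat\mu_{2M,\ell-M}\big(2M\epsilon+\frac\tau2,\mathbf w;\tau\big)$. Thus $\widehat\rho^{(s)}_{M,\ell}(\epsilon;\tau)$ is defined for $\epsilon$ in a neighbourhood (depending on $\tau$) of $0$. For $\epsilon=x+iy$ write $\frac{\partial}{\partial\epsilon}=\frac12\big(\frac{\partial}{\partial x}-i\frac{\partial}{\partial y}\big)$. For $k\in\frac12\mathbb Z$, $N\ge 1$ and a subgroup $\Gamma\le\mathrm{SL}_2(\mathbb Z)$, a family $(f_\ell)_{\ell\in\mathbb Z}$ of smooth functions $\mathbb H\to\mathbb C$ with $f_{\ell+N}=f_\ell$ is called a *vector-valued harmonic weak Maass form of weight $k$ for $\Gamma$* if 1. for each $\gamma=\begin{pmatrix}a&b\\c&d\end{pmatrix}\in\Gamma$ there is an $N\times N$ complex matrix $U(\gamma)$ such that $\mathbf f(\gamma\tau)=(c\tau+d)^k\,U(\gamma)\,\mathbf f(\tau)$ for all $\tau\in\mathbb H$, where $\mathbf f=(f_0,\dots,f_{N-1})^{T}$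 and the power is the principal one; 2. $\Delta_k f_\ell=0$ for all $\ell$, where $\Delta_k=-v^2\big(\frac{\partial^2}{\partial u^2}+\frac{\partial^2}{\partial v^2}\big)+ikv\big(\frac{\partial}{\partial u}+i\frac{\partial}{\partial v}\big)$; 3. for all $\ell$ and all $\begin{pmatrix}a&b\\c&d\end{pmatrix}\in\mathrm{SL}_2(\mathbb Z)$ there is $C\in\mathbb R$ with $(c\tau+d)^{-k}f_\ell\big(\frac{a\tau+b}{c\tau+d}\big)=O(e^{Cv})$ as $v\to\infty$, uniformly in $u$. **Proposition.** Let $\widetilde\Gamma$ be a congruence subgroup of $\mathrm{SL}_2(\mathbb Z)$ and let $S\subset\mathbb Q^2$ be a finite set such that every $s\in S$ satisfies $s=(0,0)$ or $2Ms\notin\mathbb Z^2$. Assume that $S$ is preserved by $\widetilde\Gamma$ modulo $\mathbb Z^2$, that is, for all $s\in S$ and $\gamma\in\widetilde\Gamma$ there is $\lambda\in\mathbb Z^2$ with $s=s\gamma+\lambda$. Then for every $s\in S$ the family $\big(\widehat\rho^{(s)}_{M,\ell}(0;\tau)\big)_{\ell\ (\mathrm{mod}\ 2M)}$ is a vector-valued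 harmonic weak Maass form of weight $\frac12$ for $\widetilde\Gamma\cap\Gamma(2)$. Moreover $\epsilon\mapsto\widehat\rho^{(s)}_{M,\ell}(\epsilon;\tau)$ is real-differentiable at $0$ for all $\ell$ and $\tau$, and $\Big(\frac{\partial}{\partial\epsilon}\big[\widehat\rho^{(s)}_{M,\ell}(\epsilon;\tau)\big]_{\epsilon=0}\Big)_{\ell\ (\mathrm{mod}\ 2M)}$ is a vector-valued harmonic weak Maass form of weight $\frac32$ for $\widetilde\Gamma\cap\Gamma(2)$. -/

import Mathlib

open scoped MatrixGroups ContDiff UpperHalfPlane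

noncomputable section

namespace MaassRho

/-- `e(w) = exp(2πi w)`; in particular `q ^ r = e (r * τ)`. -/
def e (w : ℂ) : ℂ := Complex.exp (2 * Real.pi * Complex.I * w)

/-- The Jacobi theta function `θ(z;τ) = ∑_{ν ∈ 1/2 + ℤ} exp(πi ν² τ + 2πi ν (z + 1/2))`,
summed over `ν = m + 1/2`. -/
def theta (z τ : ℂ) : ℂ :=
  ∑' m : ℤ, Complex.exp (Real.pi * Complex.I * ((m : ℂ) + 1 / 2) ^ 2 * τ
    + 2 * Real.pi * Complex.I * ((m : ℂ) + 1 / 2) * (z + 1 / 2))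

/-- The multivariable Appell function `μ_n(u, v; τ)`. For `k ∈ ℤⁿ`, `|k| = ∑ k_j` and
`‖k‖² = ∑ k_j²`. It is meaningful when `u` and all `v_j` avoid the lattice `ℤτ + ℤ`. -/
def mu (n : ℕ) (u : ℂ) (v : Fin n → ℂ) (τ : ℂ) : ℂ :=
  Complex.exp (Real.pi * Complex.I * u) / (∏ j, theta (v j) τ) *
    ∑' k : Fin n → ℤ,
      (-1 : ℂ) ^ (∑ j, k j) * e (((∑ j, (k j : ℂ) ^ 2) / 2 + (∑ j, (k j : ℂ)) / 2) * τ) *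
        e (∑ j, (k j : ℂ) * v j) / (1 - e u * e ((∑ j, (k j : ℂ)) * τ))

/-- `E(t) = 2 ∫_0^t exp(-π x²) dx`. -/
def errE (t : ℝ) : ℝ := 2 * ∫ x in (0 : ℝ)..t, Real.exp (-Real.pi * x ^ 2)

/-- Zwegers' real-analytic function
`R(u;τ) = ∑_{ν ∈ 1/2 + ℤ} {sgn ν - E((ν + Im u / Im τ) √(2 Im τ))} (-1)^{ν - 1/2} q^{-ν²/2} e(-νu)`,
summed over `ν = m + 1/2`. -/
def R (u τ : ℂ) : ℂ :=
  ∑' m : ℤ,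
    ((Real.sign ((m : ℝ) + 1 / 2)
        - errE (((m : ℝ) + 1 / 2 + u.im / τ.im) * Real.sqrt (2 * τ.im)) : ℝ) : ℂ) *
      (-1 : ℂ) ^ m * e (-((m : ℂ) + 1 / 2) ^ 2 / 2 * τ) * e (-((m : ℂ) + 1 / 2) * u)

/-- The completed Appell function
`μ̂_n(u, v; τ) = μ_n(u, v; τ) - (i/2) R(u - |v| - (n+1)/2; nτ)`. -/
def muHat (n : ℕ) (u : ℂ) (v : Fin n → ℂ) (τ : ℂ) : ℂ :=
  mu n u v τ - Complex.I / 2 * R (u - (∑ j, v j) - ((n : ℂ) + 1) / 2) ((n : ℂ) * τ)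

/-- The shifted completed Appell function
`μ̂_{n,ℓ}(u, v; τ) = (-1)^ℓ q^{-ℓ²/(2n)} e(-(ℓ/n)(u - |v|)) μ̂_n(u + ℓτ, v; τ)`, `ℓ ∈ ℤ`. -/
def muHatShift (n : ℕ) (l : ℤ) (u : ℂ) (v : Fin n → ℂ) (τ : ℂ) : ℂ :=
  (-1 : ℂ) ^ l * e (-(l : ℂ) ^ 2 / (2 * (n : ℂ)) * τ) *
    e (-(l : ℂ) / (n : ℂ) * (u - ∑ j, v j)) * muHat n (u + (l : ℂ) * τ) v τ

/-- The vector `(-1/2, 1/2, …, -1/2, 1/2)` of length `2M`. -/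
def vecV (M : ℕ) (j : Fin (2 * M)) : ℂ := if (j : ℕ) % 2 = 0 then -1 / 2 else 1 / 2

/-- The vector `(-1/2, 1/2, …, -1/2, 1/2) + (τ/2, 0, …, 0)` of length `2M`. -/
def vecW (M : ℕ) (τ : ℂ) (j : Fin (2 * M)) : ℂ :=
  vecV M j + if (j : ℕ) = 0 then τ / 2 else 0

/-- The functions `ρ̂^{(s)}_{M,ℓ}(u;τ)`, with `s = (α, β) ∈ ℚ²` and `ℓ ∈ ℤ`: for `s ≠ (0,0)`,
`e(-Mαβ) e(-2Mαu) q^{-Mα²} μ̂_{2M,ℓ-M}(2M(u + ατ + β), v; τ)`, and for `s = (0,0)`,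
`μ̂_{2M,ℓ-M}(2Mu + τ/2, w; τ)`. -/
def rhoHat (M : ℕ) (s : ℚ × ℚ) (l : ℤ) (u : ℂ) (τ : ℍ) : ℂ :=
  if s = 0 then
    muHatShift (2 * M) (l - M) (2 * (M : ℂ) * u + (τ : ℂ) / 2) (vecW M τ) τ
  else
    e (-(M : ℂ) * (s.1 : ℂ) * (s.2 : ℂ)) * e (-2 * (M : ℂ) * (s.1 : ℂ) * u) *
      e (-(M : ℂ) * (s.1 : ℂ) ^ 2 * (τ : ℂ)) *
      muHatShift (2 * M) (l - M) (2 * (M : ℂ) * (u + (s.1 : ℂ) * (τ : ℂ) + (s.2 : ℂ))) (vecV M) τ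

/-- The complex derivative `∂g/∂ε = (∂g/∂x - i ∂g/∂y)/2`, `ε = x + iy`, of a function that need
not be holomorphic. -/
def complexPartial (g : ℂ → ℂ) (z : ℂ) : ℂ :=
  (fderiv ℝ g z 1 - Complex.I * fderiv ℝ g z Complex.I) / 2

/-- A function on the upper half-plane in the real coordinates `(u, v)`, `τ = u + iv`, `v > 0`. -/
def inCoords (f : ℍ → ℂ) (u v : ℝ) : ℂ :=
  f (UpperHalfPlane.ofComplex ((u : ℂ) + (v : ℂ) * Complex.I))

/-- The weight `k` hyperbolic Laplacian
`Δ_k = -v² (∂²/∂u² + ∂²/∂v²) + i k v (∂/∂u + i ∂/∂v)` at `τ = u + iv`. -/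
def laplacian (k : ℝ) (f : ℍ → ℂ) (τ : ℍ) : ℂ :=
  -(τ.im : ℂ) ^ 2 *
      (iteratedDeriv 2 (fun u => inCoords f u τ.im) τ.re
        + iteratedDeriv 2 (fun v => inCoords f τ.re v) τ.im)
    + Complex.I * (k : ℂ) * (τ.im : ℂ) *
      (deriv (fun u => inCoords f u τ.im) τ.re
        + Complex.I * deriv (fun v => inCoords f τ.re v) τ.im)

/-- The automorphy factor `cτ + d`. -/
def autFactor (γ : SL(2, ℤ)) (τ : ℍ) : ℂ := ((γ 1 0 : ℤ) : ℂ) * (τ : ℂ) + ((γ 1 1 : ℤ) : ℂ)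

/-- A family `f = (f_ℓ)_{ℓ mod N}` of functions on the upper half-plane is a vector-valued harmonic
weak Maass form of weight `k` for `Γ ≤ SL₂(ℤ)`. The family is given as a family indexed by `ℤ`
that is periodic modulo `N`. -/
structure IsVectorHarmonicMaass (N : ℕ) (k : ℝ) (Γ : Subgroup SL(2, ℤ)) (f : ℤ → ℍ → ℂ) :
    Prop where
  periodic : ∀ l : ℤ, f (l + N) = f l
  smooth : ∀ l : ℤ, ContDiffOn ℝ ∞ (f l ∘ UpperHalfPlane.ofComplex) {z : ℂ | 0 < z.im}
  /-- `f(γτ) = (cτ+d)^k U(γ) f(τ)` for an `N × N` matrix `U(γ)` (principal branch; another branch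
  changes `U(γ)` by a scalar independent of `τ`). -/
  modular : ∀ γ ∈ Γ, ∃ U : Matrix (Fin N) (Fin N) ℂ, ∀ (l : Fin N) (τ : ℍ),
    f (l : ℕ) (γ • τ) = autFactor γ τ ^ (k : ℂ) * ∑ p : Fin N, U l p * f (p : ℕ) τ
  harmonic : ∀ (l : ℤ) (τ : ℍ), laplacian k (f l) τ = 0
  /-- At most linear exponential growth at every cusp `σ∞`. -/
  growth : ∀ (l : ℤ) (σ : SL(2, ℤ)), ∃ C : ℝ,
    (fun τ : ℍ => autFactor σ τ ^ (-(k : ℂ)) * f l (σ • τ)) =O[UpperHalfPlane.atImInfty]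
      fun τ : ℍ => Real.exp (C * τ.im)

/-- `S ⊆ ℚ²` is preserved modulo `ℤ²` by `Γ`: for all `s ∈ S` and `γ ∈ Γ` there is `λ ∈ ℤ²` with
`s = sγ + λ`, where `sγ` is the product of a row vector and a matrix. -/
def PreservedModInt (S : Set (ℚ × ℚ)) (Γ : Subgroup SL(2, ℤ)) : Prop :=
  ∀ s ∈ S, ∀ γ ∈ Γ, ∃ a b : ℤ,
    s.1 = s.1 * (γ 0 0 : ℤ) + s.2 * (γ 1 0 : ℤ) + a ∧
    s.2 = s.1 * (γ 0 1 : ℤ) + s.2 * (γ 1 1 : ℤ) + b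

end MaassRho

end

noncomputable section

namespace MaassRho

section

/-! ### The exponential `e` -/

/-! Every `rhoHat` is a normalized completed Appell function `Chr.Phi` attached to a characteristic
χ, that is, to the real coordinates with respect to (τ, 1) of u = 2Mε + aτ + b and of the v_j
(`rhoHat_eq`). A transformation law in ε is proved for all admissible characteristics and all of
SL₂(ℤ); the two Maass forms are then the value and the first ε-derivative at ε = 0.

The denominators of μ_n depend on k only through |k|. Grouping by |k| turns μ_n, for n = 2M, into a
one-variable Appell sum `Hf` of level n whose coefficients `bV` are periodic mod n and whose
associated theta function `fB` is a product of θ's. Adding half of the error-function series `Wf` to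
the quotient gives `Gf`, which has exact laws under u ↦ u + 1, u ↦ u + τ and l ↦ l + n
(`muHatShift_eq`, `Gf_add_one`, `Gf_add_tau`, `Gf_add_n`).

For the law under S, let `defect` be the difference between `Gf` and its S-transform. Its
∂̄-derivative vanishes, because that of `Wf` is a conjugated unary theta series, whose S-law is the
functional equation of Jacobi's theta function (`differentiable_mordell`). Its residues cancel,
because the coefficients on the two sides are discrete Fourier transforms of each other (`bV_S`,
`tendsto_mul_defect`). So it extends to an entire function; quasi-periodicity makes it bounded,
hence constant, and then zero (`SData.ext_eq_zero`). The law under T is read off termwise, and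
products of the generators give `Chr.law`. The exponential prefactor of `Phi` is chosen so that the
automorphy factor contains, besides a square root of cτ + d, only e(-cMε²/(cτ+d)). This has zero
derivative at ε = 0, so the value has weight 1/2 and the derivative weight 3/2.

An element of Γ ∩ Γ(2) moves the characteristic of `rhoHat` by integers (`chr_invariant`), and
integral shifts act on the vector `Phi` by constant matrices (`exists_matrix_of_int_shift`). The
multiplier is a continuous square root of cτ + d on a connected space, hence a constant multiple of
the principal one. Value and derivative are each a holomorphic function plus a function whose
τ̄-derivative is v^{-k} times an antiholomorphic one, which gives harmonicity (`laplacian_eq_zero`).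
Growth at the cusp σ∞ is growth at i∞ for the characteristic χσ; there the θ's at points of order
two are bounded below (`exists_theta_half_lower`) and the polar denominators stay away from zero
(`exists_global_lower_bound`). -/

lemma e_add (x y : ℂ) : e (x + y) = e x * e y := by
  simp only [e, mul_add, Complex.exp_add]

lemma e_zero : e 0 = 1 := by simp [e]

lemma e_neg (x : ℂ) : e (-x) = (e x)⁻¹ := by
  simp only [e, mul_neg, Complex.exp_neg]

lemma e_ne_zero (x : ℂ) : e x ≠ 0 := Complex.exp_ne_zero _

lemma e_int (m : ℤ) : e m = 1 := by
  rw [e, Complex.exp_eq_one_iff]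
  exact ⟨m, by ring⟩

lemma e_add_int (x : ℂ) (m : ℤ) : e (x + m) = e x := by rw [e_add, e_int, mul_one]

lemma e_eq_one_iff (x : ℂ) : e x = 1 ↔ ∃ m : ℤ, x = m := by
  rw [e, Complex.exp_eq_one_iff]
  refine exists_congr fun m => ?_
  have h : (2 * Real.pi * Complex.I : ℂ) ≠ 0 := by simp [Real.pi_ne_zero]
  constructor
  · intro h1
    apply mul_left_cancel₀ h
    rw [h1]; ring
  · rintro rfl; ring

lemma e_half : e (1 / 2) = -1 := by
  rw [e, show (2 * Real.pi * Complex.I * (1 / 2) : ℂ) = Real.pi * Complex.I by ring,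
    Complex.exp_pi_mul_I]

lemma e_int_mul (m : ℤ) (x : ℂ) : e (m * x) = e x ^ m := by
  rw [e, e, ← Complex.exp_int_mul]; ring_nf

lemma e_int_half (m : ℤ) : e (m / 2) = (-1) ^ m := by
  rw [← e_half, ← e_int_mul]; ring_nf

lemma e_sum {ι : Type*} (s : Finset ι) (f : ι → ℂ) : e (∑ i ∈ s, f i) = ∏ i ∈ s, e (f i) := by
  simp only [e, Finset.mul_sum, Complex.exp_sum]

lemma norm_e (x : ℂ) : ‖e x‖ = Real.exp (-2 * Real.pi * x.im) := by
  rw [e, Complex.norm_exp]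
  simp

lemma conj_e (x : ℂ) : (starRingEnd ℂ) (e x) = e (-(starRingEnd ℂ) x) := by
  rw [e, e, ← Complex.exp_conj]
  simp [map_ofNat]

lemma hasDerivAt_e (x : ℂ) : HasDerivAt e (2 * Real.pi * Complex.I * e x) x := by
  have h : HasDerivAt (fun w : ℂ => 2 * Real.pi * Complex.I * w) (2 * Real.pi * Complex.I) x := by
    simpa using (hasDerivAt_id x).const_mul (2 * Real.pi * Complex.I : ℂ)
  have := h.cexp
  rw [mul_comm (Complex.exp _)] at this
  exact this

lemma differentiable_e : Differentiable ℂ e := fun x => (hasDerivAt_e x).differentiableAt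

@[fun_prop] lemma DifferentiableAt_e {E : Type*} [NormedAddCommGroup E] [NormedSpace ℂ E]
    {f : E → ℂ} {x : E} (hf : DifferentiableAt ℂ f x) : DifferentiableAt ℂ (fun y => e (f y)) x :=
  (differentiable_e (f x)).comp x hf

lemma continuous_e : Continuous e := differentiable_e.continuous

/-! ### Gaussian sums -/

lemma summable_exp_neg_abs_int : Summable fun m : ℤ => Real.exp (-|(m : ℝ)|) := by
  rw [summable_int_iff_summable_nat_and_neg]
  have := Real.summable_exp_neg_nat
  constructor <;> simpa using this

/-- The power is absorbed by x^j ≤ j! e^x, then the square is completed. In B + 2, one unit pays for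
this e^x and one for the surviving e^{-x}. -/
lemma pow_mul_gauss_le {A : ℝ} (hA : 0 < A) (B : ℝ) (j : ℕ) {x : ℝ} (hx : 0 ≤ x) :
    x ^ j * Real.exp (-A * x ^ 2 + B * x) ≤
      (j.factorial * Real.exp ((B + 2) ^ 2 / (4 * A))) * Real.exp (-x) := by
  have h1 : x ^ j ≤ j.factorial * Real.exp x := by
    have := Real.pow_div_factorial_le_exp x hx j
    rwa [div_le_iff₀ (by positivity), mul_comm] at this
  calc x ^ j * Real.exp (-A * x ^ 2 + B * x)
      ≤ (j.factorial * Real.exp x) * Real.exp (-A * x ^ 2 + B * x) := by gcongr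
    _ = j.factorial * Real.exp (x + (-A * x ^ 2 + B * x)) := by rw [Real.exp_add x]; ring
    _ ≤ j.factorial * Real.exp ((B + 2) ^ 2 / (4 * A) + -x) := by
        refine mul_le_mul_of_nonneg_left (Real.exp_le_exp.mpr ?_) (by positivity)
        have : 0 ≤ A * (x - (B + 2) / (2 * A)) ^ 2 := by positivity
        have h2 : A * (x - (B + 2) / (2 * A)) ^ 2 =
          A * x ^ 2 - (B + 2) * x + (B + 2) ^ 2 / (4 * A) := by field_simp; ring
        nlinarith
    _ = _ := by rw [Real.exp_add]; ring

lemma summable_gauss (ρ : ℝ) {A : ℝ} (hA : 0 < A) (B : ℝ) (j : ℕ) :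
    Summable fun m : ℤ => |m + ρ| ^ j * Real.exp (-A * (m + ρ) ^ 2 + B * |m + ρ|) := by
  refine Summable.of_nonneg_of_le (fun m => by positivity) (fun m => ?_)
    (summable_exp_neg_abs_int.mul_left
      ((j.factorial * Real.exp ((B + 2) ^ 2 / (4 * A))) * Real.exp |ρ|))
  have h := pow_mul_gauss_le hA B j (abs_nonneg ((m : ℝ) + ρ))
  rw [sq_abs] at h
  refine h.trans ?_
  rw [mul_assoc _ (Real.exp |ρ|), ← Real.exp_add]
  gcongr
  have := abs_sub_abs_le_abs_sub (m : ℝ) (-ρ)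
  rw [abs_neg, sub_neg_eq_add] at this
  linarith

lemma summable_gauss' (ρ : ℝ) {A : ℝ} (hA : 0 < A) (B : ℝ) :
    Summable fun m : ℤ => Real.exp (-A * (m + ρ) ^ 2 + B * |m + ρ|) := by
  simpa using summable_gauss ρ hA B 0

/-! ### The error function `E` -/

lemma hasDerivAt_errE (t : ℝ) : HasDerivAt errE (2 * Real.exp (-Real.pi * t ^ 2)) t := by
  have hc : Continuous fun x : ℝ => Real.exp (-Real.pi * x ^ 2) := by fun_prop
  exact (intervalIntegral.integral_hasDerivAt_right (hc.intervalIntegrable _ _)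
    (hc.stronglyMeasurableAtFilter _ _) hc.continuousAt).const_mul 2

lemma errE_neg (t : ℝ) : errE (-t) = -errE t := by
  have := intervalIntegral.integral_comp_neg (a := 0) (b := t)
    (fun x : ℝ => Real.exp (-Real.pi * x ^ 2))
  simp only [neg_sq, neg_zero] at this
  rw [errE, errE, this, intervalIntegral.integral_symm]
  ring

lemma integrable_gauss_pi : MeasureTheory.Integrable fun x : ℝ => Real.exp (-Real.pi * x ^ 2) :=
  integrable_exp_neg_mul_sq Real.pi_pos

lemma one_sub_errE (t : ℝ) :
    1 - errE t = 2 * ∫ x in Set.Ioi t, Real.exp (-Real.pi * x ^ 2) := by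
  have h := intervalIntegral.integral_interval_add_Ioi
    (integrable_gauss_pi.integrableOn (s := Set.Ioi 0))
    (integrable_gauss_pi.integrableOn (s := Set.Ioi t))
  rw [integral_gaussian_Ioi, div_self Real.pi_ne_zero, Real.sqrt_one] at h
  rw [errE]; linarith

/-- After translating the tail integral to start at 0, (x+t)² ≥ x² + t² splits off e^{-πt²}, and the
half Gaussian integral is 1/2. -/
lemma abs_one_sub_errE_le {t : ℝ} (ht : 0 ≤ t) :
    |1 - errE t| ≤ Real.exp (-Real.pi * t ^ 2) := by
  rw [one_sub_errE, abs_of_nonneg]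
  · have h0 := integral_gaussian_Ioi Real.pi
    rw [div_self Real.pi_ne_zero, Real.sqrt_one] at h0
    have h1 : ∫ x in Set.Ioi t, Real.exp (-Real.pi * x ^ 2) =
        ∫ x in Set.Ioi (0 : ℝ), Real.exp (-Real.pi * (x + t) ^ 2) := by
      have := (MeasureTheory.measurePreserving_add_right MeasureTheory.volume t).setIntegral_preimage_emb
        (measurableEmbedding_addRight t) (fun x : ℝ => Real.exp (-Real.pi * x ^ 2)) (Set.Ioi t)
      rw [← this]
      simp
    have h2 : ∫ x in Set.Ioi (0 : ℝ), Real.exp (-Real.pi * (x + t) ^ 2) ≤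
        ∫ x in Set.Ioi (0 : ℝ), Real.exp (-Real.pi * t ^ 2) * Real.exp (-Real.pi * x ^ 2) := by
      refine MeasureTheory.setIntegral_mono_on ?_ ?_ measurableSet_Ioi ?_
      · exact (integrable_gauss_pi.comp_add_right t).integrableOn
      · exact (integrable_gauss_pi.const_mul _).integrableOn
      · intro x hx
        rw [← Real.exp_add]
        apply Real.exp_le_exp.mpr
        have : 0 ≤ Real.pi * (x * t) :=
          mul_nonneg Real.pi_pos.le (mul_nonneg (le_of_lt hx) ht)
        nlinarith
    rw [MeasureTheory.integral_const_mul, h0] at h2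
    linarith
  · have : 0 ≤ ∫ x in Set.Ioi t, Real.exp (-Real.pi * x ^ 2) :=
      MeasureTheory.integral_nonneg fun x => (Real.exp_pos _).le
    linarith

lemma abs_errE_le_one (t : ℝ) : |errE t| ≤ 1 := by
  have key : ∀ t : ℝ, 0 ≤ t → |errE t| ≤ 1 := by
    intro t ht
    have h1 : 0 ≤ errE t := by
      rw [errE]
      have := intervalIntegral.integral_nonneg (μ := MeasureTheory.volume) ht
        (fun x _ => (Real.exp_pos (-Real.pi * x ^ 2)).le)
      linarith
    have h2 : 0 ≤ 1 - errE t := by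
      rw [one_sub_errE]
      have : 0 ≤ ∫ x in Set.Ioi t, Real.exp (-Real.pi * x ^ 2) :=
        MeasureTheory.integral_nonneg fun x => (Real.exp_pos _).le
      linarith
    rw [abs_of_nonneg h1]; linarith
  rcases le_total 0 t with h | h
  · exact key t h
  · rw [← neg_neg t, errE_neg, abs_neg]
    exact key _ (by linarith)

lemma abs_sign_le_one (x : ℝ) : |Real.sign x| ≤ 1 := by
  rcases Real.sign_apply_eq x with h | h | h <;> simp [h]

lemma abs_sign_sub_errE_le {x t : ℝ} (hx : x ≠ 0) (h : 0 ≤ x * t) :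
    |Real.sign x - errE t| ≤ Real.exp (-Real.pi * t ^ 2) := by
  rcases lt_or_gt_of_ne hx with hx | hx
  · rw [Real.sign_of_neg hx]
    have ht : 0 ≤ -t := by nlinarith
    have := abs_one_sub_errE_le ht
    rw [errE_neg, neg_sq] at this
    rw [show -1 - errE t = -(1 - -errE t) by ring, abs_neg]
    exact this
  · rw [Real.sign_of_pos hx]
    exact abs_one_sub_errE_le (by nlinarith)

end

section

/-! ### Unary theta series and their error-function companions -/

/-- The terms of the theta series `Bf`. -/
def bT (n : ℕ) (ρ : ℝ) (j : ℕ) (m : ℤ) (p : ℂ × ℂ) : ℂ :=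
  ((m : ℂ) + ρ) ^ j * e ((n : ℂ) / 2 * ((m : ℂ) + ρ) ^ 2 * p.2 + n * ((m : ℂ) + ρ) * p.1)

/-- The theta series `∑_{κ ∈ ρ + ℤ} κ^j q^{nκ²/2} e(nκε)` as a function of `(ε, τ)`. -/
def Bf (n : ℕ) (ρ : ℝ) (j : ℕ) (p : ℂ × ℂ) : ℂ := ∑' m : ℤ, bT n ρ j m p

/-- The argument of the error function in `wT`. -/
def errArg (n : ℕ) (κ : ℝ) (p : ℂ × ℂ) : ℝ :=
  (κ + p.1.im / p.2.im) * Real.sqrt (2 * n * p.2.im)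

/-- The terms of the series `Wf`. -/
def wT (n : ℕ) (ρ : ℝ) (j : ℕ) (m : ℤ) (p : ℂ × ℂ) : ℂ :=
  ((m : ℂ) + ρ) ^ j * ((Real.sign ((m : ℝ) + 1 / 2) - errE (errArg n (m + ρ) p) : ℝ) : ℂ) *
    e (-((n : ℂ) / 2 * ((m : ℂ) + ρ) ^ 2 * p.2 + n * ((m : ℂ) + ρ) * p.1))

/-- The series `∑_{κ ∈ ρ + ℤ} κ^j {sgn - E((κ + Im ε/Im τ)√(2n Im τ))} q^{-nκ²/2} e(-nκε)`. -/
def Wf (n : ℕ) (ρ : ℝ) (j : ℕ) (p : ℂ × ℂ) : ℂ := ∑' m : ℤ, wT n ρ j m p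

variable {n : ℕ} {ρ : ℝ}

lemma im_theta_exponent (n : ℕ) (κ : ℝ) (p : ℂ × ℂ) :
    ((n : ℂ) / 2 * (κ : ℂ) ^ 2 * p.2 + n * (κ : ℂ) * p.1).im =
      n / 2 * κ ^ 2 * p.2.im + n * κ * p.1.im := by
  have h1 : ((n : ℂ) / 2 * (κ : ℂ) ^ 2 * p.2 + n * (κ : ℂ) * p.1) =
    ((n / 2 * κ ^ 2 : ℝ) : ℂ) * p.2 + ((n * κ : ℝ) : ℂ) * p.1 := by push_cast; ring
  rw [h1, Complex.add_im, Complex.im_ofReal_mul, Complex.im_ofReal_mul]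

lemma norm_bT (j : ℕ) (m : ℤ) (p : ℂ × ℂ) :
    ‖bT n ρ j m p‖ = |m + ρ| ^ j *
      Real.exp (-Real.pi * n * (m + ρ) ^ 2 * p.2.im - 2 * Real.pi * n * (m + ρ) * p.1.im) := by
  have h : ((m : ℂ) + ρ) = ((m + ρ : ℝ) : ℂ) := by push_cast; rfl
  rw [bT, norm_mul, norm_pow, norm_e, h, im_theta_exponent, Complex.norm_real, Real.norm_eq_abs]
  congr 2; ring

/-- The Gaussian produced by differentiating E turns the growing exponential of κ into the complex
conjugate of the decaying one. This is why all ∂̄-derivatives of `Wf` are conjugates of the theta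
series `Bf`. -/
lemma gauss_identity (κ : ℝ) {p : ℂ × ℂ} (hp : 0 < p.2.im) :
    (Real.exp (-Real.pi * errArg n κ p ^ 2) : ℂ) *
      e (-((n : ℂ) / 2 * (κ : ℂ) ^ 2 * p.2 + n * (κ : ℂ) * p.1)) =
    (Real.exp (-2 * Real.pi * n * p.1.im ^ 2 / p.2.im) : ℂ) *
      (starRingEnd ℂ) (e ((n : ℂ) / 2 * (κ : ℂ) ^ 2 * p.2 + n * (κ : ℂ) * p.1)) := by
  have h1 : errArg n κ p ^ 2 = 2 * n * (κ ^ 2 * p.2.im + 2 * κ * p.1.im + p.1.im ^ 2 / p.2.im) := by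
    rw [errArg, mul_pow, Real.sq_sqrt (by positivity)]
    field_simp
    ring
  have hz : ((n : ℂ) / 2 * (κ : ℂ) ^ 2 * p.2 + n * (κ : ℂ) * p.1) -
      (starRingEnd ℂ) ((n : ℂ) / 2 * (κ : ℂ) ^ 2 * p.2 + n * (κ : ℂ) * p.1) =
      2 * Complex.I * ((n / 2 * κ ^ 2 * p.2.im + n * κ * p.1.im : ℝ) : ℂ) := by
    rw [Complex.sub_conj, im_theta_exponent]; push_cast; ring
  rw [conj_e]
  set z := ((n : ℂ) / 2 * (κ : ℂ) ^ 2 * p.2 + n * (κ : ℂ) * p.1) with hzdef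
  have hz' : (starRingEnd ℂ) z = z - 2 * Complex.I *
    ((n / 2 * κ ^ 2 * p.2.im + n * κ * p.1.im : ℝ) : ℂ) := by rw [← hz]; ring
  rw [hz', e, e, Complex.ofReal_exp, Complex.ofReal_exp, ← Complex.exp_add, ← Complex.exp_add, h1]
  congr 1
  have hv : (p.2.im : ℂ) ≠ 0 := by exact_mod_cast hp.ne'
  push_cast
  field_simp
  ring_nf
  rw [Complex.I_sq]
  ring

lemma norm_e_neg_mul_gauss (κ : ℝ) {p : ℂ × ℂ} (hp : 0 < p.2.im) :
    Real.exp (-Real.pi * errArg n κ p ^ 2) *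
      ‖e (-((n : ℂ) / 2 * (κ : ℂ) ^ 2 * p.2 + n * (κ : ℂ) * p.1))‖ ≤
    Real.exp (-Real.pi * n * κ ^ 2 * p.2.im - 2 * Real.pi * n * κ * p.1.im) := by
  have h := congrArg norm (gauss_identity (n := n) κ hp)
  rw [norm_mul, norm_mul, Complex.norm_real, Real.norm_eq_abs, Complex.norm_real, Real.norm_eq_abs,
    abs_of_pos (Real.exp_pos _), abs_of_pos (Real.exp_pos _), RCLike.norm_conj, norm_e (_ + _),
    im_theta_exponent, ← Real.exp_add] at h
  rw [h]
  apply Real.exp_le_exp.mpr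
  have : 0 ≤ 2 * Real.pi * n * p.1.im ^ 2 / p.2.im := by positivity
  have h2 : -2 * Real.pi * n * p.1.im ^ 2 / p.2.im = -(2 * Real.pi * n * p.1.im ^ 2 / p.2.im) := by
    ring
  rw [h2]
  nlinarith

lemma int_add_half_ne_zero (m : ℤ) : (m : ℝ) + 1 / 2 ≠ 0 := by
  intro h
  have h2 : (2 * m + 1 : ℝ) = 0 := by linarith
  have h3 : (2 * m + 1 : ℤ) = 0 := by exact_mod_cast h2
  omega

/-- If m + 1/2 and the argument of E have compatible signs, then sgn - E is Gaussian small and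
`norm_e_neg_mul_gauss` applies. Otherwise κ lies in a bounded range, and the trivial bound 2
suffices at the price of a factor independent of m. -/
lemma norm_wT_le (j : ℕ) (m : ℤ) {p : ℂ × ℂ} (hp : 0 < p.2.im) {A : ℝ}
    (hA : 2 * |ρ - 1 / 2| + |p.1.im / p.2.im| ≤ A) :
    ‖wT n ρ j m p‖ ≤ 2 * Real.exp (2 * Real.pi * n * A ^ 2 * p.2.im +
        4 * Real.pi * n * A * |p.1.im|) * (|m + ρ| ^ j *
      Real.exp (-Real.pi * n * (m + ρ) ^ 2 * p.2.im - 2 * Real.pi * n * (m + ρ) * p.1.im)) := by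
  have hA0 : 0 ≤ A := le_trans (by positivity) hA
  have h : ((m : ℂ) + ρ) = ((m + ρ : ℝ) : ℂ) := by push_cast; rfl
  rw [wT, norm_mul, norm_mul, norm_pow, h, Complex.norm_real, Real.norm_eq_abs, Complex.norm_real,
    Real.norm_eq_abs]
  set κ : ℝ := m + ρ with hκ
  have key : |Real.sign ((m : ℝ) + 1 / 2) - errE (errArg n κ p)| *
      ‖e (-((n : ℂ) / 2 * (κ : ℂ) ^ 2 * p.2 + n * (κ : ℂ) * p.1))‖ ≤
      2 * Real.exp (2 * Real.pi * n * A ^ 2 * p.2.im + 4 * Real.pi * n * A * |p.1.im|) *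
      Real.exp (-Real.pi * n * κ ^ 2 * p.2.im - 2 * Real.pi * n * κ * p.1.im) := by
    by_cases hs : 0 ≤ ((m : ℝ) + 1 / 2) * errArg n κ p
    · have h1 := abs_sign_sub_errE_le (int_add_half_ne_zero m) hs
      refine (mul_le_mul_of_nonneg_right h1 (norm_nonneg _)).trans
        ((norm_e_neg_mul_gauss κ hp).trans ?_)
      refine le_mul_of_one_le_left (Real.exp_pos _).le ?_
      have : (1 : ℝ) ≤ Real.exp (2 * Real.pi * n * A ^ 2 * p.2.im +
        4 * Real.pi * n * A * |p.1.im|) := Real.one_le_exp (by positivity)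
      linarith
    · have h2 : |Real.sign ((m : ℝ) + 1 / 2) - errE (errArg n κ p)| ≤ 2 := by
        refine (abs_sub _ _).trans ?_
        linarith [abs_sign_le_one ((m : ℝ) + 1 / 2), abs_errE_le_one (errArg n κ p)]
      have h3 : ((m : ℝ) + 1 / 2) * (κ + p.1.im / p.2.im) < 0 := by
        rw [errArg, ← mul_assoc, not_le] at hs
        by_contra hcon
        exact absurd hs (not_lt.mpr (mul_nonneg (not_lt.mp hcon) (Real.sqrt_nonneg _)))
      -- With a = m + 1/2 and a + b the shifted argument, a(a + b) < 0 forces |a| ≤ |b|.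
      have h4 : |κ| ≤ A := by
        have h5 : |(m : ℝ) + 1 / 2| ≤ |ρ - 1 / 2 + p.1.im / p.2.im| := by
          have : κ + p.1.im / p.2.im = ((m : ℝ) + 1 / 2) + (ρ - 1 / 2 + p.1.im / p.2.im) := by
            rw [hκ]; ring
          rw [this] at h3
          apply sq_le_sq.mp
          set a := (m : ℝ) + 1 / 2
          set b := ρ - 1 / 2 + p.1.im / p.2.im
          nlinarith [sq_nonneg (a + b)]
        have h6 : |κ| ≤ |(m : ℝ) + 1 / 2| + |ρ - 1 / 2| := by
          have : κ = ((m : ℝ) + 1 / 2) + (ρ - 1 / 2) := by rw [hκ]; ring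
          rw [this]; exact abs_add_le _ _
        have h7 := abs_add_le (ρ - 1 / 2) (p.1.im / p.2.im)
        linarith
      refine (mul_le_mul_of_nonneg_right h2 (norm_nonneg _)).trans ?_
      rw [norm_e, Complex.neg_im, im_theta_exponent, mul_assoc (2 : ℝ) (Real.exp _), ← Real.exp_add]
      refine mul_le_mul_of_nonneg_left (Real.exp_le_exp.mpr ?_) (by norm_num)
      -- The growing exponent πnκ²v + 2πnκy exceeds the decaying one, its negative, by 2πnκ²v +
      -- 4πnκy. Bounding |κ| by A gives the exponential constant of the statement.
      have h8 : κ ^ 2 * p.2.im ≤ A ^ 2 * p.2.im := by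
        apply mul_le_mul_of_nonneg_right _ hp.le
        rw [← sq_abs κ]; gcongr
      have h9 : κ * p.1.im ≤ A * |p.1.im| := by
        calc κ * p.1.im ≤ |κ * p.1.im| := le_abs_self _
          _ = |κ| * |p.1.im| := abs_mul _ _
          _ ≤ _ := by gcongr
      have hn : 0 ≤ Real.pi * n := by positivity
      nlinarith [mul_le_mul_of_nonneg_left h8 hn, mul_le_mul_of_nonneg_left h9 hn]
  calc _ = |κ| ^ j * (|Real.sign ((m : ℝ) + 1 / 2) - errE (errArg n κ p)| *
      ‖e (-((n : ℂ) / 2 * (κ : ℂ) ^ 2 * p.2 + n * (κ : ℂ) * p.1))‖) := by ring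
    _ ≤ |κ| ^ j * _ := mul_le_mul_of_nonneg_left key (by positivity)
    _ = _ := by ring

/-- One Gaussian majorant serves a whole ball, both series and every power j at once. This is what
permits termwise differentiation to any order. -/
lemma exists_local_bound (n : ℕ) (hn : 0 < n) (ρ : ℝ) (p₀ : ℂ × ℂ) (hp₀ : 0 < p₀.2.im) :
    ∃ r > 0, ∃ A > 0, ∃ B K : ℝ, 0 ≤ K ∧ ∀ p ∈ Metric.ball p₀ r, 0 < p.2.im ∧ ∀ (j : ℕ) (m : ℤ),
      ‖bT n ρ j m p‖ ≤ K * (|m + ρ| ^ j * Real.exp (-A * (m + ρ) ^ 2 + B * |m + ρ|)) ∧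
      ‖wT n ρ j m p‖ ≤ K * (|m + ρ| ^ j * Real.exp (-A * (m + ρ) ^ 2 + B * |m + ρ|)) := by
  set v := p₀.2.im
  set Y := |p₀.1.im| + v / 2 with hY
  set A₀ := 2 * |ρ - 1 / 2| + Y / (v / 2) with hA₀
  have hA₀0 : 0 ≤ A₀ := by positivity
  refine ⟨v / 2, by positivity, Real.pi * n * (v / 2), by positivity, 2 * Real.pi * n * Y,
    2 * Real.exp (2 * Real.pi * n * A₀ ^ 2 * (2 * v) + 4 * Real.pi * n * A₀ * Y), by positivity,
    fun p hp => ?_⟩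
  rw [mem_ball_iff_norm, Prod.norm_def, max_lt_iff] at hp
  have hY' : |p.1.im| ≤ Y := by
    have h1 := (Complex.abs_im_le_norm (p - p₀).1).trans hp.1.le
    rw [Prod.fst_sub, Complex.sub_im] at h1
    have h2 := abs_sub_abs_le_abs_sub p.1.im p₀.1.im
    linarith
  have hv := abs_lt.mp ((Complex.abs_im_le_norm (p - p₀).2).trans_lt hp.2)
  rw [Prod.snd_sub, Complex.sub_im] at hv
  have hv1 : v / 2 ≤ p.2.im := by simp only [v] at *; linarith
  have hv2 : p.2.im ≤ 2 * v := by simp only [v] at *; linarith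
  have hv0 : 0 < p.2.im := lt_of_lt_of_le (by positivity) hv1
  refine ⟨hv0, fun j m => ?_⟩
  have hbase : Real.exp (-Real.pi * n * (m + ρ) ^ 2 * p.2.im - 2 * Real.pi * n * (m + ρ) * p.1.im)
      ≤ Real.exp (-(Real.pi * n * (v / 2)) * (m + ρ) ^ 2 + 2 * Real.pi * n * Y * |m + ρ|) := by
    apply Real.exp_le_exp.mpr
    have h1 : (v / 2) * ((m + ρ) ^ 2) ≤ p.2.im * ((m + ρ) ^ 2) := by gcongr
    have h2 : -((m + ρ) * p.1.im) ≤ |m + ρ| * Y := by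
      calc -((m + ρ) * p.1.im) ≤ |(m + ρ) * p.1.im| := neg_le_abs _
        _ = |m + ρ| * |p.1.im| := abs_mul _ _
        _ ≤ _ := by gcongr
    have hn : 0 ≤ Real.pi * n := by positivity
    nlinarith [mul_le_mul_of_nonneg_left h1 hn, mul_le_mul_of_nonneg_left h2 hn]
  constructor
  · rw [norm_bT]
    have h1 : (1 : ℝ) ≤ 2 * Real.exp (2 * Real.pi * n * A₀ ^ 2 * (2 * v) +
        4 * Real.pi * n * A₀ * Y) := by
      have : (1 : ℝ) ≤ Real.exp (2 * Real.pi * n * A₀ ^ 2 * (2 * v) +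
        4 * Real.pi * n * A₀ * Y) := Real.one_le_exp (by positivity)
      linarith
    refine le_trans ?_ (le_mul_of_one_le_left (by positivity) h1)
    gcongr
  · have hA : 2 * |ρ - 1 / 2| + |p.1.im / p.2.im| ≤ A₀ := by
      rw [abs_div, abs_of_pos hv0, hA₀]
      gcongr
    refine (norm_wT_le j m hv0 hA).trans ?_
    gcongr

lemma summable_bT (hn : 0 < n) (ρ : ℝ) (j : ℕ) {p : ℂ × ℂ} (hp : 0 < p.2.im) :
    Summable fun m => bT n ρ j m p := by
  obtain ⟨r, hr, A, hA, B, K, -, h⟩ := exists_local_bound n hn ρ p hp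
  exact Summable.of_norm_bounded ((summable_gauss ρ hA B j).mul_left K)
    fun m => ((h p (Metric.mem_ball_self hr)).2 j m).1

lemma summable_wT (hn : 0 < n) (ρ : ℝ) (j : ℕ) {p : ℂ × ℂ} (hp : 0 < p.2.im) :
    Summable fun m => wT n ρ j m p := by
  obtain ⟨r, hr, A, hA, B, K, -, h⟩ := exists_local_bound n hn ρ p hp
  exact Summable.of_norm_bounded ((summable_gauss ρ hA B j).mul_left K)
    fun m => ((h p (Metric.mem_ball_self hr)).2 j m).2

end

/-! ### Real differentials and smoothness of the theta and error-function series. -/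

section

variable {n : ℕ} {ρ : ℝ}

/-- The real differential of `Im ε`. -/
def dY : ℂ × ℂ →L[ℝ] ℂ :=
  Complex.ofRealCLM.comp (Complex.imCLM.comp (ContinuousLinearMap.fst ℝ ℂ ℂ))

/-- The real differential of `Im τ`. -/
def dV : ℂ × ℂ →L[ℝ] ℂ :=
  Complex.ofRealCLM.comp (Complex.imCLM.comp (ContinuousLinearMap.snd ℝ ℂ ℂ))

@[simp] lemma dY_apply (q : ℂ × ℂ) : dY q = (q.1.im : ℂ) := rfl
@[simp] lemma dV_apply (q : ℂ × ℂ) : dV q = (q.2.im : ℂ) := rfl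

lemma norm_dY_le : ‖dY‖ ≤ 1 :=
  ContinuousLinearMap.opNorm_le_bound _ zero_le_one fun q => by
    rw [dY_apply, Complex.norm_real, Real.norm_eq_abs, one_mul]
    exact (Complex.abs_im_le_norm _).trans (norm_fst_le q)

lemma norm_dV_le : ‖dV‖ ≤ 1 :=
  ContinuousLinearMap.opNorm_le_bound _ zero_le_one fun q => by
    rw [dV_apply, Complex.norm_real, Real.norm_eq_abs, one_mul]
    exact (Complex.abs_im_le_norm _).trans (norm_snd_le q)

lemma hasFDerivAt_bT (j : ℕ) (m : ℤ) (p : ℂ × ℂ) :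
    HasFDerivAt (𝕜 := ℂ) (bT n ρ j m)
      ((Real.pi * Complex.I * n * bT n ρ (j + 2) m p) • ContinuousLinearMap.snd ℂ ℂ ℂ +
       (2 * Real.pi * Complex.I * n * bT n ρ (j + 1) m p) • ContinuousLinearMap.fst ℂ ℂ ℂ) p := by
  have h1 : HasFDerivAt (𝕜 := ℂ) (fun p : ℂ × ℂ => (n : ℂ) / 2 * ((m : ℂ) + ρ) ^ 2 * p.2 +
      n * ((m : ℂ) + ρ) * p.1) (((n : ℂ) / 2 * ((m : ℂ) + ρ) ^ 2) • ContinuousLinearMap.snd ℂ ℂ ℂ +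
      ((n : ℂ) * ((m : ℂ) + ρ)) • ContinuousLinearMap.fst ℂ ℂ ℂ) p :=
    (hasFDerivAt_snd.const_mul _).add (hasFDerivAt_fst.const_mul _)
  have h2 := ((hasDerivAt_e _).comp_hasFDerivAt p h1).const_mul (((m : ℂ) + ρ) ^ j)
  refine h2.congr_fderiv ?_
  refine ContinuousLinearMap.ext fun q => ?_
  simp [bT]
  ring

lemma hasFDerivAt_Bf (hn : 0 < n) (ρ : ℝ) (j : ℕ) {p : ℂ × ℂ} (hp : 0 < p.2.im) :
    HasFDerivAt (𝕜 := ℂ) (Bf n ρ j)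
      ((Real.pi * Complex.I * n * Bf n ρ (j + 2) p) • ContinuousLinearMap.snd ℂ ℂ ℂ +
       (2 * Real.pi * Complex.I * n * Bf n ρ (j + 1) p) • ContinuousLinearMap.fst ℂ ℂ ℂ) p := by
  obtain ⟨r, hr, A, hA, B, K, -, h⟩ := exists_local_bound n hn ρ p hp
  set g := fun (j : ℕ) (m : ℤ) => K * (|m + ρ| ^ j * Real.exp (-A * (m + ρ) ^ 2 + B * |m + ρ|))
  have hg : ∀ j, Summable (g j) := fun j => (summable_gauss ρ hA B j).mul_left K
  have key := hasFDerivAt_tsum_of_isPreconnected (𝕜 := ℂ)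
    (u := fun m => ‖(Real.pi * Complex.I * n : ℂ)‖ * g (j + 2) m +
      ‖(2 * Real.pi * Complex.I * n : ℂ)‖ * g (j + 1) m)
    (((hg _).mul_left _).add ((hg _).mul_left _)) Metric.isOpen_ball
    (convex_ball p r).isPreconnected (fun m q _ => hasFDerivAt_bT (n := n) (ρ := ρ) j m q)
    (fun m q hq => ?_) (Metric.mem_ball_self hr) (summable_bT hn ρ j hp) (Metric.mem_ball_self hr)
  · refine key.congr_fderiv ?_
    have h1 := ((summable_bT hn ρ (j + 2) hp).hasSum.mul_left (Real.pi * Complex.I * n : ℂ)).smul_const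
      (ContinuousLinearMap.snd ℂ ℂ ℂ)
    have h2 := ((summable_bT hn ρ (j + 1) hp).hasSum.mul_left
      (2 * Real.pi * Complex.I * n : ℂ)).smul_const (ContinuousLinearMap.fst ℂ ℂ ℂ)
    exact (h1.add h2).tsum_eq
  · refine (norm_add_le _ _).trans (add_le_add ?_ ?_)
    · rw [norm_smul, norm_mul]
      refine (mul_le_of_le_one_right (by positivity) (ContinuousLinearMap.norm_snd_le ..)).trans ?_
      exact mul_le_mul_of_nonneg_left ((h q hq).2 _ m).1 (norm_nonneg _)
    · rw [norm_smul, norm_mul]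
      refine (mul_le_of_le_one_right (by positivity) (ContinuousLinearMap.norm_fst_le ..)).trans ?_
      exact mul_le_mul_of_nonneg_left ((h q hq).2 _ m).1 (norm_nonneg _)

/-- The Gaussian prefactor in the differential of `Wf`. -/
def gaussFactor (n : ℕ) (p : ℂ × ℂ) : ℝ :=
  2 * (Real.sqrt (2 * n * p.2.im) / p.2.im) * Real.exp (-2 * Real.pi * n * p.1.im ^ 2 / p.2.im)

lemma hasFDerivAt_errArg (hn : 0 < n) (κ : ℝ) {p : ℂ × ℂ} (hp : 0 < p.2.im) :
    HasFDerivAt (𝕜 := ℝ) (errArg n κ)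
      ((Real.sqrt (2 * n * p.2.im) / p.2.im) •
        ((κ / 2 - p.1.im / (2 * p.2.im)) •
          Complex.imCLM.comp (ContinuousLinearMap.snd ℝ ℂ ℂ) +
          Complex.imCLM.comp (ContinuousLinearMap.fst ℝ ℂ ℂ))) p := by
  have hY : HasFDerivAt (𝕜 := ℝ) (fun p : ℂ × ℂ => p.1.im)
    (Complex.imCLM.comp (ContinuousLinearMap.fst ℝ ℂ ℂ)) p :=
    (Complex.imCLM.comp (ContinuousLinearMap.fst ℝ ℂ ℂ)).hasFDerivAt
  have hV : HasFDerivAt (𝕜 := ℝ) (fun p : ℂ × ℂ => p.2.im)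
    (Complex.imCLM.comp (ContinuousLinearMap.snd ℝ ℂ ℂ)) p :=
    (Complex.imCLM.comp (ContinuousLinearMap.snd ℝ ℂ ℂ)).hasFDerivAt
  have h0 : (2 * n * p.2.im : ℝ) ≠ 0 := by positivity
  have hS := (hV.const_mul (2 * n : ℝ)).sqrt h0
  have hI := (hasDerivAt_inv hp.ne').comp_hasFDerivAt p hV
  have h := ((hY.mul hI).const_add κ).mul hS
  have hfun : errArg n κ = (fun q : ℂ × ℂ => (κ + q.1.im * (q.2.im)⁻¹) *
      Real.sqrt (2 * n * q.2.im)) := by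
    funext q; simp [errArg, div_eq_mul_inv]
  rw [hfun]
  refine h.congr_fderiv ?_
  refine ContinuousLinearMap.ext fun q => ?_
  have hs : Real.sqrt (2 * n * p.2.im) ≠ 0 := (Real.sqrt_pos.mpr (by positivity)).ne'
  have hss : Real.sqrt (2 * n * p.2.im) ^ 2 = 2 * n * p.2.im := Real.sq_sqrt (by positivity)
  -- With the root called s, the relation s² = 2nv eliminates n and leaves a rational identity.
  generalize Real.sqrt (2 * n * p.2.im) = s at hs hss ⊢
  simp
  have hn' : (n : ℝ) ≠ 0 := by positivity
  have hp' := hp.ne'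
  have hnn : (n : ℝ) = s ^ 2 / (2 * p.2.im) := by rw [hss]; field_simp
  rw [hnn]
  field_simp
  ring

/-- Differentiating the exponential raises j, while differentiating E yields a Gaussian that
`gauss_identity` converts into conjugated terms of `Bf`. -/
lemma hasFDerivAt_wT (hn : 0 < n) (j : ℕ) (m : ℤ) {p : ℂ × ℂ} (hp : 0 < p.2.im) :
    HasFDerivAt (𝕜 := ℝ) (wT n ρ j m)
      ((-(Real.pi * Complex.I * n) * wT n ρ (j + 2) m p) • ContinuousLinearMap.snd ℝ ℂ ℂ +
       (-(2 * Real.pi * Complex.I * n) * wT n ρ (j + 1) m p) • ContinuousLinearMap.fst ℝ ℂ ℂ +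
       ((-(gaussFactor n p : ℂ) / 2) * (starRingEnd ℂ) (bT n ρ (j + 1) m p)) • dV +
       ((gaussFactor n p : ℂ) * (p.1.im / (2 * p.2.im)) * (starRingEnd ℂ) (bT n ρ j m p)) • dV +
       (-(gaussFactor n p : ℂ) * (starRingEnd ℂ) (bT n ρ j m p)) • dY) p := by
  set κ : ℝ := m + ρ with hκ
  have hκC : ((m : ℂ) + ρ) = (κ : ℂ) := by push_cast [hκ]; rfl
  have h1 : HasFDerivAt (𝕜 := ℝ) (fun p : ℂ × ℂ => -((n : ℂ) / 2 * (κ : ℂ) ^ 2 * p.2 +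
      n * (κ : ℂ) * p.1)) (-(((n : ℂ) / 2 * (κ : ℂ) ^ 2) • ContinuousLinearMap.snd ℝ ℂ ℂ +
      ((n : ℂ) * (κ : ℂ)) • ContinuousLinearMap.fst ℝ ℂ ℂ)) p :=
    ((hasFDerivAt_snd.const_mul _).add (hasFDerivAt_fst.const_mul _)).neg
  have h2 := ((hasDerivAt_e _).complexToReal_fderiv).comp p h1
  have h3 := ((hasDerivAt_errE _).comp_hasFDerivAt p (hasFDerivAt_errArg hn κ hp)).const_sub
    (Real.sign ((m : ℝ) + 1 / 2))
  have h4 := (Complex.ofRealCLM.hasFDerivAt.comp p h3).mul h2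
  have h5 := h4.const_mul ((κ : ℂ) ^ j)
  have hfun : wT n ρ j m = fun p : ℂ × ℂ => (κ : ℂ) ^ j * ((((fun p : ℂ × ℂ =>
      ((Real.sign ((m : ℝ) + 1 / 2) - errE (errArg n κ p) : ℝ) : ℂ))) p) *
      e (-((n : ℂ) / 2 * (κ : ℂ) ^ 2 * p.2 + n * (κ : ℂ) * p.1))) := by
    funext p; rw [wT, hκC]; ring
  rw [hfun]
  refine h5.congr_fderiv ?_
  refine ContinuousLinearMap.ext fun q => ?_
  have hG := gauss_identity (n := n) κ hp
  simp only [add_apply, smul_apply,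
    ContinuousLinearMap.comp_apply, neg_apply, ContinuousLinearMap.coe_fst',
    ContinuousLinearMap.coe_snd', dY_apply, dV_apply, Complex.ofRealCLM_apply, Function.comp_apply,
    Complex.imCLM_apply, one_apply_eq_self, smul_eq_mul, wT, bT, hκC, gaussFactor,
    map_mul, map_pow, Complex.conj_ofReal, ← hκ]
  push_cast at hG ⊢
  generalize e (-((n : ℂ) / 2 * (κ : ℂ) ^ 2 * p.2 + n * (κ : ℂ) * p.1)) = E at *
  generalize (starRingEnd ℂ) (e ((n : ℂ) / 2 * (κ : ℂ) ^ 2 * p.2 + n * (κ : ℂ) * p.1)) = F at *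
  linear_combination (-2 * (κ : ℂ) ^ j * ((Real.sqrt (2 * n * p.2.im) : ℂ) / p.2.im) *
    ((κ / 2 - p.1.im / (2 * p.2.im)) * q.2.im + q.1.im)) * hG

lemma contDiffAt_gaussFactor (hn : 0 < n) {p : ℂ × ℂ} (hp : 0 < p.2.im) {k : WithTop ℕ∞} :
    ContDiffAt ℝ k (gaussFactor n) p := by
  have hY : ContDiffAt ℝ k (fun p : ℂ × ℂ => p.1.im) p :=
    (Complex.imCLM.comp (ContinuousLinearMap.fst ℝ ℂ ℂ)).contDiff.contDiffAt
  have hV : ContDiffAt ℝ k (fun p : ℂ × ℂ => p.2.im) p :=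
    (Complex.imCLM.comp (ContinuousLinearMap.snd ℝ ℂ ℂ)).contDiff.contDiffAt
  have hS : ContDiffAt ℝ k (fun p : ℂ × ℂ => Real.sqrt (2 * n * p.2.im)) p :=
    (contDiffAt_const.mul hV).sqrt (by positivity)
  exact (contDiffAt_const.mul (hS.div hV hp.ne')).mul
    (((contDiffAt_const.mul (hY.pow 2)).div hV hp.ne').exp)

/-- The differential of `Wf`. -/
def Wf' (n : ℕ) (ρ : ℝ) (j : ℕ) (p : ℂ × ℂ) : ℂ × ℂ →L[ℝ] ℂ :=
  (-(Real.pi * Complex.I * n) * Wf n ρ (j + 2) p) • ContinuousLinearMap.snd ℝ ℂ ℂ +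
  (-(2 * Real.pi * Complex.I * n) * Wf n ρ (j + 1) p) • ContinuousLinearMap.fst ℝ ℂ ℂ +
  ((-(gaussFactor n p : ℂ) / 2) * (starRingEnd ℂ) (Bf n ρ (j + 1) p)) • dV +
  ((gaussFactor n p : ℂ) * (p.1.im / (2 * p.2.im)) * (starRingEnd ℂ) (Bf n ρ j p)) • dV +
  (-(gaussFactor n p : ℂ) * (starRingEnd ℂ) (Bf n ρ j p)) • dY

lemma norm_smul_le_of_le_one {c : ℂ} {L : ℂ × ℂ →L[ℝ] ℂ} {a g : ℝ} {x : ℂ} (hL : ‖L‖ ≤ 1)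
    (hc : ‖c‖ ≤ a) (hx : ‖x‖ ≤ g) : ‖(c * x) • L‖ ≤ a * g := by
  rw [norm_smul, norm_mul]
  refine (mul_le_of_le_one_right (by positivity) hL).trans ?_
  exact mul_le_mul hc hx (norm_nonneg _) ((norm_nonneg _).trans hc)

lemma hasFDerivAt_Wf (hn : 0 < n) (ρ : ℝ) (j : ℕ) {p : ℂ × ℂ} (hp : 0 < p.2.im) :
    HasFDerivAt (𝕜 := ℝ) (Wf n ρ j) (Wf' n ρ j p) p := by
  obtain ⟨r, hr, A, hA, B, K, -, h⟩ := exists_local_bound n hn ρ p hp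
  set g := fun (j : ℕ) (m : ℤ) => K * (|m + ρ| ^ j * Real.exp (-A * (m + ρ) ^ 2 + B * |m + ρ|))
  have hg : ∀ j, Summable (g j) := fun j => (summable_gauss ρ hA B j).mul_left K
  set c1 : ℂ × ℂ → ℂ := fun q => -(gaussFactor n q : ℂ) / 2
  set c2 : ℂ × ℂ → ℂ := fun q => (gaussFactor n q : ℂ) * (q.1.im / (2 * q.2.im))
  set c3 : ℂ × ℂ → ℂ := fun q => -(gaussFactor n q : ℂ)
  have hGc : ContinuousAt (fun q => (gaussFactor n q : ℂ)) p :=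
    Complex.continuous_ofReal.continuousAt.comp
      (contDiffAt_gaussFactor (k := 0) hn hp).continuousAt
  have hc1 : ContinuousAt c1 p := hGc.neg.div_const 2
  have hc2 : ContinuousAt c2 p := by
    refine hGc.mul (ContinuousAt.div ?_ ?_ ?_)
    · fun_prop
    · fun_prop
    · simp [hp.ne']
  have hc3 : ContinuousAt c3 p := hGc.neg
  -- The prefactors of the conjugated theta terms do not depend on m, so bounding them near p by
  -- continuity is enough for a summable majorant.
  have hev : ∀ᶠ q in nhds p, ‖c1 q‖ < ‖c1 p‖ + 1 ∧ ‖c2 q‖ < ‖c2 p‖ + 1 ∧ ‖c3 q‖ < ‖c3 p‖ + 1 :=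
    (hc1.norm.eventually_lt_const (lt_add_one _)).and
      ((hc2.norm.eventually_lt_const (lt_add_one _)).and
        (hc3.norm.eventually_lt_const (lt_add_one _)))
  obtain ⟨r', hr', h'⟩ := Metric.eventually_nhds_iff_ball.mp hev
  have hrr : 0 < min r r' := lt_min hr hr'
  have key := hasFDerivAt_tsum_of_isPreconnected (𝕜 := ℝ)
    (u := fun m => ‖(-(Real.pi * Complex.I * n) : ℂ)‖ * g (j + 2) m +
      ‖(-(2 * Real.pi * Complex.I * n) : ℂ)‖ * g (j + 1) m + (‖c1 p‖ + 1) * g (j + 1) m +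
      (‖c2 p‖ + 1) * g j m + (‖c3 p‖ + 1) * g j m)
    (((((hg _).mul_left _).add ((hg _).mul_left _)).add ((hg _).mul_left _)).add
      ((hg _).mul_left _) |>.add ((hg _).mul_left _)) Metric.isOpen_ball
    (convex_ball p (min r r')).isPreconnected
    (fun m q hq => hasFDerivAt_wT (n := n) (ρ := ρ) hn j m
      (h q (Metric.ball_subset_ball (min_le_left _ _) hq)).1)
    (fun m q hq => ?_) (Metric.mem_ball_self hrr) (summable_wT hn ρ j hp)
    (Metric.mem_ball_self hrr)
  · refine key.congr_fderiv ?_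
    have hcB : ∀ j, HasSum (fun m => (starRingEnd ℂ) (bT n ρ j m p))
        ((starRingEnd ℂ) (Bf n ρ j p)) := fun j =>
      Complex.hasSum_conj'.mpr (by simpa using! (summable_bT hn ρ j hp).hasSum)
    have hW : ∀ j, HasSum (fun m => wT n ρ j m p) (Wf n ρ j p) := fun j =>
      (summable_wT hn ρ j hp).hasSum
    exact (((((((hW (j + 2)).mul_left _).smul_const _).add
      (((hW (j + 1)).mul_left _).smul_const _)).add
      (((hcB (j + 1)).mul_left _).smul_const _)).add
      (((hcB j).mul_left _).smul_const _)).add (((hcB j).mul_left _).smul_const _)).tsum_eq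
  · have hq1 := (h q (Metric.ball_subset_ball (min_le_left _ _) hq)).2
    have hq2 := h' q (Metric.ball_subset_ball (min_le_right _ _) hq)
    have hcb : ∀ j m, ‖(starRingEnd ℂ) (bT n ρ j m q)‖ ≤ g j m := fun j m => by
      rw [RCLike.norm_conj]; exact (hq1 j m).1
    refine (norm_add_le _ _).trans (add_le_add ((norm_add_le _ _).trans (add_le_add
      ((norm_add_le _ _).trans (add_le_add ((norm_add_le _ _).trans (add_le_add ?_ ?_)) ?_)) ?_)) ?_)
    · exact norm_smul_le_of_le_one (ContinuousLinearMap.norm_snd_le ..) le_rfl (hq1 _ m).2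
    · exact norm_smul_le_of_le_one (ContinuousLinearMap.norm_fst_le ..) le_rfl (hq1 _ m).2
    · exact norm_smul_le_of_le_one norm_dV_le hq2.1.le (hcb _ m)
    · exact norm_smul_le_of_le_one norm_dV_le hq2.2.1.le (hcb _ m)
    · exact norm_smul_le_of_le_one norm_dY_le hq2.2.2.le (hcb _ m)

lemma isOpen_halfSpace : IsOpen {p : ℂ × ℂ | 0 < p.2.im} :=
  isOpen_lt continuous_const (Complex.continuous_im.comp continuous_snd)

lemma contDiffOn_succ_of_hasFDerivAt {E : Type*} [NormedAddCommGroup E] [NormedSpace ℝ E]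
    {U : Set E} (hU : IsOpen U) {f : E → ℂ} {f' : E → E →L[ℝ] ℂ} {k : ℕ}
    (h : ∀ p ∈ U, HasFDerivAt f (f' p) p) (hf' : ContDiffOn ℝ k f' U) :
    ContDiffOn ℝ (k + 1 : ℕ) f U := by
  rw [Nat.cast_add, Nat.cast_one, contDiffOn_succ_iff_fderiv_of_isOpen hU]
  refine ⟨fun p hp => (h p hp).differentiableAt.differentiableWithinAt, by simp, ?_⟩
  exact hf'.congr fun p hp => (h p hp).fderiv

/-- The derivative of the series with index j involves the indices j + 1 and j + 2, so the induction
on k runs over all j simultaneously. The same pattern serves `contDiffOn_Wf`. -/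
lemma contDiffOn_Bf (hn : 0 < n) (ρ : ℝ) (k : ℕ) :
    ∀ j, ContDiffOn ℝ k (Bf n ρ j) {p : ℂ × ℂ | 0 < p.2.im} := by
  induction k with
  | zero =>
    intro j
    rw [Nat.cast_zero, contDiffOn_zero]
    exact fun p hp => (hasFDerivAt_Bf hn ρ j hp).continuousAt.continuousWithinAt
  | succ k ih =>
    intro j
    refine contDiffOn_succ_of_hasFDerivAt isOpen_halfSpace
      (fun p hp => (hasFDerivAt_Bf hn ρ j hp).restrictScalars ℝ) ?_
    have : ContDiffOn ℝ k (fun p => (Real.pi * Complex.I * n * Bf n ρ (j + 2) p) •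
        ContinuousLinearMap.snd ℝ ℂ ℂ + (2 * Real.pi * Complex.I * n * Bf n ρ (j + 1) p) •
        ContinuousLinearMap.fst ℝ ℂ ℂ) {p : ℂ × ℂ | 0 < p.2.im} :=
      ((contDiffOn_const.mul (ih _)).smul contDiffOn_const).add
        ((contDiffOn_const.mul (ih _)).smul contDiffOn_const)
    exact this

lemma contDiffOn_Wf (hn : 0 < n) (ρ : ℝ) (k : ℕ) :
    ∀ j, ContDiffOn ℝ k (Wf n ρ j) {p : ℂ × ℂ | 0 < p.2.im} := by
  induction k with
  | zero =>
    intro j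
    rw [Nat.cast_zero, contDiffOn_zero]
    exact fun p hp => (hasFDerivAt_Wf hn ρ j hp).continuousAt.continuousWithinAt
  | succ k ih =>
    intro j
    refine contDiffOn_succ_of_hasFDerivAt isOpen_halfSpace
      (fun p hp => hasFDerivAt_Wf hn ρ j hp) ?_
    have hG : ContDiffOn ℝ k (fun q => (gaussFactor n q : ℂ)) {p : ℂ × ℂ | 0 < p.2.im} :=
      fun p hp => ((Complex.ofRealCLM.contDiff.contDiffAt).comp p
        (contDiffAt_gaussFactor hn hp)).contDiffWithinAt
    have hB : ∀ j, ContDiffOn ℝ k (fun p => (starRingEnd ℂ) (Bf n ρ j p))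
        {p : ℂ × ℂ | 0 < p.2.im} := fun j =>
      Complex.conjCLE.contDiff.comp_contDiffOn (contDiffOn_Bf hn ρ k j)
    have hYV : ContDiffOn ℝ k (fun p : ℂ × ℂ => (p.1.im : ℂ) / (2 * p.2.im))
        {p : ℂ × ℂ | 0 < p.2.im} := by
      have hr : ContDiffOn ℝ k (fun p : ℂ × ℂ => p.1.im / (2 * p.2.im)) {p : ℂ × ℂ | 0 < p.2.im} :=
        ((Complex.imCLM.comp (ContinuousLinearMap.fst ℝ ℂ ℂ)).contDiff.contDiffOn).div
          (contDiffOn_const.mul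
            (Complex.imCLM.comp (ContinuousLinearMap.snd ℝ ℂ ℂ)).contDiff.contDiffOn)
          fun p hp => mul_ne_zero two_ne_zero (ne_of_gt hp)
      refine (Complex.ofRealCLM.contDiff.comp_contDiffOn hr).congr fun p _ => ?_
      simp
    exact (((((contDiffOn_const.mul (ih _)).smul contDiffOn_const).add
      ((contDiffOn_const.mul (ih _)).smul contDiffOn_const)).add
      (((hG.neg.div_const 2).mul (hB _)).smul contDiffOn_const)).add
      (((hG.mul hYV).mul (hB _)).smul contDiffOn_const)).add
      ((hG.neg.mul (hB _)).smul contDiffOn_const)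

end

section

/-! ### Wirtinger derivatives -/

/-- `f` is real-differentiable at `x` with `∂f = α` and `∂̄f = β`. -/
def HasWirtinger (f : ℂ → ℂ) (α β : ℂ) (x : ℂ) : Prop :=
  HasFDerivAt (𝕜 := ℝ) f (α • (1 : ℂ →L[ℝ] ℂ) + β • (Complex.conjCLE : ℂ →L[ℝ] ℂ)) x

namespace HasWirtinger

variable {f g : ℂ → ℂ} {α β α' β' x : ℂ}

lemma of_hasFDerivAt {L : ℂ →L[ℝ] ℂ} (h : HasFDerivAt (𝕜 := ℝ) f L x)
    (hL : ∀ z, L z = α * z + β * (starRingEnd ℂ) z) : HasWirtinger f α β x :=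
  h.congr_fderiv (ContinuousLinearMap.ext fun z => by simp [hL])

lemma of_hasDerivAt (h : HasDerivAt f α x) : HasWirtinger f α 0 x :=
  of_hasFDerivAt h.complexToReal_fderiv fun z => by simp

lemma hasDerivAt (h : HasWirtinger f α 0 x) : HasDerivAt f α x := by
  have h1 : HasFDerivAt (𝕜 := ℝ) f ((α • (1 : ℂ →L[ℂ] ℂ)).restrictScalars ℝ) x := by
    refine HasFDerivAt.congr_fderiv h ?_
    ext <;> simp
  have h2 : HasFDerivAt (𝕜 := ℂ) f (α • (1 : ℂ →L[ℂ] ℂ)) x :=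
    hasFDerivAt_of_restrictScalars ℝ h1 rfl
  have := h2.hasDerivAt
  simpa using this

lemma differentiableAt (h : HasWirtinger f α β x) : DifferentiableAt ℝ f x :=
  HasFDerivAt.differentiableAt h

lemma complexPartial_eq (h : HasWirtinger f α β x) : complexPartial f x = α := by
  have h1 : fderiv ℝ f x = _ := HasFDerivAt.fderiv h
  rw [complexPartial, h1]
  simp
  ring_nf
  simp
  ring

lemma add (hf : HasWirtinger f α β x) (hg : HasWirtinger g α' β' x) :
    HasWirtinger (fun z => f z + g z) (α + α') (β + β') x :=
  of_hasFDerivAt (HasFDerivAt.add hf hg) fun z => by simp; ring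

lemma sub (hf : HasWirtinger f α β x) (hg : HasWirtinger g α' β' x) :
    HasWirtinger (fun z => f z - g z) (α - α') (β - β') x :=
  of_hasFDerivAt (HasFDerivAt.sub hf hg) fun z => by simp; ring

lemma mul (hf : HasWirtinger f α β x) (hg : HasWirtinger g α' β' x) :
    HasWirtinger (fun z => f z * g z) (α * g x + f x * α') (β * g x + f x * β') x :=
  of_hasFDerivAt (HasFDerivAt.mul hf hg) fun z => by simp; ring

lemma const_mul (c : ℂ) (hf : HasWirtinger f α β x) :
    HasWirtinger (fun z => c * f z) (c * α) (c * β) x :=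
  of_hasFDerivAt (HasFDerivAt.const_mul hf c) fun z => by simp; ring

lemma sum {ι : Type*} {s : Finset ι} {F : ι → ℂ → ℂ} {A B : ι → ℂ}
    (h : ∀ i ∈ s, HasWirtinger (F i) (A i) (B i) x) :
    HasWirtinger (fun z => ∑ i ∈ s, F i z) (∑ i ∈ s, A i) (∑ i ∈ s, B i) x :=
  of_hasFDerivAt (HasFDerivAt.fun_sum fun i hi => h i hi) fun z => by
    rw [sum_apply, Finset.sum_mul, Finset.sum_mul, ← Finset.sum_add_distrib]
    simp

lemma comp_mul_left (c : ℂ) (hf : HasWirtinger f α β (c * x)) :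
    HasWirtinger (fun z => f (c * z)) (α * c) (β * (starRingEnd ℂ) c) x := by
  have h1 : HasFDerivAt (𝕜 := ℝ) (fun z : ℂ => c * z) (c • (1 : ℂ →L[ℝ] ℂ)) x :=
    (hasFDerivAt_id x).const_mul c
  exact of_hasFDerivAt (HasFDerivAt.comp x hf h1) fun z => by simp; ring

lemma comp_add_const (c : ℂ) (hf : HasWirtinger f α β (x + c)) :
    HasWirtinger (fun z => f (z + c)) α β x := by
  have h1 : HasFDerivAt (𝕜 := ℝ) (fun z : ℂ => z + c) (1 : ℂ →L[ℝ] ℂ) x :=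
    (hasFDerivAt_id x).add_const c
  exact of_hasFDerivAt (HasFDerivAt.comp x hf h1) fun z => by simp

lemma conj (h : HasDerivAt f α x) :
    HasWirtinger (fun z => (starRingEnd ℂ) (f z)) 0 ((starRingEnd ℂ) α) x :=
  of_hasFDerivAt ((Complex.conjCLE : ℂ →L[ℝ] ℂ).hasFDerivAt.comp x h.complexToReal_fderiv)
    fun z => by simp

lemma congr {f₁ : ℂ → ℂ} (hf : HasWirtinger f α β x) (h : f₁ =ᶠ[nhds x] f) :
    HasWirtinger f₁ α β x := HasFDerivAt.congr_of_eventuallyEq hf h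

end HasWirtinger

variable {n : ℕ} {ρ : ℝ}

lemma im_eq_conj (z : ℂ) : (z.im : ℂ) = -Complex.I / 2 * (z - (starRingEnd ℂ) z) := by
  rw [Complex.sub_conj]
  push_cast
  linear_combination (z.im : ℂ) * Complex.I_mul_I

lemma hasWirtinger_Wf_fst (hn : 0 < n) (ρ : ℝ) (j : ℕ) {y τ : ℂ} (hτ : 0 < τ.im) :
    HasWirtinger (fun y => Wf n ρ j (y, τ))
      (-(2 * Real.pi * Complex.I * n) * Wf n ρ (j + 1) (y, τ) +
        Complex.I / 2 * gaussFactor n (y, τ) * (starRingEnd ℂ) (Bf n ρ j (y, τ)))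
      (-(Complex.I / 2 * gaussFactor n (y, τ) * (starRingEnd ℂ) (Bf n ρ j (y, τ)))) y := by
  have h := (hasFDerivAt_Wf hn ρ j (p := (y, τ)) hτ).comp y
    (hasFDerivAt_prodMk_left (𝕜 := ℝ) y τ)
  refine HasWirtinger.of_hasFDerivAt h fun z => ?_
  simp [Wf', im_eq_conj z]
  ring

/-- For a real first argument Im ε = 0, which removes one term of `Wf'` and leaves only the
conjugated theta series with index j + 1. -/
lemma hasWirtinger_Wf_snd (hn : 0 < n) (ρ : ℝ) (j : ℕ) (b : ℝ) {τ : ℂ} (hτ : 0 < τ.im) :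
    HasWirtinger (fun τ => Wf n ρ j (b, τ))
      (-(Real.pi * Complex.I * n) * Wf n ρ (j + 2) (b, τ) +
        Complex.I / 4 * gaussFactor n (b, τ) * (starRingEnd ℂ) (Bf n ρ (j + 1) (b, τ)))
      (-(Complex.I / 4 * gaussFactor n (b, τ) * (starRingEnd ℂ) (Bf n ρ (j + 1) (b, τ)))) τ := by
  have h := (hasFDerivAt_Wf hn ρ j (p := ((b : ℂ), τ)) hτ).comp τ
    (hasFDerivAt_prodMk_right (𝕜 := ℝ) (b : ℂ) τ)
  refine HasWirtinger.of_hasFDerivAt h fun z => ?_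
  simp [Wf', im_eq_conj z]
  ring

lemma hasDerivAt_Bf_snd (hn : 0 < n) (ρ : ℝ) (j : ℕ) (b : ℂ) {τ : ℂ} (hτ : 0 < τ.im) :
    HasDerivAt (fun τ => Bf n ρ j (b, τ)) (Real.pi * Complex.I * n * Bf n ρ (j + 2) (b, τ)) τ := by
  have h := (hasFDerivAt_Bf hn ρ j (p := (b, τ)) hτ).comp τ
    (hasFDerivAt_prodMk_right (𝕜 := ℂ) b τ)
  have := h.hasDerivAt
  simpa using! this

/-! ### Sums over residue classes -/

lemma tsum_int_eq_sum_residues (hn : 0 < n) {f : ℤ → ℂ} (hf : Summable f) :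
    ∑' P, f P = ∑ p ∈ Finset.range n, ∑' m : ℤ, f (n * m + p) := by
  have : NeZero n := ⟨hn.ne'⟩
  have h1 := (Int.divModEquiv n).symm.hasSum_iff.mpr hf.hasSum
  have h2 := (Equiv.prodComm (Fin n) ℤ).hasSum_iff.mpr h1
  have h3 : ∀ p : Fin n, Summable fun m : ℤ =>
      ((f ∘ (Int.divModEquiv n).symm) ∘ (Equiv.prodComm (Fin n) ℤ)) (p, m) := fun p =>
    h2.summable.comp_injective (Prod.mk_right_injective p)
  have h4 := (h2.prod_fiberwise fun p => (h3 p).hasSum).unique (hasSum_fintype _)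
  rw [h4, ← Fin.sum_univ_eq_sum_range (fun p => ∑' m : ℤ, f (n * m + p))]
  refine Finset.sum_congr rfl fun p _ => tsum_congr fun m => ?_
  simp [Int.divModEquiv, mul_comm]

lemma sum_range_add_one_of_periodic {g : ℤ → ℂ} (hg : ∀ l, g (l + n) = g l) :
    ∑ p ∈ Finset.range n, g (p + 1) = ∑ p ∈ Finset.range n, g p := by
  have h1 := Finset.sum_range_succ (fun p : ℕ => g p) n
  have h2 := Finset.sum_range_succ' (fun p : ℕ => g p) n
  have h3 := hg 0
  rw [zero_add] at h3
  push_cast at h1 h2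
  rw [h1, h3] at h2
  linear_combination -h2

lemma sum_range_neg_of_periodic {g : ℤ → ℂ} (hg : ∀ l, g (l + n) = g l) :
    ∑ p ∈ Finset.range n, g (-p) = ∑ p ∈ Finset.range n, g p := by
  rw [← Finset.sum_range_reflect, ← sum_range_add_one_of_periodic hg]
  refine Finset.sum_congr rfl fun p hp => ?_
  have : p < n := Finset.mem_range.mp hp
  rw [← hg]
  congr 1
  omega

/-! ### Transformation of the theta series -/

lemma Bf_zero_eq (n : ℕ) (ρ : ℝ) (y τ : ℂ) :
    Bf n ρ 0 (y, τ) = e (n / 2 * ρ ^ 2 * τ + n * ρ * y) *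
      jacobiTheta₂ (n * ρ * τ + n * y) (n * τ) := by
  rw [Bf, jacobiTheta₂, ← tsum_mul_left]
  refine tsum_congr fun m => ?_
  rw [bT, jacobiTheta₂_term, pow_zero, one_mul, e, e, ← Complex.exp_add]
  congr 1
  ring

lemma Bf_neg (ρ : ℝ) (y τ : ℂ) : Bf n ρ 0 (-y, τ) = Bf n (-ρ) 0 (y, τ) := by
  rw [Bf, Bf, ← (Equiv.neg ℤ).tsum_eq (fun m => bT n ρ 0 m _)]
  refine tsum_congr fun m => ?_
  simp only [bT, Equiv.neg_apply]
  push_cast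
  ring_nf

/-- The classes κ ∈ p/n + ℤ together run over (1/n)ℤ, so the twisted sum is one Jacobi theta
function of modulus τ/n. The S-law of the vector is thereby the functional equation of
`jacobiTheta₂`. -/
lemma sum_Bf_eq (hn : 0 < n) (r : ℤ) (y : ℂ) {τ : ℂ} (hτ : 0 < τ.im) :
    ∑ p ∈ Finset.range n, e (-(r * p) / n) * Bf n ((p : ℤ) / n) 0 (y, τ) =
      jacobiTheta₂ (y - r / n) (τ / n) := by
  have hn' : (n : ℂ) ≠ 0 := by exact_mod_cast hn.ne'
  have hτn : 0 < (τ / n).im := by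
    rw [Complex.div_natCast_im]; positivity
  rw [jacobiTheta₂, tsum_int_eq_sum_residues hn ((summable_jacobiTheta₂_term_iff _ _).mpr hτn)]
  refine Finset.sum_congr rfl fun p _ => ?_
  rw [Bf, ← tsum_mul_left]
  refine tsum_congr fun m => ?_
  rw [bT, pow_zero, one_mul, jacobiTheta₂_term, ← e_add, ← e_add_int _ (-(r * m)), e]
  congr 1
  push_cast
  field_simp
  ring

/-- The `S`-transformation of the vector of theta series. -/
lemma Bf_S (hn : 0 < n) (r : ℤ) (y : ℂ) {τ : ℂ} (hτ : 0 < τ.im) :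
    Bf n ((r : ℝ) / n) 0 (y / τ, -1 / τ) = (-Complex.I * τ / n) ^ (1 / 2 : ℂ) *
      e (n * y ^ 2 / (2 * τ)) *
      ∑ p ∈ Finset.range n, e (-(r * p) / n) * Bf n ((p : ℤ) / n) 0 (y, τ) := by
  have hn' : (n : ℂ) ≠ 0 := by exact_mod_cast hn.ne'
  have hτ0 : τ ≠ 0 := by rintro rfl; simp at hτ
  have h0 : (-Complex.I * (τ / n)) ^ (1 / 2 : ℂ) ≠ 0 := by
    rw [Complex.cpow_ne_zero_iff]; left
    simp [hτ0, hn']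
  rw [sum_Bf_eq hn r y hτ, jacobiTheta₂_functional_equation, Bf_zero_eq, mul_div_assoc]
  rw [show (y - r / n) / (τ / n) = n * ((r : ℝ) / n : ℝ) * (-1 / τ) + n * (y / τ) by
    push_cast; field_simp; ring, show -1 / (τ / n) = n * (-1 / τ) by field_simp]
  have hE : e (n / 2 * (((r : ℝ) / n : ℝ) : ℂ) ^ 2 * (-1 / τ) + n * (((r : ℝ) / n : ℝ) : ℂ) * (y / τ))
      = e (n * y ^ 2 / (2 * τ)) *
        Complex.exp (-Real.pi * Complex.I * (y - r / n) ^ 2 / (τ / n)) := by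
    rw [e, e, ← Complex.exp_add]
    congr 1
    push_cast
    field_simp
    ring
  rw [hE]
  generalize (-Complex.I * (τ / n)) ^ (1 / 2 : ℂ) = s at h0 ⊢
  field_simp

end

section

variable {n : ℕ} {ρ : ℝ}

/-! ### Elementary transformations of `Wf` -/

/-- A shift of ε by aτ moves κ by a inside E. No correction term appears, because the sign in `wT`
depends on m and not on κ. -/
lemma Wf_add_mul (hn : 0 < n) (ρ a : ℝ) (ε : ℂ) {τ : ℂ} (hτ : 0 < τ.im) :
    Wf n ρ 0 (ε + a * τ, τ) =
      e (n / 2 * a ^ 2 * τ + n * a * ε) * Wf n (ρ + a) 0 (ε, τ) := by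
  rw [Wf, Wf, ← tsum_mul_left]
  refine tsum_congr fun m => ?_
  have h1 : errArg n (m + ρ) (ε + a * τ, τ) = errArg n (m + (ρ + a)) (ε, τ) := by
    simp only [errArg, Complex.add_im, Complex.im_ofReal_mul]
    field_simp
    ring_nf
  rw [wT, wT, h1, pow_zero, pow_zero, one_mul, mul_left_comm, ← e_add]
  congr 2
  push_cast
  ring

lemma Wf_add_inv (hn : 0 < n) (ρ : ℝ) (ε τ : ℂ) :
    Wf n ρ 0 (ε + 1 / n, τ) = e (-ρ) * Wf n ρ 0 (ε, τ) := by
  have hn' : (n : ℂ) ≠ 0 := by exact_mod_cast hn.ne'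
  rw [Wf, Wf, ← tsum_mul_left]
  refine tsum_congr fun m => ?_
  have h1 : errArg n (m + ρ) (ε + 1 / n, τ) = errArg n (m + ρ) (ε, τ) := by
    have : (1 / (n : ℂ)).im = 0 := by
      rw [one_div, ← Complex.ofReal_natCast, ← Complex.ofReal_inv, Complex.ofReal_im]
    simp only [errArg, Complex.add_im, this, add_zero]
  rw [wT, wT, h1, pow_zero, one_mul, mul_left_comm, ← e_add,
    ← e_add_int (-(ρ : ℂ) + _) (-m)]
  congr 2
  push_cast
  field_simp
  ring

/-- Raising ρ by one reindexes m; the signs of m + 1/2 and m - 1/2 differ only at m = 0, and that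
one jump contributes the exponential. -/
lemma Wf_add_one (hn : 0 < n) (ρ : ℝ) {p : ℂ × ℂ} (hp : 0 < p.2.im) :
    Wf n (ρ + 1) 0 p = Wf n ρ 0 p - 2 * e (-(n / 2 * ρ ^ 2 * p.2 + n * ρ * p.1)) := by
  have hs := summable_wT hn (ρ + 1) 0 hp
  have hs' := (Equiv.subRight (1 : ℤ)).summable_iff.mpr hs
  have h1 : Wf n (ρ + 1) 0 p = ∑' m, wT n (ρ + 1) 0 (m - 1) p :=
    ((Equiv.subRight (1 : ℤ)).tsum_eq _).symm
  have h2 : HasSum (fun m => wT n ρ 0 m p - wT n (ρ + 1) 0 (m - 1) p)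
      (wT n ρ 0 0 p - wT n (ρ + 1) 0 (0 - 1) p) := by
    refine hasSum_single 0 fun m hm => ?_
    have : Real.sign ((m : ℝ) + 1 / 2) = Real.sign (((m - 1 : ℤ) : ℝ) + 1 / 2) := by
      rcases lt_or_gt_of_ne hm with h | h
      · have h' : (m : ℝ) ≤ -1 := by exact_mod_cast (by omega : m ≤ -1)
        rw [Real.sign_of_neg (by linarith), Real.sign_of_neg (by push_cast; linarith)]
      · have h' : (1 : ℝ) ≤ m := by exact_mod_cast (by omega : 1 ≤ m)
        rw [Real.sign_of_pos (by linarith), Real.sign_of_pos (by push_cast; linarith)]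
    rw [wT, wT, ← this]
    push_cast
    ring_nf
  have h3 := ((summable_wT hn ρ 0 hp).hasSum.sub hs'.hasSum).unique h2
  have h4 : wT n ρ 0 0 p - wT n (ρ + 1) 0 (0 - 1) p =
      2 * e (-(n / 2 * ρ ^ 2 * p.2 + n * ρ * p.1)) := by
    rw [wT, wT, Real.sign_of_pos (by norm_num), Real.sign_of_neg (by norm_num)]
    push_cast
    ring_nf
  rw [h4] at h3
  have h5 : Wf n ρ 0 p - Wf n (ρ + 1) 0 p = 2 * e (-(n / 2 * ρ ^ 2 * p.2 + n * ρ * p.1)) := by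
    rw [h1]; exact h3
  linear_combination -h5

/-- Since n = 2M is even, (n/2)(m + l/n)² = Mm² + ml + l²/(2n) is constant modulo 1 in m. -/
lemma Wf_T {M : ℕ} (hn : 0 < n) (hnM : n = 2 * M) (l : ℤ) (y τ : ℂ) {τ' : ℂ}
    (hτ' : τ' = τ + 1) :
    Wf n ((l : ℝ) / n) 0 (y, τ') = e (-(l : ℂ) ^ 2 / (2 * n)) * Wf n ((l : ℝ) / n) 0 (y, τ) := by
  have hn' : (n : ℂ) ≠ 0 := by exact_mod_cast hn.ne'
  subst hτ'
  rw [Wf, Wf, ← tsum_mul_left]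
  refine tsum_congr fun m => ?_
  have h1 : errArg n (m + (l : ℝ) / n) (y, τ + 1) = errArg n (m + (l : ℝ) / n) (y, τ) := by
    simp [errArg]
  rw [wT, wT, h1, pow_zero, one_mul, mul_left_comm, ← e_add,
    ← e_add_int (_ + -_) (-(M * m ^ 2 + m * l))]
  congr 2
  have : (n : ℂ) = 2 * M := by rw [hnM]; push_cast; rfl
  push_cast
  field_simp
  rw [this]
  ring

/-! ### The `S`-transformation of `Wf` up to holomorphic functions -/

/-- The square root appearing in the `S`-transformation. -/
def rootFactor (n : ℕ) (τ : ℂ) : ℂ := (-Complex.I * τ / n) ^ (1 / 2 : ℂ)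

lemma im_neg_one_div (τ : ℂ) : (-1 / τ).im = τ.im / Complex.normSq τ := by
  rw [neg_div, Complex.neg_im, one_div, Complex.inv_im]; ring

lemma im_neg_one_div_pos {τ : ℂ} (hτ : 0 < τ.im) : 0 < (-1 / τ).im := by
  have hτ0 : τ ≠ 0 := by rintro rfl; simp at hτ
  rw [im_neg_one_div]
  exact div_pos hτ (Complex.normSq_pos.mpr hτ0)

lemma rootFactor_ne_zero (hn : 0 < n) {τ : ℂ} (hτ : τ ≠ 0) : rootFactor n τ ≠ 0 := by
  have hn' : (n : ℂ) ≠ 0 := by exact_mod_cast hn.ne'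
  rw [rootFactor, Complex.cpow_ne_zero_iff]; left
  simp [hτ, hn']

/-- The base -iτ/n is |τ|² times the conjugate of the base at -1/τ, and both lie in the right
half-plane, so their principal square roots differ by the factor |τ|. -/
lemma rootFactor_eq (hn : 0 < n) {τ : ℂ} (hτ : 0 < τ.im) :
    rootFactor n τ = ‖τ‖ * (starRingEnd ℂ) (rootFactor n (-1 / τ)) := by
  have hn' : (n : ℂ) ≠ 0 := by exact_mod_cast hn.ne'
  have hn0 : (0 : ℝ) < n := by exact_mod_cast hn
  have hτ0 : τ ≠ 0 := by rintro rfl; simp at hτ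
  have hnorm : 0 < ‖τ‖ := norm_pos_iff.mpr hτ0
  have hnormC : (‖τ‖ : ℂ) ≠ 0 := by exact_mod_cast hnorm.ne'
  have hw : -Complex.I * τ / n ≠ 0 := by simp [hτ0, hn']
  have hre : 0 < (-Complex.I * τ / n).re := by
    rw [Complex.div_natCast_re]
    simp only [neg_mul, Complex.neg_re, Complex.mul_re, Complex.I_re, Complex.I_im]
    have : -(0 * τ.re - 1 * τ.im) = τ.im := by ring
    rw [this]; positivity
  have hcτ : (starRingEnd ℂ) τ ≠ 0 := by simpa using hτ0
  have h1 : (starRingEnd ℂ) (-Complex.I * (-1 / τ) / n) =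
      (((‖τ‖ ^ 2)⁻¹ : ℝ) : ℂ) * (-Complex.I * τ / n) := by
    have h2 := Complex.mul_conj' τ
    simp only [map_div₀, map_mul, map_neg, Complex.conj_I, map_one, map_natCast]
    push_cast
    rw [← h2]
    field_simp
  have harg : ((starRingEnd ℂ) (-Complex.I * (-1 / τ) / n)).arg ≠ Real.pi := by
    apply Complex.slitPlane_arg_ne_pi
    rw [h1, Complex.mem_slitPlane_iff]
    left
    rw [Complex.re_ofReal_mul]
    positivity
  have h3 := Complex.cpow_conj _ (1 / 2 : ℂ) harg
  rw [Complex.conj_conj] at h3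
  have h4 : (starRingEnd ℂ) (1 / 2 : ℂ) = 1 / 2 := by
    rw [map_div₀, map_one, map_ofNat]
  rw [h4] at h3
  rw [rootFactor, rootFactor, ← h3, h1,
    Complex.cpow_def_of_ne_zero hw, Complex.cpow_def_of_ne_zero
      (mul_ne_zero (by exact_mod_cast (by positivity)) hw), Complex.log_ofReal_mul (by positivity) hw,
    add_mul, Complex.exp_add, Real.log_inv, Real.log_pow]
  have h5 : Complex.exp (((-((2 : ℕ) * Real.log ‖τ‖) : ℝ) : ℂ) * (1 / 2)) = (‖τ‖ : ℂ)⁻¹ := by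
    rw [show ((-((2 : ℕ) * Real.log ‖τ‖) : ℝ) : ℂ) * (1 / 2) = ((-Real.log ‖τ‖ : ℝ) : ℂ) by
      push_cast; ring, ← Complex.ofReal_exp, Real.exp_neg, Real.exp_log hnorm]
    push_cast; rfl
  rw [h5]
  field_simp

/-- The exponents match through Im(y/τ)²/Im(-1/τ) + Im(y²/τ) = (Im y)²/Im τ, and the factor |τ|
comes from √v/v at v/|τ|². -/
lemma gaussFactor_S (hn : 0 < n) (y : ℂ) {τ : ℂ} (hτ : 0 < τ.im) :
    (gaussFactor n (y / τ, -1 / τ) : ℂ) * (e (n * y ^ 2 / (2 * τ)) *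
      (starRingEnd ℂ) (e (n * y ^ 2 / (2 * τ)))) = ‖τ‖ * gaussFactor n (y, τ) := by
  have hτ0 : τ ≠ 0 := by rintro rfl; simp at hτ
  have hnorm : 0 < ‖τ‖ := norm_pos_iff.mpr hτ0
  have hn0 : (0 : ℝ) < n := by exact_mod_cast hn
  have hN : 0 < Complex.normSq τ := Complex.normSq_pos.mpr hτ0
  rw [Complex.mul_conj', norm_e]
  have hw : (n * y ^ 2 / (2 * τ)).im = n / 2 * (y ^ 2 / τ).im := by
    rw [show n * y ^ 2 / (2 * τ) = ((n / 2 : ℝ) : ℂ) * (y ^ 2 / τ) by push_cast; field_simp,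
      Complex.im_ofReal_mul]
  have hq : (y / τ).im ^ 2 / (-1 / τ).im + (y ^ 2 / τ).im = y.im ^ 2 / τ.im := by
    rw [im_neg_one_div]
    simp only [Complex.div_im, sq, Complex.mul_im, Complex.mul_re]
    have hN' : Complex.normSq τ = τ.re * τ.re + τ.im * τ.im := Complex.normSq_apply τ
    field_simp
    rw [hN']
    ring
  rw [← Complex.ofReal_pow, ← Complex.ofReal_mul, ← Complex.ofReal_mul]
  congr 1
  rw [gaussFactor, gaussFactor, ← Real.exp_nat_mul, hw]
  simp only []
  have hsq : Real.sqrt (2 * n * (-1 / τ).im) / (-1 / τ).im =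
      ‖τ‖ * (Real.sqrt (2 * n * τ.im) / τ.im) := by
    rw [im_neg_one_div, ← mul_div_assoc, Real.sqrt_div (by positivity), Complex.normSq_eq_norm_sq,
      Real.sqrt_sq hnorm.le]
    field_simp
  rw [hsq, mul_assoc, ← Real.exp_add]
  rw [show -2 * Real.pi * n * (y / τ).im ^ 2 / (-1 / τ).im +
    (2 : ℕ) * (-2 * Real.pi * (n / 2 * (y ^ 2 / τ).im)) = -2 * Real.pi * n *
      ((y / τ).im ^ 2 / (-1 / τ).im + (y ^ 2 / τ).im) by push_cast; ring, hq]
  ring_nf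

lemma sum_conj_Bf_S (hn : 0 < n) (p : ℤ) (y : ℂ) {τ : ℂ} (hτ : 0 < τ.im) :
    (starRingEnd ℂ) (rootFactor n (-1 / τ)) * ∑ r ∈ Finset.range n, e (-(r * p) / n) *
      (starRingEnd ℂ) (Bf n ((r : ℤ) / n) 0 (y / τ, -1 / τ)) =
    (starRingEnd ℂ) (e (n * y ^ 2 / (2 * τ))) * (starRingEnd ℂ) (Bf n ((p : ℝ) / n) 0 (y, τ)) := by
  have hτ0 : τ ≠ 0 := by rintro rfl; simp at hτ
  -- Applying S at (y/τ, -1/τ) returns (-y, τ); `Bf_neg` then reverses the index, which is why -p is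
  -- used.
  have h := Bf_S hn (-p) (y / τ) (im_neg_one_div_pos hτ)
  rw [show y / τ / (-1 / τ) = -y by field_simp, show -1 / (-1 / τ) = τ by field_simp, Bf_neg,
    show -(((-p : ℤ) : ℝ) / n) = (p : ℝ) / n by push_cast; ring,
    show n * (y / τ) ^ 2 / (2 * (-1 / τ)) = -(n * y ^ 2 / (2 * τ)) by field_simp, e_neg] at h
  have h2 := congrArg (starRingEnd ℂ) h
  rw [h2]
  simp only [map_mul, map_sum, map_inv₀]
  have h0 : (starRingEnd ℂ) (e (n * y ^ 2 / (2 * τ))) ≠ 0 := by simpa using e_ne_zero _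
  rw [rootFactor]
  have h3 : ∀ r : ℕ, (starRingEnd ℂ) (e (-(((-p : ℤ) : ℂ) * r) / n)) = e (-(r * p) / n) := by
    intro r
    rw [conj_e]
    congr 1
    simp
    ring
  simp only [h3]
  have h4 : ∀ E r S : ℂ, E ≠ 0 → r * S = E * (r * E⁻¹ * S) := by
    intro E r S hE
    field_simp
  exact h4 _ _ _ h0

/-- The combination of `Wf`'s that measures the failure of the `S`-transformation. -/
def mordell (n : ℕ) (p : ℤ) (τ y : ℂ) : ℂ :=
  Wf n ((p : ℝ) / n) 0 (y, τ) - τ⁻¹ * rootFactor n τ * e (n * y ^ 2 / (2 * τ)) *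
    ∑ r ∈ Finset.range n, e (-(r * p) / n) * Wf n ((r : ℤ) / n) 0 (y / τ, -1 / τ)

/-- Both parts of `mordell` have ∂̄-derivatives that are multiples of conjugated theta series. They
cancel by combining `gaussFactor_S`, `rootFactor_eq` and the conjugated S-law `sum_conj_Bf_S`. -/
lemma differentiable_mordell (hn : 0 < n) (p : ℤ) {τ : ℂ} (hτ : 0 < τ.im) :
    Differentiable ℂ (mordell n p τ) := by
  intro y
  have hτ0 : τ ≠ 0 := by rintro rfl; simp at hτ
  have hτ' := im_neg_one_div_pos hτ
  have h1 := hasWirtinger_Wf_fst hn ((p : ℝ) / n) 0 (y := y) hτ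
  have h2 : ∀ r ∈ Finset.range n, _ := fun r _ =>
    ((hasWirtinger_Wf_fst hn (((r : ℤ) : ℝ) / n) 0 (y := τ⁻¹ * y) hτ').comp_mul_left
      τ⁻¹).const_mul (e (-(r * p) / n))
  have h3 := HasWirtinger.sum h2
  have h4 : HasDerivAt (fun y : ℂ => τ⁻¹ * rootFactor n τ * e (n * y ^ 2 / (2 * τ)))
      (deriv (fun y : ℂ => τ⁻¹ * rootFactor n τ * e (n * y ^ 2 / (2 * τ))) y) y := by
    apply DifferentiableAt.hasDerivAt
    fun_prop
  have h5 := h1.sub ((HasWirtinger.of_hasDerivAt h4).mul h3)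
  have h6 : HasWirtinger (mordell n p τ) _ _ y :=
    h5.congr (Filter.Eventually.of_forall fun z => by simp only [mordell, div_eq_inv_mul z τ])
  -- Holomorphy at y is reduced to the vanishing of the ∂̄-coefficient.
  have hβ : ∀ {α β : ℂ}, HasWirtinger (mordell n p τ) α β y → β = 0 →
      DifferentiableAt ℂ (mordell n p τ) y := by
    rintro α β h rfl
    exact h.hasDerivAt.differentiableAt
  refine hβ h6 ?_
  rw [zero_mul, zero_add, show τ⁻¹ * y = y / τ from (div_eq_inv_mul y τ).symm]
  have hG := gaussFactor_S hn y hτ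
  have hB := sum_conj_Bf_S hn p y hτ
  have hr := rootFactor_eq hn hτ
  have hN := Complex.mul_conj' τ
  have hsum : ∑ i ∈ Finset.range n, e (-(↑i * ↑p) / ↑n) *
      (-(Complex.I / 2 * (gaussFactor n (y / τ, -1 / τ) : ℂ) *
        (starRingEnd ℂ) (Bf n ((i : ℤ) / n) 0 (y / τ, -1 / τ))) * (starRingEnd ℂ) τ⁻¹) =
      -(Complex.I / 2) * gaussFactor n (y / τ, -1 / τ) * (starRingEnd ℂ) τ⁻¹ *
      ∑ r ∈ Finset.range n, e (-(r * p) / n) *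
      (starRingEnd ℂ) (Bf n ((r : ℤ) / n) 0 (y / τ, -1 / τ)) := by
    rw [Finset.mul_sum]
    exact Finset.sum_congr rfl fun i _ => by ring
  rw [hsum, hr]
  have hnorm : (‖τ‖ : ℂ) ≠ 0 := by exact_mod_cast (norm_pos_iff.mpr hτ0).ne'
  have hcτ : (starRingEnd ℂ) τ ≠ 0 := by simpa using hτ0
  rw [map_inv₀]
  have key : τ⁻¹ * (‖τ‖ * (starRingEnd ℂ) (rootFactor n (-1 / τ))) * e (n * y ^ 2 / (2 * τ)) *
      (-(Complex.I / 2) * gaussFactor n (y / τ, -1 / τ) * ((starRingEnd ℂ) τ)⁻¹ *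
      ∑ r ∈ Finset.range n, e (-(r * p) / n) *
      (starRingEnd ℂ) (Bf n ((r : ℤ) / n) 0 (y / τ, -1 / τ))) =
      -(Complex.I / 2) * (‖τ‖ * (τ⁻¹ * ((starRingEnd ℂ) τ)⁻¹)) * e (n * y ^ 2 / (2 * τ)) *
      gaussFactor n (y / τ, -1 / τ) * ((starRingEnd ℂ) (rootFactor n (-1 / τ)) *
      ∑ r ∈ Finset.range n, e (-(r * p) / n) *
      (starRingEnd ℂ) (Bf n ((r : ℤ) / n) 0 (y / τ, -1 / τ))) := by ring
  rw [key, hB, ← mul_inv, hN]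
  have hG' : e (n * y ^ 2 / (2 * τ)) * gaussFactor n (y / τ, -1 / τ) *
      (starRingEnd ℂ) (e (n * y ^ 2 / (2 * τ))) = ‖τ‖ * gaussFactor n (y, τ) := by
    rw [← hG]; ring
  have : -(Complex.I / 2) * (‖τ‖ * ((‖τ‖ : ℂ) ^ 2)⁻¹) * e (n * y ^ 2 / (2 * τ)) *
      gaussFactor n (y / τ, -1 / τ) * ((starRingEnd ℂ) (e (n * y ^ 2 / (2 * τ))) *
        (starRingEnd ℂ) (Bf n ((p : ℝ) / n) 0 (y, τ))) =
      -(Complex.I / 2) * (‖τ‖ * ((‖τ‖ : ℂ) ^ 2)⁻¹) * (e (n * y ^ 2 / (2 * τ)) *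
      gaussFactor n (y / τ, -1 / τ) * (starRingEnd ℂ) (e (n * y ^ 2 / (2 * τ)))) *
        (starRingEnd ℂ) (Bf n ((p : ℝ) / n) 0 (y, τ)) := by ring
  rw [this, hG']
  field_simp
  ring

end

section

variable {n : ℕ}

/-! ### Sums with simple poles at the lattice -/

/-- `u` is not in `ℤτ + ℤ`. -/
def LatticeFree (τ u : ℂ) : Prop := ∀ m : ℤ, e (u + m * τ) ≠ 1

lemma LatticeFree.add_int_mul_add_int {τ u : ℂ} (h : LatticeFree τ u) (a b : ℤ) :
    LatticeFree τ (u + a * τ + b) := fun m => by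
  have := h (m + a)
  rwa [show u + a * τ + b + m * τ = u + (m + a : ℤ) * τ + (b : ℤ) by push_cast; ring, e_add_int]

lemma latticeFree_iff {τ u : ℂ} : LatticeFree τ u ↔ ∀ a b : ℤ, u ≠ a * τ + b := by
  constructor
  · intro h a b hu
    apply h (-a)
    rw [e_eq_one_iff]
    exact ⟨b, by rw [hu]; push_cast; ring⟩
  · intro h m hm
    obtain ⟨b, hb⟩ := (e_eq_one_iff _).mp hm
    exact h (-m) b (by push_cast; linear_combination hb)

lemma LatticeFree.S {τ u : ℂ} (hτ : τ ≠ 0) (h : LatticeFree τ u) :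
    LatticeFree (-1 / τ) (u / τ) := by
  rw [latticeFree_iff] at h ⊢
  intro a b hu
  apply h b (-a)
  field_simp at hu
  push_cast
  linear_combination hu

lemma exists_uniform_pos {α : Type*} {l : Filter α} (s : Finset ℤ) (f : ℤ → α → ℝ)
    (h : ∀ m ∈ s, ∃ δ > 0, ∀ᶠ q in l, δ ≤ f m q) :
    ∃ δ > 0, ∀ᶠ q in l, ∀ m ∈ s, δ ≤ f m q := by
  classical
  induction s using Finset.induction_on with
  | empty => exact ⟨1, one_pos, by simp⟩
  | insert a s _ ih =>
    obtain ⟨δ, hδ, h1⟩ := ih fun m hm => h m (Finset.mem_insert_of_mem hm)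
    obtain ⟨δ', hδ', h2⟩ := h a (Finset.mem_insert_self a s)
    refine ⟨min δ δ', lt_min hδ hδ', ?_⟩
    filter_upwards [h1, h2] with q hq1 hq2 m hm
    rcases Finset.mem_insert.mp hm with rfl | hm
    · exact (min_le_right _ _).trans hq2
    · exact (min_le_left _ _).trans (hq1 m hm)

lemma le_norm_one_sub_e {w : ℂ} (hw : 1 ≤ |w.im|) : 1 / 2 ≤ ‖1 - e w‖ := by
  have hpi := Real.pi_gt_three
  rcases le_abs.mp hw with h | h
  · have h1 : ‖e w‖ ≤ 1 / 2 := by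
      rw [norm_e]
      calc Real.exp (-2 * Real.pi * w.im) ≤ Real.exp (-1) := Real.exp_le_exp.mpr (by nlinarith)
        _ ≤ 1 / 2 := by
          rw [Real.exp_neg, one_div]
          exact inv_anti₀ two_pos (by linarith [Real.add_one_le_exp (1 : ℝ)])
    have h2 := norm_sub_norm_le (1 : ℂ) (e w)
    rw [norm_one] at h2
    linarith
  · have h1 : 2 ≤ ‖e w‖ := by
      rw [norm_e]
      calc (2 : ℝ) ≤ Real.exp 1 := by linarith [Real.add_one_le_exp (1 : ℝ)]
        _ ≤ _ := Real.exp_le_exp.mpr (by nlinarith)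
    have h2 := norm_sub_norm_le (e w) (1 : ℂ)
    rw [norm_one, norm_sub_rev] at h2
    linarith

/-- For large |m| the imaginary part of u + mτ is at least 1 in absolute value and 1 - e is bounded
below; the finitely many remaining m are handled by continuity. Indices with a pole at the base
point are excepted, so that a single pole can later be split off. -/
lemma exists_lower_bound (u₀ : ℂ) {τ₀ : ℂ} (hτ₀ : 0 < τ₀.im) :
    ∃ δ > 0, ∀ᶠ q : ℂ × ℂ in nhds (u₀, τ₀), ∀ m : ℤ,
      e (u₀ + m * τ₀) = 1 ∨ δ ≤ ‖1 - e (q.1 + m * q.2)‖ := by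
  classical
  -- For |m| ≥ N one has |m| Im τ₀/2 ≥ |Im u₀| + 2, which leaves imaginary part at least 1 after Im
  -- u has varied by up to 1.
  obtain ⟨N, hN⟩ := exists_nat_ge ((|u₀.im| + 2) / (τ₀.im / 2))
  rw [div_le_iff₀ (by positivity)] at hN
  obtain ⟨δ, hδ, h1⟩ := exists_uniform_pos (l := nhds (u₀, τ₀))
    ((Finset.Icc (-(N : ℤ)) N).filter fun m => e (u₀ + m * τ₀) ≠ 1)
    (fun m q => ‖1 - e (q.1 + m * q.2)‖) (fun m hm => by
      have hm1 : e (u₀ + m * τ₀) ≠ 1 := (Finset.mem_filter.mp hm).2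
      have hpos : 0 < ‖1 - e (u₀ + m * τ₀)‖ := norm_pos_iff.mpr (sub_ne_zero.mpr hm1.symm)
      have hc : ContinuousAt (fun q : ℂ × ℂ => ‖1 - e (q.1 + m * q.2)‖) (u₀, τ₀) := by
        have := continuous_e
        fun_prop
      exact ⟨‖1 - e (u₀ + m * τ₀)‖ / 2, by positivity,
        (hc.eventually_const_lt (by simpa using half_lt_self hpos)).mono fun q hq => hq.le⟩)
  have h2 : ∀ᶠ q : ℂ × ℂ in nhds (u₀, τ₀), |q.1.im| < |u₀.im| + 1 := by
    have hc : ContinuousAt (fun q : ℂ × ℂ => |q.1.im|) (u₀, τ₀) := by fun_prop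
    exact hc.eventually_lt_const (by simp)
  have h3 : ∀ᶠ q : ℂ × ℂ in nhds (u₀, τ₀), τ₀.im / 2 < q.2.im := by
    have hc : ContinuousAt (fun q : ℂ × ℂ => q.2.im) (u₀, τ₀) := by fun_prop
    exact hc.eventually_const_lt (half_lt_self hτ₀)
  refine ⟨min δ (1 / 2), lt_min hδ (by norm_num), ?_⟩
  filter_upwards [h1, h2, h3] with q hq1 hq2 hq3 m
  by_cases hm : e (u₀ + m * τ₀) = 1
  · exact Or.inl hm
  right
  by_cases hmN : m ∈ Finset.Icc (-(N : ℤ)) N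
  · exact (min_le_left _ _).trans (hq1 m (Finset.mem_filter.mpr ⟨hmN, hm⟩))
  · refine (min_le_right _ _).trans (le_norm_one_sub_e ?_)
    have hmabs : (N : ℝ) ≤ |(m : ℝ)| := by
      rw [Finset.mem_Icc, not_and_or] at hmN
      have : (N : ℤ) ≤ |m| := by
        rcases hmN with h | h
        · exact (by omega : (N : ℤ) ≤ -m).trans (neg_le_abs m)
        · exact (by omega : (N : ℤ) ≤ m).trans (le_abs_self m)
      exact_mod_cast this
    have him : (q.1 + m * q.2).im = m * q.2.im + q.1.im := by
      simp [add_comm]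
    rw [him]
    have h4 := abs_sub_abs_le_abs_sub (m * q.2.im) (-q.1.im)
    rw [abs_neg, sub_neg_eq_add, abs_mul, abs_of_pos (lt_trans (by positivity) hq3)] at h4
    have h5 : (N : ℝ) * (τ₀.im / 2) ≤ |(m : ℝ)| * q.2.im := by
      gcongr
    linarith

lemma norm_pole_term_le {c : ℝ} {u τ : ℂ} {p : ℤ} {δ R : ℝ} (hδ : 0 < δ) (hτ : 0 < τ.im)
    (h : δ ≤ ‖1 - e (u + p * τ)‖) (hR : |u.im| ≤ R) :
    ‖e (c * (u + p * τ)) / (1 - e (u + p * τ))‖ ≤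
      Real.exp (2 * Real.pi * |c| * R) / δ * Real.exp (2 * Real.pi * |c| * τ.im * |(p : ℝ)|) := by
  rw [norm_div, norm_e, Complex.im_ofReal_mul]
  have him : (u + p * τ).im = u.im + p * τ.im := by simp
  have h1 : Real.exp (-2 * Real.pi * (c * (u + p * τ).im)) ≤
      Real.exp (2 * Real.pi * |c| * R) * Real.exp (2 * Real.pi * |c| * τ.im * |(p : ℝ)|) := by
    rw [← Real.exp_add, him]
    apply Real.exp_le_exp.mpr
    have h2 : -(c * (u.im + p * τ.im)) ≤ |c| * (R + τ.im * |(p : ℝ)|) := by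
      refine (neg_le_abs _).trans ?_
      rw [abs_mul]
      gcongr
      refine (abs_add_le _ _).trans ?_
      rw [abs_mul, abs_of_pos hτ, mul_comm]
      gcongr
    nlinarith [Real.pi_pos, mul_le_mul_of_nonneg_left h2 Real.pi_pos.le]
  calc _ ≤ (Real.exp (2 * Real.pi * |c| * R) *
        Real.exp (2 * Real.pi * |c| * τ.im * |(p : ℝ)|)) / δ := by gcongr
    _ = _ := by ring

/-- `∑ g_p X_p^c / (1 - X_p)` with `X_p = e(u + pτ)`. -/
def poleSum (g : ℤ → ℂ) (c : ℝ) (τ u : ℂ) : ℂ :=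
  ∑' p : ℤ, g p * (e (c * (u + p * τ)) / (1 - e (u + p * τ)))

/-- Gaussian decay of a sequence. -/
def GaussDecay (g : ℤ → ℂ) : Prop :=
  ∃ A > 0, ∃ B K : ℝ, ∀ p : ℤ, ‖g p‖ ≤ K * Real.exp (-A * (p : ℝ) ^ 2 + B * |(p : ℝ)|)

lemma GaussDecay.summable {g : ℤ → ℂ} (h : GaussDecay g) : Summable g := by
  obtain ⟨A, hA, B, K, h⟩ := h
  have := (summable_gauss' 0 hA B).mul_left K
  simp only [add_zero] at this
  exact Summable.of_norm_bounded this h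

lemma GaussDecay.mul_exp {g f : ℤ → ℂ} (h : GaussDecay g) {D K' : ℝ} (hK' : 0 ≤ K')
    (hf : ∀ p, g p ≠ 0 → ‖f p‖ ≤ K' * Real.exp (D * |(p : ℝ)|)) :
    GaussDecay fun p => g p * f p := by
  obtain ⟨A, hA, B, K, h⟩ := h
  have hK : 0 ≤ K := nonneg_of_mul_nonneg_left ((norm_nonneg _).trans (h 0)) (Real.exp_pos _)
  refine ⟨A, hA, B + D, K * K', fun p => ?_⟩
  by_cases hp : g p = 0
  · simp only [hp, zero_mul, norm_zero]
    positivity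
  · rw [norm_mul]
    calc ‖g p‖ * ‖f p‖ ≤ (K * Real.exp (-A * (p : ℝ) ^ 2 + B * |(p : ℝ)|)) *
        (K' * Real.exp (D * |(p : ℝ)|)) :=
          mul_le_mul (h p) (hf p hp) (norm_nonneg _) ((norm_nonneg _).trans (h p))
      _ = K * K' * (Real.exp (-A * (p : ℝ) ^ 2 + B * |(p : ℝ)|) * Real.exp (D * |(p : ℝ)|)) := by
          ring
      _ = _ := by rw [← Real.exp_add]; ring_nf

lemma summable_poleSum {g : ℤ → ℂ} (hg : GaussDecay g) (c : ℝ) {τ u : ℂ} (hτ : 0 < τ.im)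
    (hu : LatticeFree τ u) :
    Summable fun p : ℤ => g p * (e (c * (u + p * τ)) / (1 - e (u + p * τ))) := by
  obtain ⟨δ, hδ, h⟩ := exists_lower_bound u hτ
  have h' := h.self_of_nhds
  exact (hg.mul_exp (by positivity) fun p _ =>
    norm_pole_term_le hδ hτ ((h' p).resolve_left (hu p)) le_rfl).summable

/-- A pole at u₀ is allowed when its coefficient is zero. Thus the lemma also covers the sum from
which the polar term at the origin has been deleted. -/
lemma differentiableAt_poleSum {g : ℤ → ℂ} (hg : GaussDecay g) (c : ℝ) {τ u₀ : ℂ} (hτ : 0 < τ.im)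
    (hu : ∀ p : ℤ, g p = 0 ∨ e (u₀ + p * τ) ≠ 1) :
    ∀ᶠ u in nhds u₀, DifferentiableAt ℂ (poleSum g c τ) u := by
  obtain ⟨δ, hδ, h⟩ := exists_lower_bound u₀ hτ
  have hc : ContinuousAt (fun u : ℂ => (u, τ)) u₀ := by fun_prop
  have h2 := hc.eventually h
  have h3 : ∀ᶠ u : ℂ in nhds u₀, |u.im| < |u₀.im| + 1 := by
    have hc : ContinuousAt (fun u : ℂ => |u.im|) u₀ := by fun_prop
    exact hc.eventually_lt_const (by simp)
  obtain ⟨r, hr, hball⟩ := Metric.eventually_nhds_iff_ball.mp (h2.and h3)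
  obtain ⟨A, hA, B, K, hg⟩ := hg
  have hK : 0 ≤ K := nonneg_of_mul_nonneg_left ((norm_nonneg _).trans (hg 0)) (Real.exp_pos _)
  have hpole : ∀ p : ℤ, ∀ u ∈ Metric.ball u₀ r, g p = 0 ∨ δ ≤ ‖1 - e (u + p * τ)‖ := by
    intro p u hu'
    rcases hu p with h0 | h1
    · exact Or.inl h0
    · exact Or.inr (((hball u hu').1 p).resolve_left h1)
  have hd : DifferentiableOn ℂ (poleSum g c τ) (Metric.ball u₀ r) := by
    refine Complex.differentiableOn_tsum_of_summable_norm (u := fun p : ℤ =>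
      K * Real.exp (-A * (p : ℝ) ^ 2 + B * |(p : ℝ)|) *
        (Real.exp (2 * Real.pi * |c| * (|u₀.im| + 1)) / δ *
        Real.exp (2 * Real.pi * |c| * τ.im * |(p : ℝ)|))) ?_ (fun p u hu' => ?_)
      Metric.isOpen_ball (fun p u hu' => ?_)
    · have := (summable_gauss' 0 hA (B + 2 * Real.pi * |c| * τ.im)).mul_left
        (K * (Real.exp (2 * Real.pi * |c| * (|u₀.im| + 1)) / δ))
      refine this.congr fun p => ?_
      rw [add_zero, show -A * (p : ℝ) ^ 2 + (B + 2 * Real.pi * |c| * τ.im) * |(p : ℝ)| =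
        (-A * (p : ℝ) ^ 2 + B * |(p : ℝ)|) + 2 * Real.pi * |c| * τ.im * |(p : ℝ)| by ring,
        Real.exp_add]
      ring
    · rcases hpole p u hu' with h0 | h1
      · simp only [h0, zero_mul]
        exact differentiableWithinAt_const _
      · have hne : 1 - e (u + p * τ) ≠ 0 := norm_pos_iff.mp (hδ.trans_le h1)
        have : DifferentiableAt ℂ (fun u => g p * (e (c * (u + p * τ)) / (1 - e (u + p * τ)))) u := by
          fun_prop (disch := exact hne)
        exact this.differentiableWithinAt
    · rcases hpole p u hu' with h0 | h1
      · rw [h0, zero_mul, norm_zero]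
        positivity
      · rw [norm_mul]
        exact mul_le_mul (hg p) (norm_pole_term_le hδ hτ h1 (hball u hu').2.le) (norm_nonneg _)
          ((norm_nonneg _).trans (hg p))
  exact (Metric.ball_mem_nhds u₀ hr |> fun h => Filter.eventually_of_mem h fun u hu' =>
    (hd u hu').differentiableAt (Metric.isOpen_ball.mem_nhds hu'))

/-! ### The level `n` Appell function attached to a periodic sequence -/

/-- The coefficients of `Hf`. -/
def coeffH (n : ℕ) (b : ℤ → ℂ) (l : ℤ) (t τ : ℂ) (p : ℤ) : ℂ :=
  b (p - l) * e ((p : ℂ) ^ 2 / (2 * n) * τ + p * t)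

/-- The meromorphic part: a level `n` Appell function with coefficients `b`. -/
def Hf (n : ℕ) (b : ℤ → ℂ) (l : ℤ) (t u τ : ℂ) : ℂ :=
  poleSum (coeffH n b l t τ) (1 - l / n) τ u

/-- The theta function with coefficients `b`. -/
def fB (n : ℕ) (b : ℤ → ℂ) (x τ : ℂ) : ℂ :=
  ∑' p : ℤ, b p * e ((p : ℂ) ^ 2 / (2 * n) * τ + p * x)

/-- The completed function. -/
def Gf (n : ℕ) (b : ℤ → ℂ) (l : ℤ) (t u τ : ℂ) : ℂ :=
  Hf n b l t u τ / fB n b t τ + 1 / 2 * Wf n ((l : ℝ) / n) 0 (u / n - t, τ)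

lemma exists_bound_of_periodic (hn : 0 < n) {b : ℤ → ℂ} (hb : ∀ l, b (l + n) = b l) :
    ∃ C, 0 ≤ C ∧ ∀ l, ‖b l‖ ≤ C := by
  have hper : Function.Periodic b (n : ℤ) := hb
  refine ⟨∑ p ∈ Finset.range n, ‖b p‖, by positivity, fun l => ?_⟩
  have hnz : (n : ℤ) ≠ 0 := by exact_mod_cast hn.ne'
  have h1 : b l = b (l % n) := by
    have := hper.int_mul (-(l / n)) l
    rw [← this]
    congr 1
    have := Int.emod_add_mul_ediv l n
    push_cast
    linear_combination -this
  have h2 := Int.emod_nonneg l hnz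
  have h3 := Int.emod_lt_of_pos l (by exact_mod_cast hn : (0 : ℤ) < n)
  obtain ⟨k, hk⟩ := Int.eq_ofNat_of_zero_le h2
  rw [h1, hk]
  exact Finset.single_le_sum (f := fun p : ℕ => ‖b p‖) (fun _ _ => norm_nonneg _)
    (Finset.mem_range.mpr (by omega))

lemma gaussDecay_coeffH (hn : 0 < n) {b : ℤ → ℂ} (hb : ∀ l, b (l + n) = b l) (l : ℤ) (t : ℂ)
    {τ : ℂ} (hτ : 0 < τ.im) : GaussDecay (coeffH n b l t τ) := by
  obtain ⟨C, hC, hbC⟩ := exists_bound_of_periodic hn hb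
  have hn0 : (0 : ℝ) < n := by exact_mod_cast hn
  refine ⟨Real.pi * τ.im / n, by positivity, 2 * Real.pi * |t.im|, C, fun p => ?_⟩
  rw [coeffH, norm_mul, norm_e]
  have him : ((p : ℂ) ^ 2 / (2 * n) * τ + p * t).im = (p : ℝ) ^ 2 / (2 * n) * τ.im + p * t.im := by
    rw [show (p : ℂ) ^ 2 / (2 * n) * τ + p * t = (((p : ℝ) ^ 2 / (2 * n) : ℝ) : ℂ) * τ +
      ((p : ℝ) : ℂ) * t by push_cast; ring, Complex.add_im, Complex.im_ofReal_mul,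
      Complex.im_ofReal_mul]
  rw [him]
  refine mul_le_mul (hbC _) (Real.exp_le_exp.mpr ?_) (Real.exp_pos _).le hC
  have h1 : -((p : ℝ) * t.im) ≤ |t.im| * |(p : ℝ)| := by
    rw [← abs_mul, mul_comm]; exact neg_le_abs _
  have h2 : -2 * Real.pi * ((p : ℝ) ^ 2 / (2 * n) * τ.im) = -(Real.pi * τ.im / n) * (p : ℝ) ^ 2 := by
    field_simp
  nlinarith [mul_le_mul_of_nonneg_left h1 Real.pi_pos.le]

lemma summable_fB (hn : 0 < n) {b : ℤ → ℂ} (hb : ∀ l, b (l + n) = b l) (x : ℂ) {τ : ℂ}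
    (hτ : 0 < τ.im) : Summable fun p : ℤ => b p * e ((p : ℂ) ^ 2 / (2 * n) * τ + p * x) := by
  have := (gaussDecay_coeffH hn hb 0 x hτ).summable
  refine this.congr fun p => ?_
  rw [coeffH, sub_zero]

lemma Hf_add_one (hn : 0 < n) (b : ℤ → ℂ) (l : ℤ) (t u τ : ℂ) :
    Hf n b l t (u + 1) τ = e (-l / n) * Hf n b l t u τ := by
  have hn' : (n : ℂ) ≠ 0 := by exact_mod_cast hn.ne'
  rw [Hf, Hf, poleSum, poleSum, ← tsum_mul_left]
  refine tsum_congr fun p => ?_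
  have h1 : e (u + 1 + p * τ) = e (u + p * τ) := by
    rw [show u + 1 + p * τ = u + p * τ + (1 : ℤ) by push_cast; ring, e_add_int]
  have h2 : e (((1 - l / n : ℝ) : ℂ) * (u + 1 + p * τ)) =
      e (-l / n) * e (((1 - l / n : ℝ) : ℂ) * (u + p * τ)) := by
    rw [← e_add, ← e_add_int (-l / n + _) 1]
    congr 1
    push_cast
    ring
  rw [h1, h2]
  ring

/-- Reindexing p by p - 1 restores the denominators and moves l to l + 1; translation by τ therefore
permutes the components of a vector indexed by l. -/
lemma Hf_add_tau (hn : 0 < n) (b : ℤ → ℂ) (l : ℤ) (t u τ : ℂ) :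
    Hf n b l t (u + τ) τ = e (τ / (2 * n) + (u / n - t)) * Hf n b (l + 1) t u τ := by
  have hn' : (n : ℂ) ≠ 0 := by exact_mod_cast hn.ne'
  rw [Hf, Hf, poleSum, poleSum, ← tsum_mul_left, ← (Equiv.subRight (1 : ℤ)).tsum_eq]
  refine tsum_congr fun p => ?_
  rw [Equiv.subRight_apply]
  have h1 : u + τ + ((p - 1 : ℤ) : ℂ) * τ = u + p * τ := by push_cast; ring
  rw [h1, coeffH, coeffH, show p - 1 - l = p - (l + 1) by ring]
  have h2 : e (((p - 1 : ℤ) : ℂ) ^ 2 / (2 * n) * τ + ((p - 1 : ℤ) : ℂ) * t) *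
      e (((1 - l / n : ℝ) : ℂ) * (u + p * τ)) =
      e (τ / (2 * n) + (u / n - t)) * (e ((p : ℂ) ^ 2 / (2 * n) * τ + p * t) *
      e (((1 - (l + 1 : ℤ) / n : ℝ) : ℂ) * (u + p * τ))) := by
    rw [← e_add, ← e_add, ← e_add]
    congr 1
    push_cast
    field_simp
    ring
  linear_combination (b (p - (l + 1)) / (1 - e (u + p * τ))) * h2

/-- Termwise, X^{-l/n}/(1 - X) = X^{1-l/n}/(1 - X) + X^{-l/n}, and the last summands add up to the
theta function `fB`. -/
lemma Hf_add_n (hn : 0 < n) {b : ℤ → ℂ} (hb : ∀ l, b (l + n) = b l) (l : ℤ) (t : ℂ) {u τ : ℂ}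
    (hτ : 0 < τ.im) (hu : LatticeFree τ u) :
    Hf n b (l + n) t u τ = Hf n b l t u τ +
      fB n b t τ * e (-((l : ℂ) ^ 2 / (2 * n) * τ + l * (u / n - t))) := by
  have hn' : (n : ℂ) ≠ 0 := by exact_mod_cast hn.ne'
  have hs1 := summable_poleSum (gaussDecay_coeffH hn hb l t hτ) (1 - l / n) hτ hu
  have hs2 := (summable_fB hn hb t hτ).mul_right
    (e (-((l : ℂ) ^ 2 / (2 * n) * τ + l * (u / n - t))))
  have hs2' := (Equiv.subRight l).summable_iff.mpr hs2
  rw [Hf, Hf, fB, ← tsum_mul_right, ← (Equiv.subRight l).tsum_eq (fun p => b p * _ * _), poleSum,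
    poleSum]
  refine Eq.trans (tsum_congr fun p => ?_) (hs1.tsum_add hs2')
  have hne : 1 - e (u + p * τ) ≠ 0 := sub_ne_zero.mpr (hu p).symm
  have hb' : b (p - (l + n)) = b (p - l) := by rw [← hb]; congr 1; ring
  simp only [coeffH, Equiv.subRight_apply, hb']
  have h1 : e ((p : ℂ) ^ 2 / (2 * n) * τ + p * t) * e (-(l / n * (u + p * τ))) =
      e (((p - l : ℤ) : ℂ) ^ 2 / (2 * n) * τ + ((p - l : ℤ) : ℂ) * t) *
        e (-((l : ℂ) ^ 2 / (2 * n) * τ + l * (u / n - t))) := by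
    rw [← e_add, ← e_add]
    congr 1
    push_cast
    field_simp
    ring
  have h2 : e (((1 - (l + n : ℤ) / n : ℝ) : ℂ) * (u + p * τ)) = e (-(l / n * (u + p * τ))) := by
    congr 1
    push_cast
    field_simp
    ring
  have h3 : e (((1 - l / n : ℝ) : ℂ) * (u + p * τ)) =
      e (u + p * τ) * e (-(l / n * (u + p * τ))) := by
    rw [← e_add]
    congr 1
    push_cast
    ring
  rw [h2, h3, mul_assoc (b (p - l)) (e (((p - l : ℤ) : ℂ) ^ 2 / (2 * n) * τ + _)), ← h1]
  field_simp
  ring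

lemma Gf_add_one (hn : 0 < n) (b : ℤ → ℂ) (l : ℤ) (t u τ : ℂ) :
    Gf n b l t (u + 1) τ = e (-l / n) * Gf n b l t u τ := by
  rw [Gf, Gf, Hf_add_one hn, show (u + 1) / n - t = u / n - t + 1 / n by ring, Wf_add_inv hn]
  have : e (-(((l : ℝ) / n : ℝ) : ℂ)) = e (-l / n) := by
    congr 1; push_cast; ring
  rw [this]
  ring

lemma Gf_add_tau (hn : 0 < n) (b : ℤ → ℂ) (l : ℤ) (t u : ℂ) {τ : ℂ} (hτ : 0 < τ.im) :
    Gf n b l t (u + τ) τ = e (τ / (2 * n) + (u / n - t)) * Gf n b (l + 1) t u τ := by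
  have hn' : (n : ℂ) ≠ 0 := by exact_mod_cast hn.ne'
  rw [Gf, Gf, Hf_add_tau hn, show (u + τ) / n - t = u / n - t + ((1 / n : ℝ) : ℂ) * τ by
    push_cast; ring, Wf_add_mul hn _ _ _ hτ]
  have h1 : e (n / 2 * ((1 / n : ℝ) : ℂ) ^ 2 * τ + n * ((1 / n : ℝ) : ℂ) * (u / n - t)) =
      e (τ / (2 * n) + (u / n - t)) := by
    congr 1; push_cast; field_simp
  have h2 : (l : ℝ) / n + 1 / n = ((l + 1 : ℤ) : ℝ) / n := by push_cast; ring
  rw [h1, h2]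
  ring

/-- The exponential left over by `Hf_add_n` after division by `fB` is cancelled by half of the jump
in `Wf_add_one`. The completion restores exact periodicity in l. -/
lemma Gf_add_n (hn : 0 < n) {b : ℤ → ℂ} (hb : ∀ l, b (l + n) = b l) (l : ℤ) {t u τ : ℂ}
    (hτ : 0 < τ.im) (hf : fB n b t τ ≠ 0) (hu : LatticeFree τ u) :
    Gf n b (l + n) t u τ = Gf n b l t u τ := by
  have hn' : (n : ℝ) ≠ 0 := by exact_mod_cast hn.ne'
  have hn'' : (n : ℂ) ≠ 0 := by exact_mod_cast hn.ne'
  rw [Gf, Gf, Hf_add_n hn hb l t hτ hu, show ((l + n : ℤ) : ℝ) / n = (l : ℝ) / n + 1 by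
    push_cast; field_simp, Wf_add_one hn _ (by exact hτ)]
  have h1 : e (-(n / 2 * (((l : ℝ) / n : ℝ) : ℂ) ^ 2 * τ + n * (((l : ℝ) / n : ℝ) : ℂ) * (u / n - t)))
      = e (-((l : ℂ) ^ 2 / (2 * n) * τ + l * (u / n - t))) := by
    congr 1; push_cast; field_simp
  simp only []
  rw [h1]
  field_simp
  ring

end

section

variable {n : ℕ} {b b' : ℤ → ℂ} {τ : ℂ}

/-! ### The `S`-transformation of `Gf` -/

lemma fB_eq_sum (hn : 0 < n) (hb : ∀ l, b (l + n) = b l) (x : ℂ) (hτ : 0 < τ.im) :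
    fB n b x τ = ∑ r ∈ Finset.range n, b r * Bf n ((r : ℤ) / n) 0 (x, τ) := by
  have hn' : (n : ℂ) ≠ 0 := by exact_mod_cast hn.ne'
  rw [fB, tsum_int_eq_sum_residues hn (summable_fB hn hb x hτ)]
  refine Finset.sum_congr rfl fun r _ => ?_
  rw [Bf, ← tsum_mul_left]
  refine tsum_congr fun m => ?_
  have h1 : b (n * m + r) = b r := by
    have hper : Function.Periodic b (n : ℤ) := hb
    rw [← hper.int_mul m r]
    congr 1
    push_cast
    ring
  rw [h1, bT, pow_zero, one_mul]
  congr 2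
  push_cast
  field_simp

lemma fB_S (hn : 0 < n) (hb' : ∀ l, b' (l + n) = b' l) (hb : ∀ l, b (l + n) = b l)
    (h : ∀ p, b p = ∑ r ∈ Finset.range n, e (-(r * p) / n) * b' r) (x : ℂ) (hτ : 0 < τ.im) :
    fB n b' (x / τ) (-1 / τ) = rootFactor n τ * e (n * x ^ 2 / (2 * τ)) * fB n b x τ := by
  rw [fB_eq_sum hn hb' _ (im_neg_one_div_pos hτ), fB_eq_sum hn hb _ hτ]
  have h1 : ∀ r ∈ Finset.range n, b' r * Bf n (((r : ℤ) : ℝ) / n) 0 (x / τ, -1 / τ) =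
      ∑ p ∈ Finset.range n, rootFactor n τ * e (n * x ^ 2 / (2 * τ)) *
        (e (-(r * p) / n) * b' r * Bf n ((p : ℤ) / n) 0 (x, τ)) := by
    intro r _
    rw [Bf_S hn r x hτ, ← rootFactor, mul_left_comm, ← mul_assoc, Finset.mul_sum]
    refine Finset.sum_congr rfl fun p _ => ?_
    push_cast
    ring
  rw [Finset.sum_congr rfl h1, Finset.sum_comm, Finset.mul_sum]
  refine Finset.sum_congr rfl fun p _ => ?_
  rw [h p, ← Finset.mul_sum, Finset.sum_mul]
  push_cast
  rfl

/-- The automorphy factor of the `S`-transformation of `Gf`. -/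
def jacS (n : ℕ) (t τ u : ℂ) : ℂ :=
  τ⁻¹ * rootFactor n τ * e (n * (u / n - t) ^ 2 / (2 * τ))

/-- The transform of the vector `Gf` under `S`. -/
def GfS (n : ℕ) (b' : ℤ → ℂ) (p : ℤ) (t τ u : ℂ) : ℂ :=
  jacS n t τ u * ∑ r ∈ Finset.range n, e (-(r * p) / n) * Gf n b' r (t / τ) (u / τ) (-1 / τ)

lemma GfS_add_tau (hn : 0 < n) (p : ℤ) (t u : ℂ) (hτ : τ ≠ 0) :
    GfS n b' p t τ (u + τ) = e (τ / (2 * n) + (u / n - t)) * GfS n b' (p + 1) t τ u := by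
  have hn' : (n : ℂ) ≠ 0 := by exact_mod_cast hn.ne'
  have h1 : jacS n t τ (u + τ) = e (τ / (2 * n) + (u / n - t)) * jacS n t τ u := by
    rw [jacS, jacS, mul_left_comm, ← e_add]
    congr 2
    field_simp
    ring
  rw [GfS, GfS, h1, mul_assoc]
  congr 2
  refine Finset.sum_congr rfl fun r _ => ?_
  rw [show (u + τ) / τ = u / τ + 1 by field_simp, Gf_add_one hn, ← mul_assoc, ← e_add]
  congr 2
  push_cast
  field_simp
  ring

lemma exp_residue_periodic (hn : 0 < n) (p l : ℤ) :
    e (-(((l + n : ℤ) : ℂ) * p) / n) = e (-(l * p) / n) := by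
  have hn' : (n : ℂ) ≠ 0 := by exact_mod_cast hn.ne'
  rw [← e_add_int (-(l * p) / n) (-p)]
  congr 1
  push_cast
  field_simp
  ring

/-- For the transformed function, u ↦ u + 1 is translation by minus the period -1/τ. It shifts the
summation index r by one, which periodicity mod n absorbs. -/
lemma GfS_add_one (hn : 0 < n) (hb' : ∀ l, b' (l + n) = b' l) (p : ℤ) {t u : ℂ} (hτ : 0 < τ.im)
    (hf : fB n b' (t / τ) (-1 / τ) ≠ 0) (hu : LatticeFree τ u) :
    GfS n b' p t τ (u + 1) = e (-p / n) * GfS n b' p t τ u := by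
  have hn' : (n : ℂ) ≠ 0 := by exact_mod_cast hn.ne'
  have hτ0 : τ ≠ 0 := by rintro rfl; simp at hτ
  have hτ' := im_neg_one_div_pos hτ
  have hper : ∀ l, Gf n b' (l + n) (t / τ) (u / τ) (-1 / τ) =
      Gf n b' l (t / τ) (u / τ) (-1 / τ) := fun l => Gf_add_n hn hb' l hτ' hf (hu.S hτ0)
  set κ := e (1 / (2 * n * τ) + (u / n - t) / τ) with hκ
  have hκ0 : κ ≠ 0 := e_ne_zero _
  have h1 : jacS n t τ (u + 1) = κ * jacS n t τ u := by
    rw [jacS, jacS, mul_left_comm, hκ, ← e_add]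
    congr 2
    field_simp
    ring
  -- This is `Gf_add_tau` read backwards, since (u + 1)/τ + (-1/τ) = u/τ.
  have h2 : ∀ r : ℤ, κ * Gf n b' (r + 1) (t / τ) ((u + 1) / τ) (-1 / τ) =
      Gf n b' r (t / τ) (u / τ) (-1 / τ) := by
    intro r
    have := Gf_add_tau hn b' r (t / τ) ((u + 1) / τ) hτ'
    rw [show (u + 1) / τ + -1 / τ = u / τ by field_simp; ring] at this
    rw [this, hκ]
    congr 2
    field_simp
    ring
  rw [GfS, GfS, h1, mul_assoc, mul_left_comm, mul_left_comm (e _)]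
  congr 1
  rw [Finset.mul_sum, Finset.mul_sum]
  set g : ℤ → ℂ := fun r => κ * (e (-(r * p) / n) *
      Gf n b' r (t / τ) ((u + 1) / τ) (-1 / τ)) with hgdef
  have hg : ∀ l : ℤ, g (l + n) = g l := by
    intro l
    have h3 := h2 (l + n - 1)
    have h4 := h2 (l - 1)
    rw [sub_add_cancel] at h3 h4
    simp only [hgdef]
    rw [exp_residue_periodic hn, mul_left_comm, h3, mul_left_comm κ, h4, add_sub_right_comm, hper]
  have := sum_range_add_one_of_periodic hg
  simp only [hgdef, Int.cast_natCast] at this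
  rw [← this]
  refine Finset.sum_congr rfl fun r _ => ?_
  rw [mul_left_comm, h2, ← mul_assoc, ← e_add]
  congr 2
  push_cast
  field_simp
  ring

lemma GfS_add_n (hn : 0 < n) (p : ℤ) (t u : ℂ) :
    GfS n b' (p + n) t τ u = GfS n b' p t τ u := by
  rw [GfS, GfS]
  congr 1
  refine Finset.sum_congr rfl fun r _ => ?_
  congr 1
  have := exp_residue_periodic hn r p
  rw [mul_comm (r : ℂ), mul_comm (r : ℂ)]
  simpa using this

/-- The Appell function without its pole at the origin. -/
lemma Hf_eq_pole_add (hn : 0 < n) (hb : ∀ l, b (l + n) = b l) (l : ℤ) (t : ℂ) (hτ : 0 < τ.im) :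
    ∃ g : ℂ → ℂ, ContinuousAt g 0 ∧ ∀ u, LatticeFree τ u →
      Hf n b l t u τ = b (-l) * (e ((1 - l / n : ℝ) * u) / (1 - e u)) + g u := by
  have hg := gaussDecay_coeffH hn hb l t hτ
  set c' : ℤ → ℂ := fun p => if p = 0 then 0 else coeffH n b l t τ p with hc'
  have hg' : GaussDecay c' := by
    obtain ⟨A, hA, B, K, h⟩ := hg
    refine ⟨A, hA, B, K, fun p => ?_⟩
    by_cases hp : p = 0
    · have hK : 0 ≤ K * Real.exp (-A * (p : ℝ) ^ 2 + B * |(p : ℝ)|) :=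
        (norm_nonneg _).trans (h p)
      simpa [hc', hp] using hK
    · simpa [hc', hp] using h p
  refine ⟨poleSum c' (1 - l / n) τ, ?_, fun u hu => ?_⟩
  · refine (differentiableAt_poleSum hg' _ hτ fun p => ?_).self_of_nhds.continuousAt
    by_cases hp : p = 0
    · left; simp [hc', hp]
    · right
      rw [zero_add, Ne, e_eq_one_iff]
      rintro ⟨m, hm⟩
      have := congrArg Complex.im hm
      simp [hp, hτ.ne'] at this
  · have hs := summable_poleSum hg (1 - l / n) hτ hu
    rw [Hf, poleSum, hs.tsum_eq_add_tsum_ite 0, poleSum]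
    congr 1
    · simp [coeffH, e_zero]
    · refine tsum_congr fun p => ?_
      by_cases hp : p = 0
      · simp [hc', hp]
      · simp [hc', hp]

lemma tendsto_mul_pole (c : ℝ) :
    Filter.Tendsto (fun u : ℂ => u * (e (c * u) / (1 - e u))) (nhdsWithin 0 {0}ᶜ)
      (nhds (-(2 * Real.pi * Complex.I)⁻¹)) := by
  have h0 : (2 * Real.pi * Complex.I : ℂ) ≠ 0 := by simp [Real.pi_ne_zero]
  have h1 := (hasDerivAt_e 0).tendsto_slope_zero
  rw [e_zero, mul_one] at h1
  have h2 := (h1.inv₀ h0).neg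
  have h3 : Filter.Tendsto (fun u : ℂ => e (c * u)) (nhdsWithin 0 {0}ᶜ) (nhds 1) := by
    have : ContinuousAt (fun u : ℂ => e (c * u)) 0 := by
      have := continuous_e
      fun_prop
    have h := this.tendsto
    rw [mul_zero, e_zero] at h
    exact h.mono_left nhdsWithin_le_nhds
  have h4 := h3.mul h2
  rw [one_mul] at h4
  refine h4.congr fun u => ?_
  rw [zero_add, smul_eq_mul, mul_inv, inv_inv, ← neg_sub 1 (e u), inv_neg]
  ring

lemma eventually_latticeFree_zero (hτ : 0 < τ.im) :
    ∀ᶠ u : ℂ in nhdsWithin 0 {0}ᶜ, LatticeFree τ u := by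
  obtain ⟨δ, hδ, h⟩ := exists_lower_bound 0 hτ
  have hc : ContinuousAt (fun u : ℂ => (u, τ)) 0 := by fun_prop
  have h1 := (hc.eventually h).filter_mono (nhdsWithin_le_nhds (s := {0}ᶜ))
  have h2 : ∀ᶠ u : ℂ in nhdsWithin 0 {0}ᶜ, ‖u‖ < 1 :=
    (continuous_norm.continuousAt.eventually_lt_const (by simp)).filter_mono nhdsWithin_le_nhds
  filter_upwards [h1, h2, self_mem_nhdsWithin] with u hu1 hu2 hu3 m
  rcases hu1 m with h | h
  · have hm : m = 0 := by
      rw [zero_add, e_eq_one_iff] at h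
      obtain ⟨k, hk⟩ := h
      have := congrArg Complex.im hk
      simpa [hτ.ne'] using this
    subst hm
    rw [Int.cast_zero, zero_mul, add_zero, Ne, e_eq_one_iff]
    rintro ⟨k, hk⟩
    apply hu3
    rw [hk, Complex.norm_intCast] at hu2
    have : |k| < 1 := by exact_mod_cast hu2
    rw [Int.abs_lt_one_iff] at this
    simp [hk, this]
  · intro h'
    rw [h', sub_self, norm_zero] at h
    linarith

lemma tendsto_mul_Hf (hn : 0 < n) (hb : ∀ l, b (l + n) = b l) (l : ℤ) (t : ℂ) (hτ : 0 < τ.im) :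
    Filter.Tendsto (fun u => u * Hf n b l t u τ) (nhdsWithin 0 {0}ᶜ)
      (nhds (b (-l) * -(2 * Real.pi * Complex.I)⁻¹)) := by
  obtain ⟨g, hg, h⟩ := Hf_eq_pole_add hn hb l t hτ
  have h1 := (tendsto_mul_pole (1 - l / n)).const_mul (b (-l))
  have h2 : Filter.Tendsto (fun u : ℂ => u * g u) (nhdsWithin 0 {0}ᶜ) (nhds 0) := by
    have : ContinuousAt (fun u : ℂ => u * g u) 0 := continuousAt_id.mul hg
    have h := this.tendsto
    rw [zero_mul] at h
    exact h.mono_left nhdsWithin_le_nhds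
  have h3 := h1.add h2
  rw [add_zero] at h3
  refine h3.congr' ?_
  filter_upwards [eventually_latticeFree_zero hτ] with u hu
  rw [h u hu]
  ring

end

/-! ### The defect of the S-transformation: holomorphy, quasi-periodicity, vanishing. -/

section

variable {n : ℕ} {b b' : ℤ → ℂ} {τ t : ℂ}

/-- The defect in the `S`-transformation of `Gf`. -/
def defect (n : ℕ) (b b' : ℤ → ℂ) (t τ : ℂ) (p : ℤ) (u : ℂ) : ℂ :=
  Gf n b p t u τ - GfS n b' p t τ u

lemma defect_eq (p : ℤ) (u : ℂ) (hτ : τ ≠ 0) :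
    defect n b b' t τ p u = (Hf n b p t u τ / fB n b t τ - jacS n t τ u *
      ∑ r ∈ Finset.range n, e (-(r * p) / n) * (Hf n b' r (t / τ) (u / τ) (-1 / τ) /
        fB n b' (t / τ) (-1 / τ))) + 1 / 2 * mordell n p τ (u / n - t) := by
  rw [defect, Gf, GfS, mordell, ← jacS]
  have h1 : ∑ r ∈ Finset.range n, e (-(r * p) / n) * Gf n b' r (t / τ) (u / τ) (-1 / τ) =
      (∑ r ∈ Finset.range n, e (-(r * p) / n) * (Hf n b' r (t / τ) (u / τ) (-1 / τ) /
        fB n b' (t / τ) (-1 / τ))) + 1 / 2 *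
      ∑ r ∈ Finset.range n, e (-(r * p) / n) * Wf n ((r : ℤ) / n) 0 ((u / n - t) / τ, -1 / τ) := by
    rw [Finset.mul_sum, ← Finset.sum_add_distrib]
    refine Finset.sum_congr rfl fun r _ => ?_
    rw [Gf, show u / τ / n - t / τ = (u / n - t) / τ by field_simp]
    ring
  rw [h1]
  ring

lemma eventually_latticeFree (hτ : 0 < τ.im) {u₀ : ℂ} (hu : LatticeFree τ u₀) :
    ∀ᶠ u in nhds u₀, LatticeFree τ u := by
  obtain ⟨δ, hδ, h⟩ := exists_lower_bound u₀ hτ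
  have hc : ContinuousAt (fun u : ℂ => (u, τ)) u₀ := by fun_prop
  filter_upwards [hc.eventually h] with u hu1 m h'
  have := (hu1 m).resolve_left (hu m)
  simp only [h', sub_self, norm_zero] at this
  linarith

lemma eventually_differentiableAt_Hf (hn : 0 < n) (hb : ∀ l, b (l + n) = b l) (l : ℤ)
    (hτ : 0 < τ.im) {u₀ : ℂ} (hu : LatticeFree τ u₀) :
    ∀ᶠ u in nhds u₀, DifferentiableAt ℂ (fun u => Hf n b l t u τ) u :=
  differentiableAt_poleSum (gaussDecay_coeffH hn hb l t hτ) _ hτ fun p => Or.inr (hu p)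

lemma differentiable_jacS : Differentiable ℂ (jacS n t τ) := by
  intro u
  unfold jacS
  fun_prop

lemma eventually_differentiableAt_defect (hn : 0 < n) (hb : ∀ l, b (l + n) = b l)
    (hb' : ∀ l, b' (l + n) = b' l) (p : ℤ) (hτ : 0 < τ.im) {u₀ : ℂ} (hu : LatticeFree τ u₀) :
    ∀ᶠ u in nhds u₀, DifferentiableAt ℂ (defect n b b' t τ p) u := by
  have hτ0 : τ ≠ 0 := by rintro rfl; simp at hτ
  have hτ' := im_neg_one_div_pos hτ
  have hc : ContinuousAt (fun u : ℂ => u / τ) u₀ := by fun_prop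
  have h2 : ∀ r ∈ Finset.range n, ∀ᶠ u in nhds u₀,
      DifferentiableAt ℂ (fun u => Hf n b' r (t / τ) u (-1 / τ)) (u / τ) := fun r _ =>
    hc.eventually (eventually_differentiableAt_Hf hn hb' r hτ' (hu.S hτ0))
  rw [← Finset.eventually_all] at h2
  filter_upwards [eventually_differentiableAt_Hf (t := t) hn hb p hτ hu, h2] with u h3 h4
  have hfun : defect n b b' t τ p = _ := funext fun u => defect_eq p u hτ0
  rw [hfun]
  have h5 : DifferentiableAt ℂ (fun u => ∑ r ∈ Finset.range n, e (-(r * p) / n) *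
      (Hf n b' r (t / τ) (u / τ) (-1 / τ) / fB n b' (t / τ) (-1 / τ))) u := by
    refine DifferentiableAt.fun_sum fun r hr => ?_
    have := (h4 r hr).comp u (f := fun u : ℂ => u / τ) (by fun_prop)
    exact (this.div_const _).const_mul _
  have h6 : DifferentiableAt ℂ (fun u => mordell n p τ (u / n - t)) u :=
    (differentiable_mordell hn p hτ _).comp u (f := fun u : ℂ => u / n - t) (by fun_prop)
  exact ((h3.div_const _).sub ((differentiable_jacS u).mul h5)).add (h6.const_mul _)

/-- The two residues at u = 0 agree: the coefficients match because b is the discrete Fourier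
transform of b', and the denominators match by `fB_S`. The `mordell` part is entire and contributes
nothing. -/
lemma tendsto_mul_defect (hn : 0 < n) (hb : ∀ l, b (l + n) = b l) (hb' : ∀ l, b' (l + n) = b' l)
    (hbb' : ∀ p, b p = ∑ r ∈ Finset.range n, e (-(r * p) / n) * b' r) (p : ℤ) (hτ : 0 < τ.im)
    (hf : fB n b t τ ≠ 0) :
    Filter.Tendsto (fun u => u * defect n b b' t τ p u) (nhdsWithin 0 {0}ᶜ) (nhds 0) := by
  have hτ0 : τ ≠ 0 := by rintro rfl; simp at hτ
  have hτ' := im_neg_one_div_pos hτ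
  have hn' : (n : ℂ) ≠ 0 := by exact_mod_cast hn.ne'
  have hid : Filter.Tendsto (fun u : ℂ => u) (nhdsWithin 0 {0}ᶜ) (nhds 0) := nhdsWithin_le_nhds
  have h1 := (tendsto_mul_Hf hn hb p t hτ).div_const (fB n b t τ)
  have hdiv : Filter.Tendsto (fun u : ℂ => u / τ) (nhdsWithin 0 {0}ᶜ) (nhdsWithin 0 {0}ᶜ) := by
    refine tendsto_nhdsWithin_iff.mpr ⟨?_, ?_⟩
    · simpa using hid.div_const τ
    · filter_upwards [self_mem_nhdsWithin] with u hu
      have hu' : u ≠ 0 := hu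
      simp [hu', hτ0]
  have h2 : ∀ r ∈ Finset.range n, Filter.Tendsto (fun u => τ * (e (-(r * p) / n) *
      (u / τ * Hf n b' r (t / τ) (u / τ) (-1 / τ) / fB n b' (t / τ) (-1 / τ))))
      (nhdsWithin 0 {0}ᶜ) (nhds (τ * (e (-(r * p) / n) * (b' (-r) * -(2 * Real.pi * Complex.I)⁻¹ /
        fB n b' (t / τ) (-1 / τ))))) := fun r _ =>
    ((((tendsto_mul_Hf hn hb' r (t / τ) hτ').comp hdiv).div_const _).const_mul _).const_mul _
  have h3 := tendsto_finsetSum _ h2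
  have h4 : Filter.Tendsto (jacS n t τ) (nhdsWithin 0 {0}ᶜ) (nhds (jacS n t τ 0)) :=
    (differentiable_jacS 0).continuousAt.tendsto.mono_left nhdsWithin_le_nhds
  have h5 : Filter.Tendsto (fun u => u * (1 / 2 * mordell n p τ (u / n - t)))
      (nhdsWithin 0 {0}ᶜ) (nhds 0) := by
    have hc : ContinuousAt (fun u => u * (1 / 2 * mordell n p τ (u / n - t))) 0 := by
      have := (differentiable_mordell hn p hτ).continuous
      fun_prop
    have h := hc.tendsto
    rw [zero_mul] at h
    exact h.mono_left nhdsWithin_le_nhds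
  have h6 := (h1.sub (h4.mul h3)).add h5
  have hval : b (-p) * -(2 * Real.pi * Complex.I)⁻¹ / fB n b t τ - jacS n t τ 0 *
      ∑ r ∈ Finset.range n, τ * (e (-(r * p) / n) * (b' (-r) * -(2 * Real.pi * Complex.I)⁻¹ /
        fB n b' (t / τ) (-1 / τ))) + 0 = 0 := by
    -- The residue of `Hf` at component r is governed by b'(-r), so the Fourier sum is reindexed by
    -- r ↦ -r.
    have hs : ∑ r ∈ Finset.range n, e (-(r * p) / n) * b' (-r) = b (-p) := by
      set g : ℤ → ℂ := fun r => e (-(r * (-p : ℤ)) / n) * b' r with hg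
      have hper : ∀ l : ℤ, g (l + n) = g l := by
        intro l
        change e (-(((l + n : ℤ) : ℂ) * ((-p : ℤ) : ℂ)) / n) * b' (l + n) = _
        rw [hb', exp_residue_periodic hn]
      have := sum_range_neg_of_periodic hper
      rw [hbb' (-p)]
      refine Eq.trans ?_ (this.trans ?_)
      · refine Finset.sum_congr rfl fun r _ => ?_
        simp [hg]
      · simp [hg]
    have hs2 : ∑ r ∈ Finset.range n, τ * (e (-(r * p) / n) *
        (b' (-r) * -(2 * Real.pi * Complex.I)⁻¹ / fB n b' (t / τ) (-1 / τ))) =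
        τ * b (-p) * -(2 * Real.pi * Complex.I)⁻¹ / fB n b' (t / τ) (-1 / τ) := by
      rw [← hs, Finset.mul_sum, Finset.sum_mul, Finset.sum_div]
      refine Finset.sum_congr rfl fun r _ => ?_
      ring
    have hr := rootFactor_ne_zero hn hτ0
    have hE := e_ne_zero (n * t ^ 2 / (2 * τ))
    rw [hs2, fB_S hn hb' hb hbb' t hτ, jacS, zero_div, zero_sub, neg_sq, add_zero]
    field_simp
    ring
  rw [hval] at h6
  refine h6.congr fun u => ?_
  rw [defect_eq p u hτ0, mul_add, mul_sub]
  congr 2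
  · ring
  · rw [mul_left_comm u, Finset.mul_sum _ _ u]
    congr 1
    refine Finset.sum_congr rfl fun r _ => ?_
    field_simp

/-- Since u times the defect tends to 0, the defect is o(1/u) at the origin and Riemann's theorem
removes the singularity. -/
lemma exists_local_zero (hn : 0 < n) (hb : ∀ l, b (l + n) = b l) (hb' : ∀ l, b' (l + n) = b' l)
    (hbb' : ∀ p, b p = ∑ r ∈ Finset.range n, e (-(r * p) / n) * b' r) (p : ℤ) (hτ : 0 < τ.im)
    (hf : fB n b t τ ≠ 0) :
    ∃ g : ℂ → ℂ, (∀ᶠ u in nhds 0, DifferentiableAt ℂ g u) ∧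
      ∀ᶠ u in nhdsWithin 0 {0}ᶜ, defect n b b' t τ p u = g u := by
  have h1 : ∀ᶠ u in nhdsWithin 0 {0}ᶜ, DifferentiableAt ℂ (defect n b b' t τ p) u := by
    filter_upwards [eventually_latticeFree_zero hτ] with u hu
    exact (eventually_differentiableAt_defect hn hb hb' p hτ hu).self_of_nhds
  rw [eventually_nhdsWithin_iff] at h1
  obtain ⟨r, hr, hball⟩ := Metric.eventually_nhds_iff_ball.mp h1
  have h2 := Complex.differentiableOn_update_limUnder_of_isLittleO
    (f := defect n b b' t τ p) (Metric.ball_mem_nhds (0 : ℂ) hr)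
    (fun u hu => (hball u hu.1 hu.2).differentiableWithinAt) (by
      rw [Asymptotics.isLittleO_iff_tendsto']
      · have h3 := tendsto_mul_defect hn hb hb' hbb' p hτ hf
        have h4 : Filter.Tendsto (fun u : ℂ => u * defect n b b' t τ p 0)
            (nhdsWithin 0 {0}ᶜ) (nhds 0) := by
          have hid : Filter.Tendsto (fun u : ℂ => u) (nhdsWithin 0 {0}ᶜ) (nhds 0) :=
            nhdsWithin_le_nhds
          simpa using hid.mul_const (defect n b b' t τ p 0)
        have h5 := h3.sub h4
        rw [sub_zero] at h5
        refine h5.congr fun u => ?_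
        rw [sub_zero, div_inv_eq_mul]
        ring
      · filter_upwards [self_mem_nhdsWithin] with u hu h
        rw [sub_zero, inv_eq_zero] at h
        exact absurd h hu)
  refine ⟨_, Filter.eventually_of_mem (Metric.ball_mem_nhds (0 : ℂ) hr) fun u hu =>
    (h2 u hu).differentiableAt (Metric.isOpen_ball.mem_nhds hu), ?_⟩
  filter_upwards [self_mem_nhdsWithin] with u hu
  exact (Function.update_of_ne hu _ _).symm

/-! #### Quasi-periodicity of the defect -/

/-- The standing hypotheses for the `S`-transformation. -/
structure SData (n : ℕ) (b b' : ℤ → ℂ) (t τ : ℂ) : Prop where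
  hn : 0 < n
  per : ∀ l, b (l + n) = b l
  per' : ∀ l, b' (l + n) = b' l
  dft : ∀ p, b p = ∑ r ∈ Finset.range n, e (-(r * p) / n) * b' r
  hτ : 0 < τ.im
  hf : fB n b t τ ≠ 0


namespace SData

lemma τ_ne (h : SData n b b' t τ) : τ ≠ 0 := by
  have := h.hτ
  rintro rfl
  simp at this

lemma hf' (h : SData n b b' t τ) : fB n b' (t / τ) (-1 / τ) ≠ 0 := by
  rw [fB_S h.hn h.per' h.per h.dft t h.hτ]
  exact mul_ne_zero (mul_ne_zero (rootFactor_ne_zero h.hn h.τ_ne) (e_ne_zero _)) h.hf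

lemma defect_add_one (h : SData n b b' t τ) (p : ℤ) {u : ℂ} (hu : LatticeFree τ u) :
    defect n b b' t τ p (u + 1) = e (-p / n) * defect n b b' t τ p u := by
  rw [defect, Gf_add_one h.hn, GfS_add_one h.hn h.per' p h.hτ h.hf' hu, defect]
  ring

lemma defect_add_int (h : SData n b b' t τ) (p : ℤ) {u : ℂ} (hu : LatticeFree τ u) (c : ℤ) :
    defect n b b' t τ p (u + c) = e (-(p * c) / n) * defect n b b' t τ p u := by
  induction c using Int.induction_on with
  | zero => simp [e_zero]
  | succ k ih =>
    have h1 := h.defect_add_one p (by simpa using hu.add_int_mul_add_int 0 k : LatticeFree τ (u + (k : ℤ)))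
    rw [show u + ((k + 1 : ℤ) : ℂ) = u + ((k : ℤ) : ℂ) + 1 by push_cast; ring, h1, ih, ← mul_assoc,
      ← e_add]
    congr 2
    push_cast; ring
  | pred k ih =>
    have h1 := h.defect_add_one p (by simpa using hu.add_int_mul_add_int 0 (-(k : ℤ) - 1) :
      LatticeFree τ (u + (-(k : ℤ) - 1 : ℤ)))
    rw [show u + ((-(k : ℤ) - 1 : ℤ) : ℂ) + 1 = u + ((-(k : ℤ) : ℤ) : ℂ) by push_cast; ring, ih] at h1
    have h2 : defect n b b' t τ p (u + (-(k : ℤ) - 1 : ℤ)) = e (p / n) * (e (-p / n) *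
        defect n b b' t τ p (u + (-(k : ℤ) - 1 : ℤ))) := by
      rw [← mul_assoc, ← e_add, show (p / n + -p / n : ℂ) = 0 by ring, e_zero, one_mul]
    rw [h2, ← h1, ← mul_assoc, ← e_add]
    congr 2
    push_cast; ring

lemma defect_add_tau (h : SData n b b' t τ) (p : ℤ) (u : ℂ) :
    defect n b b' t τ p (u + τ) = e (τ / (2 * n) + (u / n - t)) * defect n b b' t τ (p + 1) u := by
  rw [defect, Gf_add_tau h.hn b p t u h.hτ, GfS_add_tau h.hn p t u h.τ_ne, defect]
  ring

lemma defect_add_int_mul_tau (h : SData n b b' t τ) (p : ℤ) (u : ℂ) (a : ℤ) :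
    defect n b b' t τ p (u + a * τ) = e ((a : ℂ) ^ 2 * τ / (2 * n) + a * (u / n - t)) *
      defect n b b' t τ (p + a) u := by
  have hn' : (n : ℂ) ≠ 0 := by exact_mod_cast h.hn.ne'
  induction a using Int.induction_on generalizing p with
  | zero => simp [e_zero]
  | succ k ih =>
    rw [show u + ((k + 1 : ℤ) : ℂ) * τ = u + ((k : ℤ) : ℂ) * τ + τ by push_cast; ring,
      h.defect_add_tau, ih, ← mul_assoc, ← e_add, add_assoc p 1, add_comm (1 : ℤ)]
    congr 2
    push_cast; field_simp; ring
  | pred k ih =>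
    have h1 := h.defect_add_tau (p - 1) (u + (-(k : ℤ) - 1 : ℤ) * τ)
    rw [show u + ((-(k : ℤ) - 1 : ℤ) : ℂ) * τ + τ = u + ((-(k : ℤ) : ℤ) : ℂ) * τ by push_cast; ring,
      ih, sub_add_cancel, show p - 1 + -(k : ℤ) = p + (-k - 1) by ring] at h1
    set x := τ / (2 * n) + ((u + (-(k : ℤ) - 1 : ℤ) * τ) / n - t) with hx
    have h2 : defect n b b' t τ p (u + (-(k : ℤ) - 1 : ℤ) * τ) = e (-x) * (e x *
        defect n b b' t τ p (u + (-(k : ℤ) - 1 : ℤ) * τ)) := by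
      rw [← mul_assoc, ← e_add, neg_add_cancel, e_zero, one_mul]
    rw [h2, ← h1, ← mul_assoc, ← e_add, hx]
    congr 2
    push_cast; field_simp; ring

lemma defect_add_n (h : SData n b b' t τ) (p : ℤ) {u : ℂ} (hu : LatticeFree τ u) :
    defect n b b' t τ (p + n) u = defect n b b' t τ p u := by
  rw [defect, Gf_add_n h.hn h.per p h.hτ h.hf hu, GfS_add_n h.hn, defect]

lemma eventually_latticeFree_ne (hτ : 0 < τ.im) (u₀ : ℂ) :
    ∀ᶠ u in nhdsWithin u₀ {u₀}ᶜ, LatticeFree τ u := by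
  by_cases hu : LatticeFree τ u₀
  · exact (eventually_latticeFree hτ hu).filter_mono nhdsWithin_le_nhds
  · rw [latticeFree_iff] at hu
    push Not at hu
    obtain ⟨a, c, rfl⟩ := hu
    have ht : Filter.Tendsto (fun u : ℂ => u - (a * τ + c))
        (nhdsWithin (a * τ + c) {(a * τ + c : ℂ)}ᶜ) (nhdsWithin 0 {0}ᶜ) := by
      refine tendsto_nhdsWithin_iff.mpr ⟨?_, ?_⟩
      · have hc : ContinuousAt (fun u : ℂ => u - (a * τ + c)) (a * τ + c) := by fun_prop
        have := hc.tendsto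
        rw [sub_self] at this
        exact this.mono_left nhdsWithin_le_nhds
      · filter_upwards [self_mem_nhdsWithin] with u hu
        exact sub_ne_zero.mpr hu
    filter_upwards [ht.eventually (eventually_latticeFree_zero hτ)] with u hu
    have := hu.add_int_mul_add_int a c
    rwa [show u - (a * τ + c) + a * τ + c = u by ring] at this

/-- Quasi-periodicity carries the removable singularity at 0 to every lattice point. -/
lemma exists_local (h : SData n b b' t τ) (p : ℤ) (u₀ : ℂ) :
    ∃ g : ℂ → ℂ, (∀ᶠ u in nhds u₀, DifferentiableAt ℂ g u) ∧
      ∀ᶠ u in nhdsWithin u₀ {u₀}ᶜ, defect n b b' t τ p u = g u := by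
  by_cases hu : LatticeFree τ u₀
  · exact ⟨_, eventually_differentiableAt_defect h.hn h.per h.per' p h.hτ hu, Filter.Eventually.of_forall fun _ => rfl⟩
  · rw [latticeFree_iff] at hu
    push Not at hu
    obtain ⟨a, c, rfl⟩ := hu
    obtain ⟨g, hg1, hg2⟩ := exists_local_zero h.hn h.per h.per' h.dft (p + a) h.hτ h.hf
    have hc : ContinuousAt (fun u : ℂ => u - (a * τ + c)) (a * τ + c) := by fun_prop
    have hc' := hc.tendsto
    rw [sub_self] at hc'
    have ht : Filter.Tendsto (fun u : ℂ => u - (a * τ + c))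
        (nhdsWithin (a * τ + c) {(a * τ + c : ℂ)}ᶜ) (nhdsWithin 0 {0}ᶜ) := by
      refine tendsto_nhdsWithin_iff.mpr ⟨hc'.mono_left nhdsWithin_le_nhds, ?_⟩
      filter_upwards [self_mem_nhdsWithin] with u hu
      exact sub_ne_zero.mpr hu
    refine ⟨fun u => e (-(p * c) / n) * (e ((a : ℂ) ^ 2 * τ / (2 * n) +
      a * ((u - (a * τ + c)) / n - t)) * g (u - (a * τ + c))), ?_, ?_⟩
    · filter_upwards [hc'.eventually hg1] with u hu
      have := hu.comp u (f := fun u : ℂ => u - (a * τ + c)) (by fun_prop)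
      have h2 : DifferentiableAt ℂ (fun u : ℂ => e ((a : ℂ) ^ 2 * τ / (2 * n) +
        a * ((u - (a * τ + c)) / n - t))) u := by fun_prop
      exact (h2.mul this).const_mul _
    · filter_upwards [ht.eventually hg2, ht.eventually (eventually_latticeFree_zero h.hτ)] with u h1 h2
      have h3 : LatticeFree τ (u - (a * τ + c) + a * τ) := by
        simpa using h2.add_int_mul_add_int a 0
      rw [← h1, ← h.defect_add_int_mul_tau, ← h.defect_add_int p h3]
      congr 1
      ring

/-- The entire extension of the defect. -/
def ext (_ : SData n b b' t τ) (p : ℤ) (u : ℂ) : ℂ :=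
  Filter.limUnder (nhdsWithin u {u}ᶜ) (defect n b b' t τ p)

/-- Near u₀ the punctured limits defining `ext` are the values of any local holomorphic model g. At
u ≠ u₀ this holds because small neighbourhoods of u avoid u₀. -/
lemma ext_eventuallyEq (h : SData n b b' t τ) (p : ℤ) {u₀ : ℂ} {g : ℂ → ℂ}
    (hg : ∀ᶠ u in nhds u₀, DifferentiableAt ℂ g u)
    (hD : ∀ᶠ u in nhdsWithin u₀ {u₀}ᶜ, defect n b b' t τ p u = g u) :
    ∀ᶠ u in nhds u₀, h.ext p u = g u := by
  have h1 : ∀ᶠ u in nhds u₀, ∀ᶠ u' in nhdsWithin u {u}ᶜ, defect n b b' t τ p u' = g u' := by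
    rw [eventually_nhdsWithin_iff] at hD
    filter_upwards [hD.eventually_nhds] with u hu
    by_cases huu : u = u₀
    · subst huu
      exact eventually_nhdsWithin_iff.mpr hu
    · have h3 : ∀ᶠ u' in nhds u, u' ≠ u₀ := isOpen_ne.mem_nhds huu
      filter_upwards [hu.filter_mono nhdsWithin_le_nhds, h3.filter_mono nhdsWithin_le_nhds]
        with u' h4 h5 using h4 h5
  filter_upwards [hg, h1] with u hu1 hu2
  refine Filter.Tendsto.limUnder_eq ?_
  exact (hu1.continuousAt.tendsto.mono_left nhdsWithin_le_nhds).congr'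
    (hu2.mono fun _ h => h.symm)

lemma differentiable_ext (h : SData n b b' t τ) (p : ℤ) : Differentiable ℂ (h.ext p) := by
  intro u₀
  obtain ⟨g, hg1, hg2⟩ := h.exists_local p u₀
  exact hg1.self_of_nhds.congr_of_eventuallyEq (h.ext_eventuallyEq p hg1 hg2)

lemma ext_eq (h : SData n b b' t τ) (p : ℤ) {u : ℂ} (hu : LatticeFree τ u) :
    h.ext p u = defect n b b' t τ p u :=
  (h.ext_eventuallyEq p (eventually_differentiableAt_defect h.hn h.per h.per' p h.hτ hu)
    (Filter.Eventually.of_forall fun _ => rfl)).self_of_nhds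

/-- Lattice-free points fill a punctured neighbourhood of every point, so identities between
continuous functions extend across the lattice. -/
lemma eq_of_eq_on_latticeFree (h : SData n b b' t τ) {f g : ℂ → ℂ} (hf : Continuous f)
    (hg : Continuous g) (hfg : ∀ u, LatticeFree τ u → f u = g u) (u : ℂ) : f u = g u :=
  tendsto_nhds_unique_of_eventuallyEq (l := nhdsWithin u {u}ᶜ)
    (hf.continuousAt.tendsto.mono_left nhdsWithin_le_nhds)
    (hg.continuousAt.tendsto.mono_left nhdsWithin_le_nhds)
    ((eventually_latticeFree_ne h.hτ u).mono hfg)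

lemma ext_add_n (h : SData n b b' t τ) (p : ℤ) (u : ℂ) : h.ext (p + n) u = h.ext p u :=
  h.eq_of_eq_on_latticeFree (h.differentiable_ext _).continuous (h.differentiable_ext _).continuous
    (fun u hu => by rw [h.ext_eq _ hu, h.ext_eq _ hu, h.defect_add_n p hu]) u

lemma ext_add (h : SData n b b' t τ) (p : ℤ) (u : ℂ) (a c : ℤ) :
    h.ext p (u + a * τ + c) = e (-(p * c) / n) * (e ((a : ℂ) ^ 2 * τ / (2 * n) +
      a * (u / n - t)) * h.ext (p + a) u) := by
  have h1 := (h.differentiable_ext p).continuous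
  have h2 := (h.differentiable_ext (p + a)).continuous
  have h3 := continuous_e
  refine h.eq_of_eq_on_latticeFree (f := fun u => h.ext p (u + a * τ + c))
    (g := fun u => e (-(p * c) / n) * (e ((a : ℂ) ^ 2 * τ / (2 * n) +
      a * (u / n - t)) * h.ext (p + a) u)) (by fun_prop) (by fun_prop) (fun u hu => ?_) u
  have h4 : LatticeFree τ (u + a * τ) := by simpa using hu.add_int_mul_add_int a 0
  rw [h.ext_eq p (hu.add_int_mul_add_int a c), h.ext_eq _ hu, h.defect_add_int p h4,
    h.defect_add_int_mul_tau]

lemma exists_bound_cell (h : SData n b b' t τ) :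
    ∃ C, 0 ≤ C ∧ ∀ (p : ℤ) (x y : ℝ), x ∈ Set.Icc (0 : ℝ) 1 → y ∈ Set.Icc (0 : ℝ) 1 →
      ‖h.ext p (x + y * τ)‖ ≤ C := by
  have hK : IsCompact ((fun q : ℝ × ℝ => (q.1 : ℂ) + q.2 * τ) '' (Set.Icc 0 1 ×ˢ Set.Icc 0 1)) :=
    (isCompact_Icc.prod isCompact_Icc).image (by fun_prop)
  have h1 : ∀ r : ℕ, ∃ C, ∀ x y : ℝ, x ∈ Set.Icc (0 : ℝ) 1 → y ∈ Set.Icc (0 : ℝ) 1 →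
      ‖h.ext r (x + y * τ)‖ ≤ C := by
    intro r
    obtain ⟨C, hC⟩ := hK.exists_bound_of_continuousOn (h.differentiable_ext r).continuous.continuousOn
    exact ⟨C, fun x y hx hy => hC _ ⟨(x, y), ⟨hx, hy⟩, rfl⟩⟩
  choose C hC using h1
  have hC0 : ∀ r, 0 ≤ C r := fun r => (norm_nonneg _).trans
    (hC r 0 0 (by simp) (by simp))
  refine ⟨∑ r ∈ Finset.range n, C r, Finset.sum_nonneg fun r _ => hC0 r, fun p x y hx hy => ?_⟩
  have hper : ∀ (p : ℤ) (a : ℤ), h.ext (p + a * n) (x + y * τ) = h.ext p (x + y * τ) := by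
    intro p a
    induction a using Int.induction_on with
    | zero => simp
    | succ k ih => rw [add_mul, one_mul, ← add_assoc, h.ext_add_n, ih]
    | pred k ih => rw [← ih, ← h.ext_add_n (p + (-(k : ℤ) - 1) * n)]; congr 1; ring
  have hn' : (0 : ℤ) < n := by exact_mod_cast h.hn
  have h2 : h.ext p (x + y * τ) = h.ext ((p % n).toNat : ℕ) (x + y * τ) := by
    rw [Int.toNat_of_nonneg (Int.emod_nonneg _ hn'.ne'), ← hper (p % n) (p / n), mul_comm (p / (n : ℤ)),
      Int.emod_add_mul_ediv]
  rw [h2]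
  refine (hC _ x y hx hy).trans (Finset.single_le_sum (f := C) (fun r _ => hC0 r) ?_)
  have := Int.emod_lt_of_pos p hn'
  have := Int.emod_nonneg p hn'.ne'
  rw [Finset.mem_range]
  omega

lemma norm_factor_le (_ : SData n b b' t τ) (a : ℤ) (u : ℂ) {B : ℝ} (hB : |u.im / n - t.im| ≤ B) :
    ‖e ((a : ℂ) ^ 2 * τ / (2 * n) + a * (u / n - t))‖ ≤
      Real.exp (-(Real.pi * τ.im / n) * (a : ℝ) ^ 2 + 2 * Real.pi * B * |(a : ℝ)|) := by
  rw [norm_e]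
  apply Real.exp_le_exp.mpr
  have him : ((a : ℂ) ^ 2 * τ / (2 * n) + a * (u / n - t)).im =
      (a : ℝ) ^ 2 * τ.im / (2 * n) + a * (u.im / n - t.im) := by
    rw [show (a : ℂ) ^ 2 * τ / (2 * n) + a * (u / n - t) =
      (((a : ℝ) ^ 2 / (2 * n) : ℝ) : ℂ) * τ + ((a : ℝ) : ℂ) * (((1 / n : ℝ) : ℂ) * u - t) by
        push_cast; ring]
    simp only [Complex.add_im, Complex.im_ofReal_mul, Complex.sub_im]
    ring
  rw [him]
  have h1 : -((a : ℝ) * (u.im / n - t.im)) ≤ |(a : ℝ)| * B := by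
    refine (neg_le_abs _).trans ?_
    rw [abs_mul]
    gcongr
  have h2 : -2 * Real.pi * ((a : ℝ) ^ 2 * τ.im / (2 * n) + a * (u.im / n - t.im)) =
    -(Real.pi * τ.im / n) * (a : ℝ) ^ 2 + 2 * Real.pi * -((a : ℝ) * (u.im / n - t.im)) := by
    ring
  rw [h2]
  have := Real.pi_pos
  nlinarith

/-- Each point is a lattice translate of one in a compact cell, and the factor in `ext_add` is
bounded because it is Gaussian in a. So `ext` is bounded, and constant by Liouville's theorem. Far
translates of 0 carry a factor tending to 0, which forces the constant to vanish. -/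
lemma ext_eq_zero (h : SData n b b' t τ) (p : ℤ) (u : ℂ) : h.ext p u = 0 := by
  obtain ⟨C, hC, hbound⟩ := h.exists_bound_cell
  have hn' : (0 : ℝ) < n := by exact_mod_cast h.hn
  have hA : 0 < Real.pi * τ.im / n := by have := h.hτ; positivity
  set A := Real.pi * τ.im / n with hA'
  -- B bounds |Im u/n - Im t| on the fundamental cell, where 0 ≤ Im u ≤ Im τ.
  set B := τ.im / n + |t.im| with hB
  have hB0 : 0 ≤ B := by have := h.hτ; positivity
  have hsm := summable_gauss' 0 hA (2 * Real.pi * B)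
  simp only [add_zero] at hsm
  have hlim : Filter.Tendsto
      (fun k : ℕ => C * Real.exp (-A * (k : ℝ) ^ 2 + 2 * Real.pi * B * |(k : ℝ)|))
      Filter.atTop (nhds 0) := by
    have h1 := (hsm.comp_injective (i := fun k : ℕ => (k : ℤ)) Nat.cast_injective).tendsto_atTop_zero
    simpa using h1.const_mul C
  obtain ⟨K, hK⟩ : ∃ K, ∀ a : ℤ,
      Real.exp (-A * (a : ℝ) ^ 2 + 2 * Real.pi * B * |(a : ℝ)|) ≤ K :=
    ⟨_, fun a => hsm.le_tsum a fun _ _ => (Real.exp_pos _).le⟩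
  have hbd : Bornology.IsBounded (Set.range (h.ext p)) := by
    rw [isBounded_iff_forall_norm_le]
    refine ⟨K * C, ?_⟩
    rintro _ ⟨U, rfl⟩
    set y := U.im / τ.im with hy
    set x := (U - y * τ).re with hx
    have hU : U = ((Int.fract x : ℝ) : ℂ) + (Int.fract y : ℝ) * τ + ⌊y⌋ * τ + ⌊x⌋ := by
      have h1 : U = x + y * τ := by
        apply Complex.ext
        · simp [hx]
        · have := h.hτ.ne'
          simp [hy]
          field_simp
      conv_lhs => rw [h1, ← Int.fract_add_floor x, ← Int.fract_add_floor y]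
      push_cast
      ring
    have hcell := hbound (p + ⌊y⌋) (Int.fract x) (Int.fract y)
      ⟨Int.fract_nonneg _, (Int.fract_lt_one _).le⟩ ⟨Int.fract_nonneg _, (Int.fract_lt_one _).le⟩
    rw [hU, h.ext_add, norm_mul, norm_mul]
    have hone : ‖e (-(p * (⌊x⌋ : ℤ)) / n)‖ = 1 := by
      rw [norm_e, show (-((p : ℂ) * (⌊x⌋ : ℤ)) / n) = ((-(p * ⌊x⌋) / n : ℝ) : ℂ) by push_cast; ring,
        Complex.ofReal_im]
      simp
    rw [hone, one_mul]
    refine mul_le_mul ((h.norm_factor_le _ _ ?_).trans (hK ⌊y⌋)) hcell (norm_nonneg _)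
      ((Real.exp_pos _).le.trans (hK 0))
    have him : (((Int.fract x : ℝ) : ℂ) + (Int.fract y : ℝ) * τ).im = Int.fract y * τ.im := by simp
    rw [him]
    refine (abs_sub _ _).trans ?_
    rw [hB, abs_of_nonneg (div_nonneg (mul_nonneg (Int.fract_nonneg _) h.hτ.le) hn'.le)]
    have := (Int.fract_lt_one y).le
    have h3 := h.hτ
    gcongr
    nlinarith
  have hconst := fun v w => (h.differentiable_ext p).apply_eq_apply_of_bounded hbd v w
  rw [hconst u 0]
  -- The constant value is evaluated at kτ and translated back to 0: a Gaussian factor times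
  -- component p + k at 0, which C bounds independently of the index.
  have hle : ∀ k : ℕ, ‖h.ext p 0‖ ≤
      C * Real.exp (-A * (k : ℝ) ^ 2 + 2 * Real.pi * B * |(k : ℝ)|) := by
    intro k
    have h1 := h.ext_add p 0 k 0
    rw [hconst _ 0] at h1
    rw [h1, norm_mul, norm_mul, mul_comm C]
    simp only [Int.cast_zero, mul_zero, neg_zero, zero_div, e_zero, norm_one, one_mul]
    have h2 := h.norm_factor_le k 0 (B := B) (by
      simp only [Complex.zero_im, zero_div, zero_sub, abs_neg, hB]
      have := h.hτ
      have : 0 ≤ τ.im / n := by positivity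
      linarith)
    have h3 := hbound (p + k) 0 0 (by simp) (by simp)
    simp only [Complex.ofReal_zero, zero_mul, add_zero] at h3
    simp only [zero_div, Int.cast_natCast] at h2
    simp only [Int.cast_natCast]
    exact mul_le_mul h2 h3 (norm_nonneg _) (Real.exp_pos _).le
  have := ge_of_tendsto' hlim hle
  exact norm_le_zero_iff.mp this

/-- The `S`-transformation law of the completed function. -/
theorem Gf_S (h : SData n b b' t τ) (p : ℤ) {u : ℂ} (hu : LatticeFree τ u) :
    Gf n b p t u τ = jacS n t τ u *
      ∑ r ∈ Finset.range n, e (-(r * p) / n) * Gf n b' r (t / τ) (u / τ) (-1 / τ) := by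
  have h1 := h.ext_eq p hu
  rw [h.ext_eq_zero, defect] at h1
  exact (sub_eq_zero.mp h1.symm)

end SData

end

section

/-! ### Sums over `ℤⁿ` -/

lemma summable_and_tsum_pi_prod {n : ℕ} (f : Fin n → ℤ → ℂ)
    (hf : ∀ j, Summable fun m => ‖f j m‖) :
    Summable (fun k : Fin n → ℤ => ‖∏ j, f j (k j)‖) ∧
      ∑' k : Fin n → ℤ, ∏ j, f j (k j) = ∏ j, ∑' m, f j m := by
  induction n with
  | zero =>
    refine ⟨Summable.of_finite, ?_⟩
    rw [tsum_fintype]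
    simp
  | succ n ih =>
    obtain ⟨h1, h2⟩ := ih (fun j => f j.succ) fun j => hf j.succ
    have hs := (hf 0).mul_norm h1
    have he := (Fin.consEquiv fun _ : Fin (n + 1) => ℤ)
    refine ⟨?_, ?_⟩
    · rw [← (Fin.consEquiv fun _ : Fin (n + 1) => ℤ).summable_iff]
      refine hs.congr fun q => ?_
      simp [Fin.prod_univ_succ]
    · rw [← (Fin.consEquiv fun _ : Fin (n + 1) => ℤ).tsum_eq, Fin.prod_univ_succ, ← h2,
        tsum_mul_tsum_of_summable_norm (hf 0) h1]
      refine tsum_congr fun q => ?_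
      simp [Fin.prod_univ_succ]

/-- The terms of the theta function, up to a common factor. -/
def tT (z τ : ℂ) (m : ℤ) : ℂ := e (m / 2 + (m ^ 2 / 2 + m / 2) * τ + m * z)

lemma norm_tT_le {A B : ℝ} {z τ : ℂ} (hτ : 0 < τ.im) (hA : A ≤ Real.pi * τ.im)
    (hB : Real.pi * τ.im + 2 * Real.pi * |z.im| ≤ B) (m : ℤ) :
    ‖tT z τ m‖ ≤ Real.exp (-A * (m : ℝ) ^ 2 + B * |(m : ℝ)|) := by
  rw [tT, norm_e]
  apply Real.exp_le_exp.mpr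
  have him : ((m / 2 + (m ^ 2 / 2 + m / 2) * τ + m * z : ℂ)).im =
      ((m : ℝ) ^ 2 / 2 + m / 2) * τ.im + m * z.im := by
    rw [show (m / 2 + (m ^ 2 / 2 + m / 2) * τ + m * z : ℂ) = (((m : ℝ) / 2 : ℝ) : ℂ) +
      (((m : ℝ) ^ 2 / 2 + m / 2 : ℝ) : ℂ) * τ + ((m : ℝ) : ℂ) * z by push_cast; ring]
    simp only [Complex.add_im, Complex.im_ofReal_mul, Complex.ofReal_im, zero_add]
  rw [him]
  have hπ := Real.pi_pos
  have h1 : -((m : ℝ)) ≤ |(m : ℝ)| := neg_le_abs _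
  have h2 : -((m : ℝ) * z.im) ≤ |(m : ℝ)| * |z.im| := by
    rw [← abs_mul]; exact neg_le_abs _
  have h3 : A * (m : ℝ) ^ 2 ≤ Real.pi * τ.im * (m : ℝ) ^ 2 := by gcongr
  have h4 : (Real.pi * τ.im + 2 * Real.pi * |z.im|) * |(m : ℝ)| ≤ B * |(m : ℝ)| := by gcongr
  nlinarith [mul_le_mul_of_nonneg_left h1 (mul_pos hπ hτ).le,
    mul_le_mul_of_nonneg_left h2 hπ.le]

lemma summable_norm_tT (z : ℂ) {τ : ℂ} (hτ : 0 < τ.im) : Summable fun m => ‖tT z τ m‖ := by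
  have hA : 0 < Real.pi * τ.im := by positivity
  have := summable_gauss' 0 hA (Real.pi * τ.im + 2 * Real.pi * |z.im|)
  simp only [add_zero] at this
  exact this.of_nonneg_of_le (fun _ => norm_nonneg _) fun m => norm_tT_le hτ le_rfl le_rfl m

lemma theta_eq (z τ : ℂ) : theta z τ = e (τ / 8 + z / 2 + 1 / 4) * ∑' m, tT z τ m := by
  rw [theta, ← tsum_mul_left]
  refine tsum_congr fun m => ?_
  rw [tT, ← e_add, e]
  congr 1
  ring

lemma tsum_tT_eq (z τ : ℂ) : ∑' m, tT z τ m = jacobiTheta₂ (z + 1 / 2 + τ / 2) τ := by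
  rw [jacobiTheta₂]
  refine tsum_congr fun m => ?_
  rw [tT, jacobiTheta₂_term, e]
  congr 1
  ring

variable {n : ℕ} {v : Fin n → ℂ} {τ : ℂ}

/-- The numerators of the Appell function. -/
def aT (v : Fin n → ℂ) (τ : ℂ) (k : Fin n → ℤ) : ℂ := ∏ j, tT (v j) τ (k j)

lemma aT_eq (v : Fin n → ℂ) (τ : ℂ) (k : Fin n → ℤ) :
    aT v τ k = (-1 : ℂ) ^ (∑ j, k j) *
      e (((∑ j, (k j : ℂ) ^ 2) / 2 + (∑ j, (k j : ℂ)) / 2) * τ) * e (∑ j, (k j : ℂ) * v j) := by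
  rw [← e_int_half, ← e_add, ← e_add, aT]
  simp only [tT]
  rw [← e_sum]
  congr 1
  simp only [Finset.sum_add_distrib, ← Finset.sum_div, ← Finset.sum_mul]
  push_cast
  ring

lemma summable_norm_aT (v : Fin n → ℂ) (hτ : 0 < τ.im) : Summable fun k => ‖aT v τ k‖ :=
  (summable_and_tsum_pi_prod _ fun j => summable_norm_tT (v j) hτ).1

lemma tsum_aT (v : Fin n → ℂ) (hτ : 0 < τ.im) : ∑' k, aT v τ k = ∏ j, ∑' m, tT (v j) τ m :=
  (summable_and_tsum_pi_prod _ fun j => summable_norm_tT (v j) hτ).2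

/-- The sum of the numerators with `|k| = N`. -/
def aN (v : Fin n → ℂ) (τ : ℂ) (N : ℤ) : ℂ :=
  ∑' k : (fun k : Fin n → ℤ => ∑ j, k j) ⁻¹' {N}, aT v τ k

/-- The polar denominators depend on k only through |k|, so summing over the fibres of |k| reduces
sums over ℤⁿ to sums over ℤ. -/
lemma hasSum_aN_mul (hτ : 0 < τ.im) {g : ℤ → ℂ} {C : ℝ} (hg : ∀ N, ‖g N‖ ≤ C) :
    HasSum (fun N => aN v τ N * g N) (∑' k, aT v τ k * g (∑ j, k j)) := by
  have hs : Summable fun k => aT v τ k * g (∑ j, k j) := by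
    refine Summable.of_norm_bounded ((summable_norm_aT v hτ).mul_right C) fun k => ?_
    rw [norm_mul]
    gcongr
    exact hg _
  refine (hs.hasSum.tsum_fiberwise fun k : Fin n → ℤ => ∑ j, k j).congr_fun ?_
  intro N
  rw [aN, ← tsum_mul_right]
  refine tsum_congr fun k => ?_
  have hk : ∑ j, (k : Fin n → ℤ) j = N := k.2
  rw [hk]

lemma exists_bound_inv_one_sub (hτ : 0 < τ.im) {u : ℂ} (hu : LatticeFree τ u) :
    ∃ C, ∀ N : ℤ, ‖(1 - e (u + N * τ))⁻¹‖ ≤ C := by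
  obtain ⟨δ, hδ, h⟩ := exists_lower_bound u hτ
  refine ⟨δ⁻¹, fun N => ?_⟩
  rw [norm_inv]
  have := (h.self_of_nhds N).resolve_left (hu N)
  gcongr

lemma mu_eq_tsum (u : ℂ) (v : Fin n → ℂ) (τ : ℂ) :
    mu n u v τ = e (u / 2) / (∏ j, theta (v j) τ) *
      ∑' k, aT v τ k * (1 - e (u + (∑ j, k j : ℤ) * τ))⁻¹ := by
  rw [mu]
  congr 1
  · rw [e]; ring_nf
  · refine tsum_congr fun k => ?_
    rw [aT_eq, ← e_add u, div_eq_mul_inv]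
    push_cast
    rfl

lemma mu_eq_tsum_aN {u : ℂ} (v : Fin n → ℂ) (hτ : 0 < τ.im) (hu : LatticeFree τ u) :
    mu n u v τ = e (u / 2) / (∏ j, theta (v j) τ) *
      ∑' N : ℤ, aN v τ N * (1 - e (u + N * τ))⁻¹ := by
  obtain ⟨C, hC⟩ := exists_bound_inv_one_sub hτ hu
  rw [mu_eq_tsum, (hasSum_aN_mul (g := fun N => (1 - e (u + N * τ))⁻¹) hτ hC).tsum_eq]

lemma tT_add_one (z τ : ℂ) (m : ℤ) :
    tT z τ (m + 1) = tT z τ m * e (1 / 2 + (m + 1) * τ + z) := by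
  rw [tT, tT, ← e_add]
  congr 1
  push_cast
  ring

/-- Adding 1 to every k_j raises |k| by n and multiplies each term by a factor depending only on
|k|. This quasi-periodicity makes `bV` periodic. -/
lemma aN_add_card (v : Fin n → ℂ) (τ : ℂ) (N : ℤ) :
    aN v τ (N + n) = aN v τ N * e (n / 2 + (N + n) * τ + ∑ j, v j) := by
  have hmem : ∀ k : Fin n → ℤ, ∑ j, k j = N ↔ ∑ j, (k j + 1) = N + n := fun k => by
    simp [Finset.sum_add_distrib]
  let eq : (fun k : Fin n → ℤ => ∑ j, k j) ⁻¹' {N} ≃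
      (fun k : Fin n → ℤ => ∑ j, k j) ⁻¹' {N + (n : ℤ)} :=
    (Equiv.addRight (1 : Fin n → ℤ)).subtypeEquiv fun k => hmem k
  rw [aN, ← eq.tsum_eq, aN, ← tsum_mul_right]
  refine tsum_congr fun k => ?_
  have hk : ∑ j, (k : Fin n → ℤ) j = N := k.2
  change aT v τ ((k : Fin n → ℤ) + 1) = _
  rw [aT, aT]
  simp only [Pi.add_apply, Pi.one_apply, tT_add_one]
  rw [Finset.prod_mul_distrib, ← e_sum]
  congr 2
  simp only [Finset.sum_add_distrib, ← Finset.sum_mul, Finset.sum_const, Finset.card_univ,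
    Fintype.card_fin, nsmul_eq_mul, mul_one]
  have hk' : ∑ j, ((k : Fin n → ℤ) j : ℂ) = N := by exact_mod_cast congrArg (Int.cast (R := ℂ)) hk
  linear_combination τ * hk'

/-! ### The completed Appell function in terms of level `n` functions -/

variable {M : ℕ}

/-- The mean of the parameters `v`. -/
def tV (M : ℕ) (v : Fin (2 * M) → ℂ) : ℂ := (∑ j, v j) / ((2 * M : ℕ) : ℂ)

/-- The theta decomposition of the numerators. -/
def bV (M : ℕ) (v : Fin (2 * M) → ℂ) (τ : ℂ) (p : ℤ) : ℂ :=
  e (M / 2 + M / 4 * τ + M * tV M v - p ^ 2 / (4 * M) * τ - p * tV M v) * aN v τ (p - M)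

lemma sum_eq_tV (hM : 0 < M) (v : Fin (2 * M) → ℂ) : ∑ j, v j = 2 * M * tV M v := by
  have : (M : ℂ) ≠ 0 := by exact_mod_cast hM.ne'
  rw [tV]
  push_cast
  field_simp

lemma bV_add (hM : 0 < M) (v : Fin (2 * M) → ℂ) (τ : ℂ) (p : ℤ) :
    bV M v τ (p + (2 * M : ℕ)) = bV M v τ p := by
  have hM' : (M : ℂ) ≠ 0 := by exact_mod_cast hM.ne'
  rw [bV, bV, show p + ((2 * M : ℕ) : ℤ) - M = (p - M) + ((2 * M : ℕ) : ℤ) by ring, aN_add_card,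
    mul_comm (aN _ _ _), ← mul_assoc, ← e_add, sum_eq_tV hM]
  congr 1
  rw [← e_add_int _ (-M)]
  congr 1
  push_cast
  field_simp
  ring

/-- Expanding ∏ θ(w + v_j) according to |k| exhibits it as a theta function of level 2M in w. The
index is p = |k| + M, the shift coming from the half-integers in θ. -/
lemma fB_bV (hM : 0 < M) (v : Fin (2 * M) → ℂ) (hτ : 0 < τ.im) (w : ℂ) :
    fB (2 * M) (bV M v τ) (w + tV M v) τ = ∏ j, theta (w + v j) τ := by
  have hM' : (M : ℂ) ≠ 0 := by exact_mod_cast hM.ne'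
  have h1 := hasSum_aN_mul (v := fun j => w + v j) (g := fun _ => 1) hτ (C := 1) (by simp)
  have haN : ∀ N, aN (fun j => w + v j) τ N = aN v τ N * e (N * w) := by
    intro N
    rw [aN, aN, ← tsum_mul_right]
    refine tsum_congr fun k => ?_
    obtain ⟨k, hk⟩ := k
    have hk : ∑ j, k j = N := hk
    subst hk
    rw [aT, aT]
    push_cast
    rw [Finset.sum_mul, e_sum, ← Finset.prod_mul_distrib]
    refine Finset.prod_congr rfl fun j _ => ?_
    rw [tT, tT, ← e_add]
    ring_nf
  simp only [mul_one] at h1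
  simp only [theta_eq]
  rw [Finset.prod_mul_distrib, ← e_sum, ← tsum_aT _ hτ, ← h1.tsum_eq, ← tsum_mul_left, fB,
    ← (Equiv.addRight (M : ℤ)).tsum_eq]
  refine tsum_congr fun N => ?_
  rw [haN, Equiv.coe_addRight, bV, add_sub_cancel_right]
  have h2 : ∑ j : Fin (2 * M), (τ / 8 + (w + v j) / 2 + 1 / 4) =
      M * τ / 4 + M * w + M * tV M v + M / 2 := by
    simp only [Finset.sum_add_distrib, ← Finset.sum_div, Finset.sum_const, Finset.card_univ,
      Fintype.card_fin, nsmul_eq_mul]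
    rw [sum_eq_tV hM]
    push_cast
    ring
  rw [h2, mul_right_comm, ← e_add, mul_left_comm, ← e_add, mul_comm]
  congr 2
  push_cast
  field_simp
  ring

lemma fB_bV_zero (hM : 0 < M) (v : Fin (2 * M) → ℂ) (hτ : 0 < τ.im) :
    fB (2 * M) (bV M v τ) (tV M v) τ = ∏ j, theta (v j) τ := by
  simpa using fB_bV hM v hτ 0

lemma Hf_bV (hM : 0 < M) (l : ℤ) (u : ℂ) (v : Fin (2 * M) → ℂ) (τ : ℂ) :
    Hf (2 * M) (bV M v τ) l (tV M v) u τ =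
      e (M / 2 + (-l ^ 2 / (4 * M) + l - 3 * M / 4) * τ + (1 - l / (2 * M)) * u +
        (l - M) * tV M v) * ∑' N : ℤ, aN v τ N * (1 - e (u + (l - M) * τ + N * τ))⁻¹ := by
  have hM' : (M : ℂ) ≠ 0 := by exact_mod_cast hM.ne'
  rw [Hf, poleSum, ← tsum_mul_left, ← (Equiv.addRight (l - M)).tsum_eq]
  refine tsum_congr fun N => ?_
  rw [Equiv.coe_addRight, coeffH, ← bV_add hM, bV,
    show N + (l - M) - l + ((2 * M : ℕ) : ℤ) - M = N by push_cast; ring,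
    show u + (l - M) * τ + N * τ = u + ((N + (l - M) : ℤ) : ℂ) * τ by push_cast; ring]
  have haux : ∀ A B C x y : ℂ, e A * x * e B * (e C / y) = e (A + B + C) * (x * y⁻¹) := by
    intro A B C x y
    rw [e_add, e_add]
    ring
  rw [haux]
  congr 2
  push_cast
  field_simp
  ring

/-- The index l - M is what makes the two series match: m + 1/2 + (l - M)/(2M) = m + l/(2M), so the
half-integral lattice of `R` becomes that of `Wf`. -/
lemma R_eq_Wf (hM : 0 < M) (l : ℤ) (u t : ℂ) (hτ : 0 < τ.im) :
    (-1 : ℂ) ^ (l - M) * e (-((l - M : ℤ) : ℂ) ^ 2 / (2 * ((2 * M : ℕ) : ℂ)) * τ) *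
      e (-((l - M : ℤ) : ℂ) / ((2 * M : ℕ) : ℂ) * (u - 2 * M * t)) *
      (Complex.I / 2 * R (u + ((l - M : ℤ) : ℂ) * τ - 2 * M * t - (((2 * M : ℕ) : ℂ) + 1) / 2)
        (((2 * M : ℕ) : ℂ) * τ)) =
    -((-1) ^ l * (1 / 2 * Wf (2 * M) ((l : ℝ) / (2 * M : ℕ)) 0 (u / (2 * M : ℕ) - t, τ))) := by
  have hM' : (M : ℂ) ≠ 0 := by exact_mod_cast hM.ne'
  have hMr : (M : ℝ) ≠ 0 := by exact_mod_cast hM.ne'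
  have hv : τ.im ≠ 0 := hτ.ne'
  rw [R, Wf, ← tsum_mul_left, ← tsum_mul_left, ← tsum_mul_left, ← tsum_mul_left, ← tsum_neg]
  refine tsum_congr fun m => ?_
  have h1 : (((2 * M : ℕ) : ℂ) * τ).im = 2 * M * τ.im := by
    rw [show ((2 * M : ℕ) : ℂ) = ((2 * M : ℝ) : ℂ) by push_cast; ring, Complex.im_ofReal_mul]
  have h2 : (u + ((l - M : ℤ) : ℂ) * τ - 2 * M * t - (((2 * M : ℕ) : ℂ) + 1) / 2).im =
      u.im + (l - M) * τ.im - 2 * M * t.im := by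
    rw [show (u + ((l - M : ℤ) : ℂ) * τ - 2 * M * t - (((2 * M : ℕ) : ℂ) + 1) / 2) =
      u + ((l - M : ℝ) : ℂ) * τ - ((2 * M : ℝ) : ℂ) * t - ((M + 1 / 2 : ℝ) : ℂ) by push_cast; ring]
    simp only [Complex.sub_im, Complex.add_im, Complex.im_ofReal_mul, Complex.ofReal_im, sub_zero]
  have h3 : (u / ((2 * M : ℕ) : ℂ) - t).im = u.im / (2 * M) - t.im := by
    rw [Complex.sub_im, Complex.div_natCast_im]
    push_cast
    rfl
  have harg : ((m : ℝ) + 1 / 2 + (u + ((l - M : ℤ) : ℂ) * τ - 2 * M * t -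
      (((2 * M : ℕ) : ℂ) + 1) / 2).im / (((2 * M : ℕ) : ℂ) * τ).im) *
        Real.sqrt (2 * (((2 * M : ℕ) : ℂ) * τ).im) =
      errArg (2 * M) (m + (l : ℝ) / (2 * M : ℕ)) (u / (2 * M : ℕ) - t, τ) := by
    rw [errArg, h1, h2, h3]
    congr 1
    · push_cast
      field_simp
      ring
    · congr 1
      push_cast
      ring
  rw [wT, harg, pow_zero, one_mul]
  set E := ((Real.sign ((m : ℝ) + 1 / 2) -
    errE (errArg (2 * M) (m + (l : ℝ) / (2 * M : ℕ)) (u / (2 * M : ℕ) - t, τ)) : ℝ) : ℂ)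
  have hI : Complex.I = e (1 / 4) := by
    rw [e, show (2 * Real.pi * Complex.I * (1 / 4) : ℂ) = Real.pi / 2 * Complex.I by ring,
      Complex.exp_pi_div_two_mul_I]
  -- With i and the powers of -1 also written through e, all phases merge into one exponent, to be
  -- compared modulo 1.
  have haux : ∀ a₁ a₂ a₃ a₄ a₅ a₆ a₇ a₈ a₉ : ℂ,
      e (a₁ + a₂ + a₃ + a₄ + a₅ + a₆ + a₇) = e (1 / 2 + a₈ + a₉) →
      e a₁ * e a₂ * e a₃ * (e a₄ / 2 * (E * e a₅ * e a₆ * e a₇)) =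
        -(e a₈ * (1 / 2 * (E * e a₉))) := by
    intro a₁ a₂ a₃ a₄ a₅ a₆ a₇ a₈ a₉ h
    simp only [e_add, e_half] at h
    linear_combination E / 2 * h
  rw [hI, ← e_int_half, ← e_int_half, ← e_int_half]
  apply haux
  rw [← e_add_int _ (-(m * M + m))]
  congr 1
  push_cast
  field_simp
  ring

lemma muHatShift_eq (hM : 0 < M) (l : ℤ) {u : ℂ} (v : Fin (2 * M) → ℂ) (hτ : 0 < τ.im)
    (hu : LatticeFree τ u) :
    muHatShift (2 * M) (l - M) u v τ =
      (-1) ^ l * Gf (2 * M) (bV M v τ) l (tV M v) u τ := by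
  have hM' : (M : ℂ) ≠ 0 := by exact_mod_cast hM.ne'
  have hu' : LatticeFree τ (u + ((l - M : ℤ) : ℂ) * τ) := by
    simpa using hu.add_int_mul_add_int (l - M) 0
  have hR := R_eq_Wf hM l u (tV M v) hτ
  rw [muHatShift, muHat, mul_sub, sum_eq_tV hM, hR, Gf, mul_add, sub_neg_eq_add]
  congr 1
  rw [mu_eq_tsum_aN v hτ hu', Hf_bV hM, fB_bV_zero hM v hτ, ← e_int_half, ← e_int_half]
  push_cast
  have haux : ∀ a₁ a₂ a₃ a₄ a₅ a₆ S P : ℂ, e (a₁ + a₂ + a₃ + a₄) = e (a₅ + a₆) →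
      e a₁ * e a₂ * e a₃ * (e a₄ / P * S) = e a₅ * (e a₆ * S / P) := by
    intro a₁ a₂ a₃ a₄ a₅ a₆ S P h
    simp only [e_add] at h
    linear_combination S / P * h
  apply haux
  rw [← e_add_int _ M]
  congr 1
  push_cast
  field_simp
  ring

end

section

/-! ### Transformation laws of the theta function -/

lemma theta_add_int (z τ : ℂ) (m : ℤ) : theta (z + m) τ = (-1) ^ m * theta z τ := by
  rw [theta_eq, theta_eq, ← mul_assoc, ← e_int_half, ← e_add]
  congr 1
  · congr 1; ring
  · refine tsum_congr fun k => ?_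
    rw [tT, tT, ← e_add_int _ (-(k * m))]
    congr 1
    push_cast
    ring

lemma theta_add_int_mul (z τ : ℂ) (m : ℤ) :
    theta (z + m * τ) τ = (-1) ^ m * e (-(m : ℂ) ^ 2 / 2 * τ - m * z) * theta z τ := by
  rw [theta_eq, theta_eq, ← e_int_half, ← e_add, ← mul_assoc, ← e_add, ← tsum_mul_left,
    ← tsum_mul_left, ← (Equiv.subRight m).tsum_eq]
  refine tsum_congr fun k => ?_
  rw [tT, tT, ← e_add, ← e_add, Equiv.subRight_apply, ← e_add_int _ m]
  congr 1
  push_cast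
  ring

lemma theta_add_one' (z τ : ℂ) : theta z (τ + 1) = e (1 / 8) * theta z τ := by
  rw [theta_eq, theta_eq, ← mul_assoc, ← e_add]
  congr 1
  · congr 1; ring
  · refine tsum_congr fun k => ?_
    obtain ⟨c, hc⟩ := Int.even_mul_succ_self k
    have hc' : (k : ℂ) * (k + 1) = c + c := by exact_mod_cast congrArg (Int.cast (R := ℂ)) hc
    rw [tT, tT, ← e_add_int ((k / 2 + (k ^ 2 / 2 + k / 2) * τ + k * z : ℂ)) c]
    congr 1
    linear_combination hc' / 2

lemma theta_S (z : ℂ) {τ : ℂ} (hτ : 0 < τ.im) :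
    theta (z / τ) (-1 / τ) =
      -Complex.I * (-Complex.I * τ) ^ (1 / 2 : ℂ) * e (z ^ 2 / (2 * τ)) * theta z τ := by
  have hτ0 : τ ≠ 0 := by rintro rfl; simp at hτ
  have hr : (-Complex.I * τ) ^ (1 / 2 : ℂ) ≠ 0 := by
    rw [Complex.cpow_ne_zero_iff]; left
    simp [hτ0]
  rw [theta_eq, theta_eq, tsum_tT_eq, tsum_tT_eq, jacobiTheta₂_functional_equation (_ + _ + _) τ]
  -- The half-period point attached to θ at -1/τ differs from the one produced by the functional
  -- equation by the period -1/τ.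
  have h1 : (z + 1 / 2 + τ / 2) / τ = z / τ + 1 / 2 + -1 / τ / 2 - -1 / τ := by
    field_simp; ring
  have h2 := jacobiTheta₂_add_left' ((z + 1 / 2 + τ / 2) / τ) (-1 / τ)
  have h3 : (z + 1 / 2 + τ / 2) / τ + -1 / τ = z / τ + 1 / 2 + -1 / τ / 2 := by
    rw [h1]; ring
  rw [h3] at h2
  rw [h2]
  have h4 : Complex.exp (-Real.pi * Complex.I * (-1 / τ + 2 * ((z + 1 / 2 + τ / 2) / τ))) =
      e (-(1 / 2) * (-1 / τ + 2 * ((z + 1 / 2 + τ / 2) / τ))) := by rw [e]; ring_nf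
  have h5 : Complex.exp (-Real.pi * Complex.I * (z + 1 / 2 + τ / 2) ^ 2 / τ) =
      e (-(1 / 2) * ((z + 1 / 2 + τ / 2) ^ 2 / τ)) := by rw [e]; ring_nf
  have hI : -Complex.I = e (-(1 / 4)) := by
    rw [e, show (2 * Real.pi * Complex.I * -(1 / 4) : ℂ) = -Real.pi / 2 * Complex.I by ring,
      Complex.exp_neg_pi_div_two_mul_I]
  rw [h4, h5]
  rw [show -Complex.I * (-Complex.I * τ) ^ (1 / 2 : ℂ) = e (-(1 / 4)) *
    (-Complex.I * τ) ^ (1 / 2 : ℂ) by rw [← hI]]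
  generalize (-Complex.I * τ) ^ (1 / 2 : ℂ) = r at hr
  generalize jacobiTheta₂ ((z + 1 / 2 + τ / 2) / τ) (-1 / τ) = J
  have haux : ∀ a b c d f g : ℂ, e (a + b) = e (c + d + f + g) →
      e a * (e b * J) = e c * r * e d * (e f * (1 / r * e g * J)) := by
    intro a b c d f g h
    simp only [e_add] at h
    field_simp
    linear_combination J * h
  apply haux
  congr 1
  field_simp
  ring

/-! ### Fourier uniqueness -/

lemma eq_zero_of_fourier {a : ℤ → ℂ} (ha : Summable fun p => ‖a p‖)
    (h : ∀ x : ℝ, ∑' p, a p * e (p * x) = 0) (q : ℤ) : a q = 0 := by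
  have he : ∀ (k : ℤ) (x : ℝ), ‖e (k * x)‖ = 1 := fun k x => by
    rw [norm_e, show (k : ℂ) * x = ((k * x : ℝ) : ℂ) by push_cast; ring, Complex.ofReal_im]
    simp
  have hcont : ∀ k : ℤ, Continuous fun x : ℝ => e (k * x) := fun k => by
    have := continuous_e
    fun_prop
  have hint : ∀ k : ℤ, ∫ x in (0 : ℝ)..1, e (k * x) = if k = 0 then 1 else 0 := by
    intro k
    split_ifs with hk
    · simp [hk, e_zero]
    · have hk' : (2 * Real.pi * Complex.I * k : ℂ) ≠ 0 := by
        simp [hk, Real.pi_ne_zero]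
      have := integral_exp_mul_complex (a := 0) (b := 1) hk'
      simp only [e, ← mul_assoc]
      rw [this, Complex.ofReal_one, mul_one, Complex.ofReal_zero, mul_zero, Complex.exp_zero]
      have h1 := e_int k
      rw [e] at h1
      rw [h1]
      simp
  have hs := intervalIntegral.hasSum_intervalIntegral_of_summable_norm (a := 0) (b := 1)
    (f := fun p : ℤ => (⟨fun x : ℝ => a p * e (p * x) * e (-q * x), by
      have := continuous_e
      fun_prop⟩ : C(ℝ, ℂ))) (by
      refine ha.of_nonneg_of_le (fun _ => norm_nonneg _) fun p => ?_
      refine (ContinuousMap.norm_le _ (norm_nonneg _)).mpr fun x => ?_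
      have h2 := he (-q) x
      simp only [Int.cast_neg, neg_mul] at h2
      simp [he, h2])
  have h0 : ∀ x : ℝ, ∑' p : ℤ, a p * e (p * x) * e (-q * x) = 0 := fun x => by
    rw [tsum_mul_right, h, zero_mul]
  simp only [ContinuousMap.coe_mk, h0, intervalIntegral.integral_zero] at hs
  have h3 : ∀ p : ℤ, ∫ x in (0 : ℝ)..1, a p * e (p * x) * e (-q * x) = if p = q then a q else 0 := by
    intro p
    have : ∀ x : ℝ, a p * e (p * x) * e (-q * x) = a p * e (((p - q : ℤ) : ℂ) * x) := fun x => by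
      rw [mul_assoc, ← e_add]
      congr 2
      push_cast
      ring
    simp only [this]
    rw [intervalIntegral.integral_const_mul, hint]
    by_cases hp : p = q
    · simp [hp]
    · simp [hp, sub_eq_zero]
  simp only [h3] at hs
  exact (hasSum_ite_eq q (a q)).unique hs

variable {n : ℕ} {τ : ℂ}

/-- The coefficients are recovered from `fB` as Fourier coefficients in x. This lets relations
between coefficient sequences be proved through their theta functions. -/
lemma eq_of_fB_eq (hn : 0 < n) {b b' : ℤ → ℂ} (hb : ∀ l, b (l + n) = b l)
    (hb' : ∀ l, b' (l + n) = b' l) (hτ : 0 < τ.im) (h : ∀ x, fB n b x τ = fB n b' x τ) : b = b' := by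
  have hs := summable_fB hn hb 0 hτ
  have hs' := summable_fB hn hb' 0 hτ
  simp only [mul_zero, add_zero] at hs hs'
  funext q
  have := eq_zero_of_fourier (a := fun p => (b p - b' p) * e ((p : ℂ) ^ 2 / (2 * n) * τ))
    (by simpa only [sub_mul] using (hs.sub hs').norm) (fun x => by
      have h1 := (summable_fB hn hb x hτ).tsum_sub (summable_fB hn hb' x hτ)
      have h2 := h x
      rw [fB, fB] at h2
      rw [h2, sub_self] at h1
      rw [← h1]
      refine tsum_congr fun p => ?_
      rw [e_add]
      ring) q
  exact sub_eq_zero.mp ((mul_eq_zero.mp this).resolve_right (e_ne_zero _))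

lemma fB_const_mul (n : ℕ) (c : ℂ) (b : ℤ → ℂ) (x τ : ℂ) :
    fB n (fun p => c * b p) x τ = c * fB n b x τ := by
  rw [fB, fB, ← tsum_mul_left]
  exact tsum_congr fun p => by ring

lemma Gf_const_mul (n : ℕ) {c : ℂ} (hc : c ≠ 0) (b : ℤ → ℂ) (l : ℤ) (t u τ : ℂ) :
    Gf n (fun p => c * b p) l t u τ = Gf n b l t u τ := by
  have h : Hf n (fun p => c * b p) l t u τ = c * Hf n b l t u τ := by
    rw [Hf, Hf, poleSum, poleSum, ← tsum_mul_left]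
    refine tsum_congr fun p => ?_
    rw [coeffH, coeffH]
    ring
  rw [Gf, Gf, h, fB_const_mul, mul_div_mul_left _ _ hc]

variable {M : ℕ}

/-- Both sides have `fB` series proportional to ∏ θ(x - t + v_j): one by `theta_S` applied to each
factor, the other by `fB_S`. Fourier uniqueness then compares coefficients. The constant C is
harmless, since `Gf` is homogeneous of degree 0 in b (`Gf_const_mul`). -/
lemma bV_S (hM : 0 < M) (v : Fin (2 * M) → ℂ) (hτ : 0 < τ.im) :
    ∃ C : ℂ, C ≠ 0 ∧ ∀ p, bV M v τ p = ∑ r ∈ Finset.range (2 * M),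
      e (-(r * p) / (2 * M : ℕ)) * (C * bV M (fun j => v j / τ) (-1 / τ) r) := by
  have hn : 0 < 2 * M := by omega
  have hτ0 : τ ≠ 0 := by rintro rfl; simp at hτ
  set b' := bV M (fun j => v j / τ) (-1 / τ) with hb'
  set b := bV M v τ with hb
  set bs : ℤ → ℂ := fun p => ∑ r ∈ Finset.range (2 * M), e (-(r * p) / (2 * M : ℕ)) * b' r with hbs
  set t := tV M v with ht
  have hper : ∀ l, b (l + (2 * M : ℕ)) = b l := bV_add hM v τ
  have hper' : ∀ l, b' (l + (2 * M : ℕ)) = b' l := bV_add hM _ _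
  have hpers : ∀ l, bs (l + (2 * M : ℕ)) = bs l := by
    intro l
    refine Finset.sum_congr rfl fun r _ => ?_
    have := exp_residue_periodic hn r l
    congr 1
    rw [mul_comm (r : ℂ), mul_comm (r : ℂ)]
    simpa using this
  have htV : tV M (fun j => v j / τ) = t / τ := by
    rw [tV, ht, tV, ← Finset.sum_div]; ring
  set r₀ := -Complex.I * (-Complex.I * τ) ^ (1 / 2 : ℂ) with hr₀
  have hr₀' : r₀ ≠ 0 := by
    rw [hr₀]
    refine mul_ne_zero (by simp) ?_
    rw [Complex.cpow_ne_zero_iff]; left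
    simp [hτ0]
  -- K collects the x-independent factors: as t is the mean of the v_j, the cross terms vanish and
  -- Σ(x - t + v_j)² = 2Mx² + Σ(v_j - t)².
  set K := r₀ ^ (2 * M) * e (∑ j, (v j - t) ^ 2 / (2 * τ)) with hK
  have hK0 : K ≠ 0 := mul_ne_zero (pow_ne_zero _ hr₀') (e_ne_zero _)
  have hR := rootFactor_ne_zero hn hτ0
  have hmain : ∀ x, rootFactor (2 * M) τ * fB (2 * M) bs x τ = K * fB (2 * M) b x τ := by
    intro x
    have h1 := fB_S hn hper' hpers (fun p => rfl) x hτ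
    have h2 := fB_bV hM (fun j => v j / τ) (im_neg_one_div_pos hτ) ((x - t) / τ)
    rw [htV, ← add_div, sub_add_cancel, ← hb', h1] at h2
    have h3 := fB_bV hM v hτ (x - t)
    rw [← ht, sub_add_cancel, ← hb] at h3
    have h4 : ∀ j, theta ((x - t) / τ + v j / τ) (-1 / τ) =
        r₀ * e ((x - t + v j) ^ 2 / (2 * τ)) * theta (x - t + v j) τ := fun j => by
      rw [← add_div, theta_S _ hτ]
    simp only [h4, Finset.prod_mul_distrib, ← e_sum, ← h3, Finset.prod_const, Finset.card_univ,
      Fintype.card_fin] at h2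
    have h5 : ∑ j, (x - t + v j) ^ 2 / (2 * τ) =
        ((2 * M : ℕ) : ℂ) * x ^ 2 / (2 * τ) + ∑ j, (v j - t) ^ 2 / (2 * τ) := by
      have h6 : ∑ j, (v j - t) = 0 := by
        rw [Finset.sum_sub_distrib, sum_eq_tV hM]
        simp [← ht]
      have h7 : ∀ j, (x - t + v j) ^ 2 / (2 * τ) = x ^ 2 / (2 * τ) + x / τ * (v j - t) +
          (v j - t) ^ 2 / (2 * τ) := fun j => by field_simp; ring
      simp only [h7, Finset.sum_add_distrib, ← Finset.mul_sum, h6, Finset.sum_const,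
        Finset.card_univ, Fintype.card_fin, nsmul_eq_mul]
      ring
    rw [h5, e_add] at h2
    have hE := e_ne_zero (((2 * M : ℕ) : ℂ) * x ^ 2 / (2 * τ))
    apply mul_left_cancel₀ hE
    rw [hK]
    linear_combination h2
  have heq : (fun p => rootFactor (2 * M) τ * bs p) = fun p => K * b p := by
    refine eq_of_fB_eq hn (fun l => by simp only [hpers]) (fun l => by simp only [hper]) hτ
      fun x => ?_
    rw [fB_const_mul, fB_const_mul, hmain]
  refine ⟨rootFactor (2 * M) τ / K, div_ne_zero hR hK0, fun p => ?_⟩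
  have h8 := congrFun heq p
  have h9 : ∑ r ∈ Finset.range (2 * M), e (-(r * p) / (2 * M : ℕ)) *
      (rootFactor (2 * M) τ / K * b' r) = rootFactor (2 * M) τ / K * bs p := by
    rw [hbs, Finset.mul_sum]
    exact Finset.sum_congr rfl fun r _ => by ring
  rw [h9]
  field_simp
  linear_combination -h8

/-- The `S`-transformation law. -/
lemma Gf_bV_S (hM : 0 < M) (v : Fin (2 * M) → ℂ) (hτ : 0 < τ.im)
    (hv : ∏ j, theta (v j) τ ≠ 0) (p : ℤ) {u : ℂ} (hu : LatticeFree τ u) :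
    Gf (2 * M) (bV M v τ) p (tV M v) u τ = jacS (2 * M) (tV M v) τ u *
      ∑ r ∈ Finset.range (2 * M), e (-(r * p) / (2 * M : ℕ)) *
        Gf (2 * M) (bV M (fun j => v j / τ) (-1 / τ)) r (tV M v / τ) (u / τ) (-1 / τ) := by
  obtain ⟨C, hC, h⟩ := bV_S hM v hτ
  have hS : SData (2 * M) (bV M v τ) (fun p => C * bV M (fun j => v j / τ) (-1 / τ) p)
      (tV M v) τ :=
    ⟨by omega, bV_add hM v τ, fun l => by simp only [bV_add hM], h, hτ, by
      rwa [fB_bV_zero hM v hτ]⟩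
  rw [hS.Gf_S p hu]
  simp only [Gf_const_mul _ hC]

lemma tT_add_one' (z τ : ℂ) (m : ℤ) : tT z (τ + 1) m = tT z τ m := by
  obtain ⟨c, hc⟩ := Int.even_mul_succ_self m
  have hc' : (m : ℂ) * (m + 1) = c + c := by exact_mod_cast congrArg (Int.cast (R := ℂ)) hc
  rw [tT, tT, ← e_add_int ((m / 2 + (m ^ 2 / 2 + m / 2) * τ + m * z : ℂ)) c]
  congr 1
  linear_combination hc' / 2

lemma bV_T (v : Fin (2 * M) → ℂ) (τ : ℂ) (p : ℤ) :
    bV M v (τ + 1) p = e (M / 4 - p ^ 2 / (4 * M)) * bV M v τ p := by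
  have h : aN v (τ + 1) (p - M) = aN v τ (p - M) := by
    simp only [aN, aT, tT_add_one']
  rw [bV, bV, h, ← mul_assoc, ← e_add]
  congr 2
  ring

/-- The `T`-transformation law. -/
lemma Gf_bV_T (hM : 0 < M) (v : Fin (2 * M) → ℂ) (τ t u : ℂ) (l : ℤ) :
    Gf (2 * M) (bV M v (τ + 1)) l t u (τ + 1) =
      e (-(l : ℂ) ^ 2 / (4 * M)) * Gf (2 * M) (bV M v τ) l t u τ := by
  have hM' : (M : ℂ) ≠ 0 := by exact_mod_cast hM.ne'
  have hf : fB (2 * M) (bV M v (τ + 1)) t (τ + 1) = e (M / 4) * fB (2 * M) (bV M v τ) t τ := by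
    rw [fB, fB, ← tsum_mul_left]
    refine tsum_congr fun p => ?_
    rw [bV_T, mul_right_comm, ← e_add, mul_comm (bV M v τ p), ← mul_assoc, ← e_add]
    congr 2
    push_cast
    field_simp
    ring
  have hH : Hf (2 * M) (bV M v (τ + 1)) l t u (τ + 1) =
      e (M / 4) * (e (-(l : ℂ) ^ 2 / (4 * M)) * Hf (2 * M) (bV M v τ) l t u τ) := by
    rw [Hf, Hf, poleSum, poleSum, ← tsum_mul_left, ← tsum_mul_left]
    refine tsum_congr fun p => ?_
    have hX : e (u + p * (τ + 1)) = e (u + p * τ) := by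
      rw [← e_add_int (u + p * τ) p]; ring_nf
    rw [hX, coeffH, coeffH, bV_T]
    have haux : ∀ A B C D E F G x y : ℂ, e (A + B + C) = e (D + E + F + G) →
        e A * x * e B * (e C / y) = e D * (e E * (x * e F * (e G / y))) := by
      intro A B C D E F G x y h
      simp only [e_add] at h
      linear_combination x / y * h
    apply haux
    rw [← e_add_int _ (-p)]
    congr 1
    push_cast
    field_simp
    ring
  rw [Gf, Gf, hf, hH, mul_div_mul_left _ _ (e_ne_zero _), Wf_T (M := M) (by omega) rfl l _ τ rfl]
  push_cast
  rw [show (2 * (2 * (M : ℂ))) = 4 * M by ring]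
  ring

/-! ### Integral shifts of the parameters -/

/-- The numerators do not change; the signs from the θ's are compensated by e(u/2), and the argument
of `R` depends only on u - |v|. -/
lemma muHat_add_int (u : ℂ) (v : Fin n → ℂ) (τ : ℂ) (m : Fin n → ℤ) :
    muHat n u (fun j => v j + m j) τ = muHat n (u - ∑ j, (m j : ℂ)) v τ := by
  have h1 : ∀ k : Fin n → ℤ, aT (fun j => v j + m j) τ k = aT v τ k := by
    intro k
    refine Finset.prod_congr rfl fun j _ => ?_
    rw [tT, tT, ← e_add_int _ (-(k j * m j))]
    congr 1
    push_cast
    ring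
  have h2 : ∀ w : ℂ, e (u - ∑ j, (m j : ℂ) + w) = e (u + w) := by
    intro w
    rw [← e_add_int _ (∑ j, m j)]
    congr 1
    push_cast
    ring
  rw [muHat, muHat]
  congr 1
  · rw [mu_eq_tsum, mu_eq_tsum]
    simp only [h1, h2, theta_add_int, Finset.prod_mul_distrib]
    congr 1
    have h3 : ∏ j, (-1 : ℂ) ^ m j = e (∑ j, (m j : ℂ) / 2) := by
      simp only [← e_int_half, e_sum]
    rw [h3, show (u - ∑ j, (m j : ℂ)) / 2 = u / 2 + -∑ j, (m j : ℂ) / 2 by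
      rw [← Finset.sum_div]; ring, e_add, e_neg]
    rw [div_mul_eq_div_div, div_eq_mul_inv (e (u / 2))]
  · congr 2
    rw [Finset.sum_add_distrib]
    ring

lemma muHat_add_int_mul (u : ℂ) (v : Fin n → ℂ) (τ : ℂ) (m : Fin n → ℤ) :
    muHat n (u + (∑ j, (m j : ℂ)) * τ) (fun j => v j + m j * τ) τ = muHat n u v τ := by
  have h1 : ∀ k : Fin n → ℤ, aT (fun j => v j + m j * τ) τ (k - m) =
      aT v τ k * e (∑ j, (-(m j / 2) - (m j ^ 2 / 2 + m j / 2) * τ - m j * v j)) := by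
    intro k
    rw [aT, aT, e_sum, ← Finset.prod_mul_distrib]
    refine Finset.prod_congr rfl fun j _ => ?_
    rw [tT, tT, ← e_add, Pi.sub_apply]
    congr 1
    push_cast
    ring
  rw [muHat, muHat]
  congr 1
  · rw [mu_eq_tsum, mu_eq_tsum, ← (Equiv.subRight m).tsum_eq]
    have h2 : ∀ k : Fin n → ℤ, u + (∑ j, (m j : ℂ)) * τ + ((∑ j, (k - m) j : ℤ) : ℂ) * τ =
        u + ((∑ j, k j : ℤ) : ℂ) * τ := by
      intro k
      simp only [Pi.sub_apply]
      push_cast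
      rw [Finset.sum_sub_distrib]
      ring
    simp only [Equiv.subRight_apply, h1, h2]
    have h3 : ∀ j, theta (v j + m j * τ) τ = e (m j / 2 + (-(m j : ℂ) ^ 2 / 2 * τ - m j * v j)) *
        theta (v j) τ := fun j => by
      rw [theta_add_int_mul, e_add, e_int_half]
    simp only [h3, Finset.prod_mul_distrib, ← e_sum]
    simp only [mul_right_comm, tsum_mul_right]
    have haux : ∀ A B C D S P : ℂ, e (A + B) = e (C + D) →
        e A / (e C * P) * (S * e B) = e D / P * S := by
      intro A B C D S P h
      simp only [e_add] at h
      have := e_ne_zero C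
      rw [div_mul_eq_mul_div, div_mul_eq_mul_div, mul_comm (e C) P, ← div_div]
      rw [div_eq_iff this]
      linear_combination S / P * h
    apply haux
    rw [← e_add_int (_ + u / 2) (-∑ j, m j)]
    congr 1
    simp only [Finset.sum_add_distrib, Finset.sum_sub_distrib, Finset.sum_neg_distrib,
      ← Finset.sum_mul, ← Finset.sum_div]
    push_cast
    ring
  · congr 2
    rw [Finset.sum_add_distrib, ← Finset.sum_mul]
    ring

end

section

/-! ### The theta function at points of order two -/

lemma norm_tT_char (r s : ℝ) (τ : ℂ) (m : ℤ) :
    ‖tT (r * τ + s) τ m‖ =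
      Real.exp (-Real.pi * τ.im * ((m : ℝ) ^ 2 + m + 2 * m * r)) := by
  rw [tT, norm_e, show (m / 2 + (m ^ 2 / 2 + m / 2) * τ + m * (r * τ + s) : ℂ) =
    ((m / 2 + m * s : ℝ) : ℂ) + (((m : ℝ) ^ 2 / 2 + m / 2 + m * r : ℝ) : ℂ) * τ by push_cast; ring,
    Complex.add_im, Complex.im_ofReal_mul, Complex.ofReal_im]
  ring_nf

lemma norm_tsum_sub_le {h : ℕ → ℂ} {ρ : ℝ} (hρ : 0 ≤ ρ) (hρ' : ρ ≤ 1 / 4) (k : ℕ)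
    (hh : ∀ n, ‖h (n + k)‖ ≤ ρ ^ (n + 1)) : ‖∑' n, h (n + k)‖ ≤ 1 / 3 := by
  have h1 : HasSum (fun n : ℕ => ρ ^ (n + 1)) (ρ * (1 - ρ)⁻¹) := by
    simpa only [pow_succ'] using (hasSum_geometric_of_lt_one hρ (by linarith)).mul_left ρ
  refine (tsum_of_norm_bounded h1 hh).trans ?_
  rw [← div_eq_mul_inv, div_le_iff₀ (by linarith)]
  linarith

lemma exp_neg_pi_mul_le {v : ℝ} (hv : 4 / 5 ≤ v) : Real.exp (-Real.pi * v) ≤ 1 / 4 := by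
  have h1 : -Real.pi * v ≤ -2 := by nlinarith [Real.pi_gt_three]
  refine (Real.exp_le_exp.mpr h1).trans ?_
  rw [Real.exp_neg, show (2 : ℝ) = 1 + 1 by norm_num, Real.exp_add]
  have := Real.exp_one_gt_d9
  rw [inv_le_comm₀ (by positivity) (by norm_num)]
  nlinarith

/-- For (r, s) = (0, 1) the terms m and -m - 1 coincide, so the sum is twice 1 plus a tail of size
at most 1/3. For r = 1, after reindexing and normalizing, the central term has norm 1 and each of
the two tails is at most 1/3. -/
lemma tsum_tT_half_lower {τ : ℂ} (hτ : 4 / 5 ≤ τ.im) {r s : ℤ}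
    (h : r = 0 ∧ s = 1 ∨ r = 1) : 1 / 3 ≤ ‖∑' m, tT ((r * τ + s) / 2) τ m‖ := by
  have hτ0 : 0 < τ.im := by linarith
  set ρ := Real.exp (-Real.pi * τ.im) with hρ
  have hρ0 : 0 ≤ ρ := (Real.exp_pos _).le
  have hρ4 : ρ ≤ 1 / 4 := exp_neg_pi_mul_le hτ
  have hρle : ∀ (x : ℝ) (k : ℕ), (k : ℝ) ≤ x → Real.exp (-Real.pi * τ.im * x) ≤ ρ ^ k := by
    intro x k hx
    rw [hρ, ← Real.exp_nat_mul]
    apply Real.exp_le_exp.mpr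
    have : 0 < Real.pi * τ.im := by have := Real.pi_pos; positivity
    nlinarith
  have hz : ((r * τ + s) / 2 : ℂ) = ((r / 2 : ℝ) : ℂ) * τ + ((s / 2 : ℝ) : ℂ) := by
    push_cast; ring
  have hnorm : ∀ m : ℤ, ‖tT ((r * τ + s) / 2) τ m‖ =
      Real.exp (-Real.pi * τ.im * ((m : ℝ) ^ 2 + m + m * r)) := fun m => by
    rw [hz, norm_tT_char]; ring_nf
  have hs : Summable fun m => tT ((r * τ + s) / 2) τ m := (summable_norm_tT _ hτ0).of_norm
  rcases h with ⟨rfl, rfl⟩ | rfl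
  · have h1 : ∀ m : ℤ, tT ((((0 : ℤ) : ℂ) * τ + (1 : ℤ)) / 2) τ m = e ((m ^ 2 / 2 + m / 2) * τ) := by
      intro m
      rw [tT, ← e_add_int ((m ^ 2 / 2 + m / 2) * τ : ℂ) m]
      congr 1
      push_cast
      ring
    have hs1 : Summable fun k : ℕ => tT ((((0 : ℤ) : ℂ) * τ + (1 : ℤ)) / 2) τ (k : ℤ) :=
      hs.comp_injective (i := fun k : ℕ => (k : ℤ)) Nat.cast_injective
    have hs2 := hs.comp_injective (i := fun k : ℕ => (-(k + 1) : ℤ)) fun a b h => by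
      simp only at h; omega
    rw [tsum_of_nat_of_neg_add_one hs1 hs2]
    have h2 : ∀ k : ℕ, tT ((((0 : ℤ) : ℂ) * τ + (1 : ℤ)) / 2) τ (-(k + 1)) =
        tT ((((0 : ℤ) : ℂ) * τ + (1 : ℤ)) / 2) τ k := by
      intro k
      rw [h1, h1]
      congr 1
      push_cast
      ring
    simp only [h2]
    rw [hs1.tsum_eq_zero_add]
    have h3 := norm_tsum_sub_le (h := fun k : ℕ => tT ((((0 : ℤ) : ℂ) * τ + (1 : ℤ)) / 2) τ k)
      hρ0 hρ4 1 fun k => by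
        rw [hnorm]
        refine hρle _ _ ?_
        push_cast
        nlinarith [sq_nonneg (k : ℝ), Nat.cast_nonneg (α := ℝ) k]
    have h4 : tT ((((0 : ℤ) : ℂ) * τ + (1 : ℤ)) / 2) τ ((0 : ℕ) : ℤ) = 1 := by
      rw [h1]; simp [e_zero]
    rw [h4]
    set S := ∑' k : ℕ, tT ((((0 : ℤ) : ℂ) * τ + (1 : ℤ)) / 2) τ ((k + 1 : ℕ) : ℤ)
    have h5 : ‖(2 : ℂ)‖ ≤ ‖1 + S + (1 + S)‖ + ‖2 * S‖ := by
      refine le_trans (le_of_eq ?_) (norm_sub_le _ _)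
      congr 1
      ring
    rw [norm_mul] at h5
    norm_num at h5
    linarith
  · set z : ℂ := (((1 : ℤ) : ℂ) * τ + s) / 2
    set g : ℤ → ℂ := fun m => tT z τ (m - 1) with hg
    have hgs : Summable g := (Equiv.subRight (1 : ℤ)).summable_iff.mpr hs
    have h0 : ∑' m, tT z τ m = ∑' m, g m := ((Equiv.subRight (1 : ℤ)).tsum_eq _).symm
    have hgn : ∀ m, ‖g m‖ = Real.exp (Real.pi * τ.im) * Real.exp (-Real.pi * τ.im * (m : ℝ) ^ 2) := by
      intro m
      rw [hg, hnorm, ← Real.exp_add]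
      congr 1
      push_cast
      ring
    set E := Real.exp (Real.pi * τ.im) with hE
    have hE1 : 1 ≤ E := Real.one_le_exp (by have := Real.pi_pos; positivity)
    have hE0 : (E : ℂ) ≠ 0 := by
      have : E ≠ 0 := by positivity
      exact_mod_cast this
    set g' : ℤ → ℂ := fun m => g m / E with hg'
    have hgs' : Summable g' := hgs.div_const _
    have hgn' : ∀ m, ‖g' m‖ = Real.exp (-Real.pi * τ.im * (m : ℝ) ^ 2) := by
      intro m
      rw [hg', norm_div, hgn, Complex.norm_real, Real.norm_of_nonneg (by positivity)]
      field_simp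
    have h0' : ∑' m, tT z τ m = E * ∑' m, g' m := by
      rw [h0, ← tsum_mul_left]
      refine tsum_congr fun m => ?_
      simp only [hg']
      field_simp
    have hs1 : Summable fun k : ℕ => g' (k : ℤ) := hgs'.comp_injective (i := fun k : ℕ => (k : ℤ)) Nat.cast_injective
    have hs2 := hgs'.comp_injective (i := fun k : ℕ => (-(k + 1) : ℤ)) fun a b h => by
      simp only at h; omega
    rw [h0', tsum_of_nat_of_neg_add_one hs1 hs2, hs1.tsum_eq_zero_add]
    have h3 := norm_tsum_sub_le (h := fun k : ℕ => g' k) hρ0 hρ4 1 fun k => by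
        rw [hgn']
        refine hρle _ _ ?_
        push_cast
        nlinarith [sq_nonneg (k : ℝ), Nat.cast_nonneg (α := ℝ) k]
    have h4 := norm_tsum_sub_le (h := fun k : ℕ => g' (-(k + 1))) hρ0 hρ4 0 fun k => by
        rw [hgn']
        refine hρle _ _ ?_
        push_cast
        nlinarith [sq_nonneg (k : ℝ), Nat.cast_nonneg (α := ℝ) k]
    simp only [add_zero] at h4
    have h5 : ‖g' ((0 : ℕ) : ℤ)‖ = 1 := by rw [hgn']; simp
    set S := ∑' k : ℕ, g' ((k + 1 : ℕ) : ℤ)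
    set S' := ∑' k : ℕ, g' (-(k + 1))
    have h6 : ‖g' ((0 : ℕ) : ℤ)‖ ≤ ‖g' ((0 : ℕ) : ℤ) + S + S'‖ + (‖S‖ + ‖S'‖) := by
      calc ‖g' ((0 : ℕ) : ℤ)‖ = ‖(g' ((0 : ℕ) : ℤ) + S + S') - (S + S')‖ := by congr 1; ring
        _ ≤ _ := (norm_sub_le _ _).trans (by gcongr; exact norm_add_le _ _)
    rw [norm_mul, Complex.norm_real, Real.norm_of_nonneg (by positivity)]
    rw [h5] at h6
    generalize ‖g' ((0 : ℕ) : ℤ) + S + S'‖ = X at h6 ⊢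
    have h7 : 1 / 3 ≤ X := by linarith
    exact h7.trans (le_mul_of_one_le_left (by linarith) hE1)

/-- A lower bound for the theta function at points of order two, high in the upper half-plane. -/
lemma exists_theta_half_lower {a b : ℤ} (hab : ¬ (Even a ∧ Even b)) :
    ∃ K : ℝ, ∀ τ : ℂ, 4 / 5 ≤ τ.im →
      1 / 3 * Real.exp (-K * τ.im) ≤ ‖theta ((a * τ + b) / 2) τ‖ := by
  obtain ⟨a', r, hr, ha⟩ : ∃ a' r : ℤ, (r = 0 ∨ r = 1) ∧ a = 2 * a' + r :=
    ⟨a / 2, a % 2, by omega, by omega⟩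
  obtain ⟨b', s, hs, hb⟩ : ∃ b' s : ℤ, (s = 0 ∨ s = 1) ∧ b = 2 * b' + s :=
    ⟨b / 2, b % 2, by omega, by omega⟩
  have hrs : r = 0 ∧ s = 1 ∨ r = 1 := by
    rcases hr with rfl | rfl
    · rcases hs with rfl | rfl
      · exact absurd ⟨⟨a', by omega⟩, ⟨b', by omega⟩⟩ hab
      · left; exact ⟨rfl, rfl⟩
    · right; rfl
  refine ⟨-Real.pi * ((a' : ℝ) ^ 2 + a' * r) + Real.pi / 4 + Real.pi * r / 2, fun τ hτ => ?_⟩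
  have h1 : ((a * τ + b) / 2 : ℂ) = (r * τ + s) / 2 + b' + a' * τ := by
    rw [ha, hb]; push_cast; ring
  rw [h1, theta_add_int_mul, theta_add_int, theta_eq, norm_mul, norm_mul, norm_mul, norm_mul]
  have h2 : ∀ m : ℤ, ‖((-1 : ℂ)) ^ m‖ = 1 := fun m => by rw [norm_zpow]; simp
  have h3 := tsum_tT_half_lower hτ hrs
  rw [h2, h2, one_mul, one_mul, ← mul_assoc, norm_e, norm_e, ← Real.exp_add, mul_comm (1 / 3 : ℝ)]
  refine mul_le_mul (le_of_eq ?_) h3 (by norm_num) (Real.exp_pos _).le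
  congr 1
  have h4 : (-(a' : ℂ) ^ 2 / 2 * τ - a' * ((r * τ + s) / 2 + b')).im =
      -((a' : ℝ) ^ 2 / 2 + a' * r / 2) * τ.im := by
    rw [show (-(a' : ℂ) ^ 2 / 2 * τ - a' * ((r * τ + s) / 2 + b')) =
      ((-((a' : ℝ) ^ 2 / 2 + a' * r / 2) : ℝ) : ℂ) * τ + ((-(a' * (s / 2 + b')) : ℝ) : ℂ) by
        push_cast; ring, Complex.add_im, Complex.im_ofReal_mul, Complex.ofReal_im, add_zero]
  have h5 : (τ / 8 + (r * τ + s) / 2 / 2 + 1 / 4 : ℂ).im = (1 / 8 + r / 4) * τ.im := by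
    rw [show (τ / 8 + (r * τ + s) / 2 / 2 + 1 / 4 : ℂ) =
      (((1 / 8 + r / 4) : ℝ) : ℂ) * τ + ((s / 4 + 1 / 4 : ℝ) : ℂ) by push_cast; ring,
      Complex.add_im, Complex.im_ofReal_mul, Complex.ofReal_im, add_zero]
  rw [h4, h5]
  ring

/-- The theta function does not vanish at points of order two. -/
def ThetaHalfNeZero (τ : ℂ) : Prop :=
  ∀ a b : ℤ, ¬ (Even a ∧ Even b) → theta ((a * τ + b) / 2) τ ≠ 0

lemma thetaHalfNeZero_add_one {τ : ℂ} (h : ThetaHalfNeZero τ) : ThetaHalfNeZero (τ + 1) := by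
  intro a b hab
  have := h a (a + b) (by rw [Int.even_add]; tauto)
  rw [show ((a * (τ + 1) + b) / 2 : ℂ) = (a * τ + (a + b : ℤ)) / 2 by push_cast; ring,
    theta_add_one']
  exact mul_ne_zero (e_ne_zero _) this

lemma thetaHalfNeZero_of_add_one {τ : ℂ} (h : ThetaHalfNeZero (τ + 1)) : ThetaHalfNeZero τ := by
  intro a b hab
  have := h a (b - a) (by rw [Int.even_sub]; tauto)
  rw [show ((a * (τ + 1) + (b - a : ℤ)) / 2 : ℂ) = (a * τ + b) / 2 by push_cast; ring,
    theta_add_one'] at this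
  exact right_ne_zero_of_mul this

lemma thetaHalfNeZero_S {τ : ℂ} (hτ : 0 < τ.im) (h : ThetaHalfNeZero τ) :
    ThetaHalfNeZero (-1 / τ) := by
  intro a b hab
  have hτ0 : τ ≠ 0 := by rintro rfl; simp at hτ
  have := h b (-a) (by rw [even_neg]; tauto)
  rw [show ((a * (-1 / τ) + b) / 2 : ℂ) = (b * τ + (-a : ℤ)) / 2 / τ by
    push_cast; field_simp; ring, theta_S _ hτ]
  refine mul_ne_zero (mul_ne_zero (mul_ne_zero (by simp) ?_) (e_ne_zero _)) this
  rw [Complex.cpow_ne_zero_iff]; left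
  simp [hτ0]

lemma coe_S_smul (τ : ℍ) : ((ModularGroup.S • τ : ℍ) : ℂ) = -1 / (τ : ℂ) := by
  rw [UpperHalfPlane.modular_S_smul, UpperHalfPlane.coe_mk, inv_neg, neg_div, one_div]

lemma coe_T_smul (τ : ℍ) : ((ModularGroup.T • τ : ℍ) : ℂ) = τ + 1 := by
  rw [UpperHalfPlane.modular_T_smul, UpperHalfPlane.coe_vadd, Complex.ofReal_one, add_comm]

lemma thetaHalfNeZero_smul_iff (g : SL(2, ℤ)) :
    ∀ τ : ℍ, ThetaHalfNeZero (g • τ : ℍ) ↔ ThetaHalfNeZero τ := by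
  have hg : g ∈ Subgroup.closure {ModularGroup.S, ModularGroup.T} := by
    rw [SpecialLinearGroup.SL2Z_generators]; trivial
  induction hg using Subgroup.closure_induction with
  | mem x hx =>
    intro τ
    rcases hx with rfl | rfl
    · rw [coe_S_smul]
      refine ⟨fun h => ?_, thetaHalfNeZero_S τ.im_pos⟩
      have := thetaHalfNeZero_S (im_neg_one_div_pos τ.im_pos) h
      rwa [show -1 / (-1 / (τ : ℂ)) = τ by have := τ.ne_zero; field_simp] at this
    · rw [coe_T_smul]
      exact ⟨thetaHalfNeZero_of_add_one, thetaHalfNeZero_add_one⟩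
  | one => intro τ; rw [one_smul]
  | mul x y _ _ hx hy => intro τ; rw [mul_smul, hx, hy]
  | inv x _ hx => intro τ; rw [← hx, smul_inv_smul]

/-- The points of order two are permuted under SL₂(ℤ), so non-vanishing need only be checked in the
fundamental domain, where the leading term dominates. -/
lemma thetaHalfNeZero (τ : ℍ) : ThetaHalfNeZero τ := by
  obtain ⟨g, hg⟩ := ModularGroup.exists_smul_mem_fd τ
  rw [← thetaHalfNeZero_smul_iff g]
  intro a b hab
  obtain ⟨K, hK⟩ := exists_theta_half_lower hab
  have h1 := ModularGroup.three_le_four_mul_im_sq_of_mem_fd hg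
  -- In the fundamental domain Im τ ≥ √3/2 > 4/5.
  have h2 : 4 / 5 ≤ (g • τ : ℍ).im := by
    have := (g • τ).im_pos
    nlinarith
  have := hK (g • τ : ℍ) h2
  rw [← norm_pos_iff]
  exact lt_of_lt_of_le (by positivity) this

end

section

/-! ### Characteristics and the normalized functions -/

/-- A characteristic: real coordinates of `u` and of the `v_j` with respect to `(τ, 1)`. -/
@[ext] structure Chr (M : ℕ) where
  a : ℝ
  b : ℝ
  va : Fin (2 * M) → ℝ
  vb : Fin (2 * M) → ℝ

lemma autFactor_ne_zero (γ : SL(2, ℤ)) (τ : ℍ) : autFactor γ τ ≠ 0 := by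
  have := UpperHalfPlane.denom_ne_zero (γ : GL (Fin 2) ℝ) τ
  simpa [autFactor, UpperHalfPlane.denom] using this

lemma coe_smul_eq (γ : SL(2, ℤ)) (τ : ℍ) : ((γ • τ : ℍ) : ℂ) =
    ((γ 0 0 : ℤ) * (τ : ℂ) + (γ 0 1 : ℤ)) / autFactor γ τ := by
  rw [UpperHalfPlane.coe_specialLinearGroup_apply]
  simp [autFactor]

lemma autFactor_mul (γ δ : SL(2, ℤ)) (τ : ℍ) :
    autFactor (γ * δ) τ = autFactor γ (δ • τ) * autFactor δ τ := by
  have h := autFactor_ne_zero δ τ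
  have h1 : autFactor γ (δ • τ) =
      (γ 1 0 : ℤ) * (((δ 0 0 : ℤ) * (τ : ℂ) + (δ 0 1 : ℤ)) / autFactor δ τ) + (γ 1 1 : ℤ) := by
    rw [autFactor, coe_smul_eq]
  rw [h1, add_mul, mul_div_assoc', div_mul_cancel₀ _ h, autFactor, autFactor,
    Matrix.SpecialLinearGroup.coe_mul, Matrix.mul_apply, Matrix.mul_apply, Fin.sum_univ_two,
    Fin.sum_univ_two]
  push_cast
  ring

lemma det_eq_one (γ : SL(2, ℤ)) : γ 0 0 * γ 1 1 - γ 0 1 * γ 1 0 = 1 := by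
  rw [← Matrix.det_fin_two]
  exact γ.det_coe

lemma LatticeFree.smul {γ : SL(2, ℤ)} {τ : ℍ} {u : ℂ} (h : LatticeFree τ u) :
    LatticeFree (γ • τ : ℍ) (u / autFactor γ τ) := by
  have hj := autFactor_ne_zero γ τ
  rw [latticeFree_iff] at h ⊢
  intro a b hu
  rw [coe_smul_eq, div_eq_iff hj, add_mul, mul_div_assoc', div_mul_cancel₀ _ hj, autFactor] at hu
  apply h (a * γ 0 0 + b * γ 1 0) (a * γ 0 1 + b * γ 1 1)
  rw [hu]
  push_cast
  ring

namespace Chr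

variable {M : ℕ}

/-- The right action of the modular group on characteristics. -/
def act (χ : Chr M) (γ : SL(2, ℤ)) : Chr M where
  a := χ.a * (γ 0 0 : ℤ) + χ.b * (γ 1 0 : ℤ)
  b := χ.a * (γ 0 1 : ℤ) + χ.b * (γ 1 1 : ℤ)
  va j := χ.va j * (γ 0 0 : ℤ) + χ.vb j * (γ 1 0 : ℤ)
  vb j := χ.va j * (γ 0 1 : ℤ) + χ.vb j * (γ 1 1 : ℤ)

lemma act_one (χ : Chr M) : χ.act 1 = χ := by
  ext <;> simp [act]

lemma act_mul (χ : Chr M) (γ δ : SL(2, ℤ)) : χ.act (γ * δ) = (χ.act γ).act δ := by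
  ext <;> simp only [act, Matrix.SpecialLinearGroup.coe_mul, Matrix.mul_apply, Fin.sum_univ_two] <;>
    push_cast <;> ring

/-- The admissible characteristics. -/
structure Good (χ : Chr M) : Prop where
  not_int : ∀ m k : ℤ, ¬ (χ.a = m ∧ χ.b = k)
  half : ∀ j, ∃ m k : ℤ, χ.va j = m / 2 ∧ χ.vb j = k / 2 ∧ ¬ (Even m ∧ Even k)

lemma Good.act {χ : Chr M} (h : χ.Good) (γ : SL(2, ℤ)) : (χ.act γ).Good := by
  have hdet := det_eq_one γ
  have hdetR : ((γ 0 0 : ℤ) : ℝ) * (γ 1 1 : ℤ) - (γ 0 1 : ℤ) * (γ 1 0 : ℤ) = 1 := by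
    exact_mod_cast hdet
  refine ⟨fun m k hmk => ?_, fun j => ?_⟩
  · obtain ⟨h1, h2⟩ := hmk
    simp only [Chr.act] at h1 h2
    -- The witnesses are the coordinates of (m, k)γ⁻¹, which are integral because det γ = 1; parity
    -- is handled in the same way below.
    apply h.not_int (m * γ 1 1 - k * γ 1 0) (-m * γ 0 1 + k * γ 0 0)
    push_cast
    rw [← h1, ← h2]
    constructor
    · linear_combination -χ.a * hdetR
    · linear_combination -χ.b * hdetR
  · obtain ⟨m, k, h1, h2, h3⟩ := h.half j
    refine ⟨m * γ 0 0 + k * γ 1 0, m * γ 0 1 + k * γ 1 1, ?_, ?_, fun ⟨h4, h5⟩ => h3 ?_⟩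
    · simp only [Chr.act, h1, h2]; push_cast; ring
    · simp only [Chr.act, h1, h2]; push_cast; ring
    · have h6 : m = (m * γ 0 0 + k * γ 1 0) * γ 1 1 - (m * γ 0 1 + k * γ 1 1) * γ 1 0 := by
        linear_combination -m * hdet
      have h7 : k = -(m * γ 0 0 + k * γ 1 0) * γ 0 1 + (m * γ 0 1 + k * γ 1 1) * γ 0 0 := by
        linear_combination -k * hdet
      have h8 := (h4.mul_right (γ 1 1)).sub (h5.mul_right (γ 1 0))
      have h9 := (h4.neg.mul_right (γ 0 1)).add (h5.mul_right (γ 0 0))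
      rw [← h6] at h8
      rw [← h7] at h9
      exact ⟨h8, h9⟩

/-- The parameter `u`. -/
def u (χ : Chr M) (ε τ : ℂ) : ℂ := 2 * M * ε + χ.a * τ + χ.b

/-- The parameters `v`. -/
def v (χ : Chr M) (τ : ℂ) (j : Fin (2 * M)) : ℂ := χ.va j * τ + χ.vb j

/-- The `τ`-coordinate of `u / 2M` minus the mean of `v`. -/
def a₀ (χ : Chr M) : ℝ := (χ.a - ∑ j, χ.va j) / (2 * M)

/-- The constant coordinate of `u / 2M` minus the mean of `v`. -/
def b₀ (χ : Chr M) : ℝ := (χ.b - ∑ j, χ.vb j) / (2 * M)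

/-- The normalized completed Appell function. -/
def Phi (χ : Chr M) (l : ℤ) (ε τ : ℂ) : ℂ :=
  e (-(M * χ.a₀ * (χ.a₀ * τ + χ.b₀ + 2 * ε))) *
    muHatShift (2 * M) (l - M) (χ.u ε τ) (χ.v τ) τ

lemma sum_v (χ : Chr M) (τ : ℂ) :
    ∑ j, χ.v τ j = ((∑ j, χ.va j : ℝ) : ℂ) * τ + ((∑ j, χ.vb j : ℝ) : ℂ) := by
  simp only [v]
  push_cast
  rw [Finset.sum_add_distrib, Finset.sum_mul]

lemma u_div_sub_tV (hM : 0 < M) (χ : Chr M) (ε τ : ℂ) :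
    χ.u ε τ / (2 * M : ℕ) - tV M (χ.v τ) = ε + χ.a₀ * τ + χ.b₀ := by
  have hM' : (M : ℂ) ≠ 0 := by exact_mod_cast hM.ne'
  rw [tV, sum_v, u, a₀, b₀]
  push_cast
  field_simp
  ring

lemma Phi_eq (hM : 0 < M) (χ : Chr M) (l : ℤ) {ε τ : ℂ} (hτ : 0 < τ.im)
    (hu : LatticeFree τ (χ.u ε τ)) :
    χ.Phi l ε τ = e (-(M * χ.a₀ * (χ.a₀ * τ + χ.b₀ + 2 * ε))) *
      ((-1) ^ l * Gf (2 * M) (bV M (χ.v τ) τ) l (tV M (χ.v τ)) (χ.u ε τ) τ) := by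
  rw [Phi, muHatShift_eq hM l _ hτ hu]

lemma Good.theta_ne_zero {χ : Chr M} (h : χ.Good) (τ : ℍ) : ∏ j, theta (χ.v τ j) τ ≠ 0 := by
  refine Finset.prod_ne_zero_iff.mpr fun j _ => ?_
  obtain ⟨m, k, h1, h2, h3⟩ := h.half j
  have := thetaHalfNeZero τ m k h3
  rw [v, h1, h2]
  convert this using 2
  push_cast
  ring

lemma Good.latticeFree {χ : Chr M} (h : χ.Good) (τ : ℍ) : LatticeFree τ (χ.u 0 τ) := by
  rw [latticeFree_iff]
  intro m k hu
  have hτ := τ.im_pos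
  rw [u, mul_zero, zero_add] at hu
  have h1 : χ.a = m := by
    have := congrArg Complex.im hu
    rw [show (m : ℂ) = ((m : ℝ) : ℂ) by push_cast; rfl,
      show (k : ℂ) = ((k : ℝ) : ℂ) by push_cast; rfl] at this
    simp only [Complex.add_im, Complex.im_ofReal_mul, Complex.ofReal_im, add_zero] at this
    exact mul_right_cancel₀ hτ.ne' this
  refine h.not_int m k ⟨h1, ?_⟩
  rw [h1] at hu
  push_cast at hu
  exact_mod_cast add_left_cancel hu

/-- The modular transformation law of the normalized functions under `γ`. -/
def Law (M : ℕ) (γ : SL(2, ℤ)) : Prop :=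
  ∃ μ : ℍ → ℂ, Continuous μ ∧ (∀ τ, μ τ ^ 2 = autFactor γ τ) ∧
    ∀ χ : Chr M, χ.Good → ∃ U : ℕ → ℕ → ℂ, ∀ l < 2 * M, ∀ (τ : ℍ) (ε : ℂ),
      LatticeFree τ ((χ.act γ).u ε τ) →
      χ.Phi l (ε / autFactor γ τ) (γ • τ : ℍ) =
        μ τ * e (-((γ 1 0 : ℤ) * M * ε ^ 2 / autFactor γ τ)) *
          ∑ p ∈ Finset.range (2 * M), U l p * (χ.act γ).Phi p ε τ

lemma Law.one : Law M 1 := by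
  have h1 : ∀ τ, autFactor 1 τ = 1 := fun τ => by simp [autFactor]
  refine ⟨fun _ => 1, continuous_const, fun τ => by rw [h1]; norm_num, fun χ _ =>
    ⟨fun l p => if p = l then 1 else 0, fun l hl τ ε _ => ?_⟩⟩
  rw [h1, one_smul, act_one]
  simp [e_zero, hl]

lemma u_act (χ : Chr M) (γ : SL(2, ℤ)) (ε : ℂ) (τ : ℍ) :
    χ.u (ε / autFactor γ τ) (γ • τ : ℍ) = (χ.act γ).u ε τ / autFactor γ τ := by
  have hj := autFactor_ne_zero γ τ
  rw [coe_smul_eq, u, u, act]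
  field_simp
  push_cast
  rw [autFactor]
  ring

lemma continuous_autFactor (γ : SL(2, ℤ)) : Continuous (autFactor γ) := by
  unfold autFactor
  fun_prop

lemma continuous_smul (γ : SL(2, ℤ)) : Continuous fun τ : ℍ => γ • τ := by
  rw [UpperHalfPlane.isEmbedding_coe.continuous_iff]
  have h : (UpperHalfPlane.coe ∘ fun τ : ℍ => γ • τ) = fun τ : ℍ =>
      ((γ 0 0 : ℤ) * (τ : ℂ) + (γ 0 1 : ℤ)) / autFactor γ τ := funext fun τ => coe_smul_eq γ τ
  rw [h]
  exact Continuous.div (by fun_prop) (continuous_autFactor γ) (autFactor_ne_zero γ)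

/-- Because μ is only required to be some continuous square root of cτ + d, the cocycle relation for
`autFactor` is all that composition needs, and no branches have to be compared. -/
lemma Law.mul {γ δ : SL(2, ℤ)} (hγ : Law M γ) (hδ : Law M δ) : Law M (γ * δ) := by
  obtain ⟨μ, hμ, hμ2, hU⟩ := hγ
  obtain ⟨ν, hν, hν2, hV⟩ := hδ
  refine ⟨fun τ => μ (δ • τ) * ν τ, (hμ.comp (continuous_smul δ)).mul hν, fun τ => by
    rw [mul_pow, hμ2, hν2, autFactor_mul], fun χ hχ => ?_⟩
  obtain ⟨U, hU⟩ := hU χ hχ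
  obtain ⟨V, hV⟩ := hV (χ.act γ) (hχ.act γ)
  refine ⟨fun l p => ∑ r ∈ Finset.range (2 * M), U l r * V r p, fun l hl τ ε hε => ?_⟩
  have hj := autFactor_ne_zero δ τ
  have hj' := autFactor_ne_zero γ (δ • τ)
  rw [act_mul] at hε ⊢
  have h1 : LatticeFree (δ • τ : ℍ) ((χ.act γ).u (ε / autFactor δ τ) (δ • τ : ℍ)) := by
    rw [u_act]
    exact hε.smul
  have h2 := hU l hl (δ • τ) (ε / autFactor δ τ) h1
  rw [autFactor_mul, mul_smul, mul_comm (autFactor γ (δ • τ)), ← div_div, h2]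
  have h3 : ∀ r ∈ Finset.range (2 * M), _ := fun r hr =>
    hV r (Finset.mem_range.mp hr) τ ε hε
  have h4 : ∑ r ∈ Finset.range (2 * M), U l r *
      (χ.act γ).Phi r (ε / autFactor δ τ) (δ • τ : ℍ) =
      ν τ * e (-((δ 1 0 : ℤ) * M * ε ^ 2 / autFactor δ τ)) * ∑ p ∈ Finset.range (2 * M),
        (∑ r ∈ Finset.range (2 * M), U l r * V r p) * ((χ.act γ).act δ).Phi p ε τ := by
    rw [Finset.sum_congr rfl fun r hr => by rw [h3 r hr]]
    simp only [Finset.sum_mul, Finset.mul_sum]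
    rw [Finset.sum_comm]
    refine Finset.sum_congr rfl fun p _ => Finset.sum_congr rfl fun r _ => ?_
    ring
  rw [h4]
  have h5 : e (-((γ 1 0 : ℤ) * M * (ε / autFactor δ τ) ^ 2 / autFactor γ (δ • τ))) *
      e (-((δ 1 0 : ℤ) * M * ε ^ 2 / autFactor δ τ)) =
      e (-(((γ * δ) 1 0 : ℤ) * M * ε ^ 2 / (autFactor δ τ * autFactor γ (δ • τ)))) := by
    rw [← e_add]
    congr 1
    have h6 := autFactor_mul γ δ τ
    have hdet : ((δ 0 0 : ℤ) : ℂ) * (δ 1 1 : ℤ) - (δ 0 1 : ℤ) * (δ 1 0 : ℤ) = 1 := by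
      exact_mod_cast det_eq_one δ
    -- The relation c(γδ)·j(δ,τ) = c(γ) + c(δ)·j(γδ,τ) is exactly the additivity of the exponents in
    -- ε².
    have h7 : (((γ * δ) 1 0 : ℤ) : ℂ) * autFactor δ τ =
        (γ 1 0 : ℤ) + (δ 1 0 : ℤ) * (autFactor γ (δ • τ) * autFactor δ τ) := by
      rw [← h6, autFactor, autFactor, Matrix.SpecialLinearGroup.coe_mul, Matrix.mul_apply,
        Matrix.mul_apply, Fin.sum_univ_two, Fin.sum_univ_two]
      push_cast
      linear_combination (γ 1 0 : ℂ) * hdet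
    field_simp
    linear_combination M * ε ^ 2 * h7
  rw [← h5]
  ring

/-! #### The generators -/

/-- The target characteristic is kept as a variable χ', so that the same statement, read in the two
directions, gives T and its inverse. -/
lemma Phi_T (hM : 0 < M) (χ : Chr M) (l : ℤ) {ε τ : ℂ} (hτ : 0 < τ.im) {χ' : Chr M}
    (ha : χ'.a = χ.a) (hb : χ'.b = χ.a + χ.b) (hva : χ'.va = χ.va)
    (hvb : ∀ j, χ'.vb j = χ.va j + χ.vb j) (hu : LatticeFree τ (χ'.u ε τ)) :
    χ.Phi l ε (τ + 1) = e (-(l : ℂ) ^ 2 / (4 * M)) * χ'.Phi l ε τ := by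
  have hv : χ.v (τ + 1) = χ'.v τ := by
    funext j; rw [v, v, hvb, hva]; push_cast; ring
  have hu' : χ.u ε (τ + 1) = χ'.u ε τ := by
    rw [u, u, ha, hb]; push_cast; ring
  have h0 : χ'.a₀ = χ.a₀ := by rw [a₀, a₀, ha, hva]
  have h0' : χ'.b₀ = χ.a₀ + χ.b₀ := by
    rw [b₀, b₀, a₀, hb]
    simp only [hvb, Finset.sum_add_distrib]
    ring
  have hlf : LatticeFree (τ + 1) (χ.u ε (τ + 1)) := by
    rw [hu']
    rw [latticeFree_iff] at hu ⊢
    intro a b h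
    apply hu a (a + b)
    rw [h]; push_cast; ring
  rw [Phi_eq hM χ l (by simpa using hτ) hlf, Phi_eq hM χ' l hτ hu, hv, hu', Gf_bV_T hM, h0, h0']
  push_cast
  rw [show (χ.a₀ : ℂ) * (τ + 1) + χ.b₀ + 2 * ε = χ.a₀ * τ + (χ.a₀ + χ.b₀) + 2 * ε by ring]
  ring

lemma Law.T (hM : 0 < M) : Law M ModularGroup.T := by
  have h1 : ∀ τ, autFactor ModularGroup.T τ = 1 := fun τ => by
    simp [autFactor, ModularGroup.T]
  refine ⟨fun _ => 1, continuous_const, fun τ => by rw [h1]; norm_num, fun χ _ =>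
    ⟨fun l p => if p = l then e (-(l : ℂ) ^ 2 / (4 * M)) else 0, fun l hl τ ε hu => ?_⟩⟩
  have h2 := Phi_T hM χ l (ε := ε) τ.im_pos (χ' := χ.act ModularGroup.T)
    (by simp [act, ModularGroup.T]) (by simp [act, ModularGroup.T])
    (by funext j; simp [act, ModularGroup.T]) (fun j => by simp [act, ModularGroup.T]) hu
  rw [h1, coe_T_smul, div_one, h2]
  simp [ModularGroup.T, e_zero, hl]

lemma Law.T_inv (hM : 0 < M) : Law M ModularGroup.T⁻¹ := by
  have h10 : ModularGroup.T⁻¹ 1 0 = 0 := by decide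
  have h11 : ModularGroup.T⁻¹ 1 1 = 1 := by decide
  have h00 : ModularGroup.T⁻¹ 0 0 = 1 := by decide
  have h01 : ModularGroup.T⁻¹ 0 1 = -1 := by decide
  have h1 : ∀ τ, autFactor ModularGroup.T⁻¹ τ = 1 := fun τ => by
    simp [autFactor, h10, h11]
  refine ⟨fun _ => 1, continuous_const, fun τ => by rw [h1]; norm_num, fun χ _ =>
    ⟨fun l p => if p = l then e ((l : ℂ) ^ 2 / (4 * M)) else 0, fun l hl τ ε hu => ?_⟩⟩
  have hτ : ((ModularGroup.T⁻¹ • τ : ℍ) : ℂ) = τ - 1 := by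
    rw [coe_smul_eq, h1, h00, h01]; push_cast; ring
  have hu2 : LatticeFree (τ - 1 : ℂ) (χ.u ε (τ - 1 : ℂ)) := by
    have := hu.smul (γ := ModularGroup.T⁻¹)
    rw [← u_act, h1, div_one, hτ] at this
    exact this
  have h2 := Phi_T hM (χ.act ModularGroup.T⁻¹) l (ε := ε) (τ := (τ : ℂ) - 1)
    (by simpa using τ.im_pos) (χ' := χ)
    (by simp [act, h00, h10]) (by simp [act, h00, h10, h01, h11])
    (by funext j; simp [act, h00, h10]) (fun j => by simp [act, h00, h10, h01, h11]) hu2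
  rw [sub_add_cancel] at h2
  rw [h1, hτ, div_one, h10]
  simp only [ite_mul, zero_mul, Finset.sum_ite_eq', Finset.mem_range, hl, if_true, h2]
  rw [← mul_assoc (e ((l : ℂ) ^ 2 / (4 * M))), ← e_add]
  simp only [Int.cast_zero, zero_mul, zero_div, neg_zero, e_zero, one_mul, Int.cast_natCast]
  rw [show (l : ℂ) ^ 2 / (4 * M) + -(l : ℂ) ^ 2 / (4 * M) = 0 by ring, e_zero, one_mul]

lemma continuous_rootFactor_neg_inv {n : ℕ} (hn : 0 < n) :
    Continuous fun τ : ℍ => rootFactor n (-1 / (τ : ℂ)) := by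
  have hn' : (0 : ℝ) < n := by exact_mod_cast hn
  unfold rootFactor
  refine Continuous.cpow ?_ continuous_const fun τ => ?_
  · have : ∀ τ : ℍ, (τ : ℂ) ≠ 0 := fun τ => τ.ne_zero
    fun_prop (disch := assumption)
  · left
    have h := im_neg_one_div_pos τ.im_pos
    rw [show -Complex.I * (-1 / (τ : ℂ)) / n = ((1 / n : ℝ) : ℂ) * (-Complex.I * (-1 / (τ : ℂ))) by
      push_cast; ring, Complex.re_ofReal_mul]
    have h2 : (-Complex.I * (-1 / (τ : ℂ))).re = (-1 / (τ : ℂ)).im := by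
      rw [Complex.mul_re]; simp
    rw [h2]
    exact mul_pos (by positivity) h

/-- S and its inverse act alike on ℍ, but dividing the parameters by -1/τ produces the
characteristic acted on by S⁻¹ without an extra sign. The law is `Gf_bV_S` at the point -1/τ. -/
lemma Law.S_inv (hM : 0 < M) : Law M ModularGroup.S⁻¹ := by
  have h10 : ModularGroup.S⁻¹ 1 0 = -1 := by decide
  have h11 : ModularGroup.S⁻¹ 1 1 = 0 := by decide
  have h00 : ModularGroup.S⁻¹ 0 0 = 0 := by decide
  have h01 : ModularGroup.S⁻¹ 0 1 = 1 := by decide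
  have hn : 0 < 2 * M := by omega
  have hM' : (M : ℂ) ≠ 0 := by exact_mod_cast hM.ne'
  have h1 : ∀ τ : ℍ, autFactor ModularGroup.S⁻¹ τ = -τ := fun τ => by
    simp [autFactor, h10, h11]
  -- The constant is fixed by c² = 2Mi, which makes the square of c·(-τ)·`rootFactor` at -1/τ equal
  -- to the automorphy factor -τ.
  set c : ℂ := (Complex.I * (2 * M : ℕ)) ^ (((2 : ℕ) : ℂ)⁻¹) with hc
  have hc2 : c ^ 2 = Complex.I * (2 * M : ℕ) := Complex.cpow_nat_inv_pow _ (by norm_num)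
  have hc0 : c ≠ 0 := by
    intro h
    rw [h] at hc2
    simp [hM'] at hc2
  refine ⟨fun τ => c * (-τ * rootFactor (2 * M) (-1 / (τ : ℂ))), ?_, fun τ => ?_, fun χ hχ =>
    ⟨fun l r => c⁻¹ * ((-1) ^ l * (-1) ^ r) * e (-((r : ℂ) * l) / (2 * M : ℕ)),
      fun l hl τ ε hu => ?_⟩⟩
  · have := continuous_rootFactor_neg_inv hn
    fun_prop
  · have hr : rootFactor (2 * M) (-1 / (τ : ℂ)) ^ 2 = -Complex.I * (-1 / τ) / (2 * M : ℕ) := by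
      rw [rootFactor, one_div, show (2 : ℂ) = ((2 : ℕ) : ℂ) by norm_num]
      exact Complex.cpow_nat_inv_pow _ (by norm_num)
    have := τ.ne_zero
    rw [mul_pow, mul_pow, hr, hc2, h1]
    push_cast
    field_simp
    linear_combination Complex.I_sq
  · have hτ0 := τ.ne_zero
    have hτ : ((ModularGroup.S⁻¹ • τ : ℍ) : ℂ) = -1 / τ := by
      rw [coe_smul_eq, h1, h00, h01]; push_cast; field_simp; ring
    have hu2 := hu.smul (γ := ModularGroup.S⁻¹)
    rw [← u_act] at hu2
    have hua := u_act χ ModularGroup.S⁻¹ ε τ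
    have hθ := hχ.theta_ne_zero (ModularGroup.S⁻¹ • τ)
    have hva : ∀ j, χ.v (-1 / (τ : ℂ)) j / (-1 / (τ : ℂ)) = (χ.act ModularGroup.S⁻¹).v τ j := by
      intro j
      simp only [v, act, h00, h10, h01, h11]
      push_cast
      field_simp
      ring
    have hta : tV M (χ.v (-1 / (τ : ℂ))) / (-1 / (τ : ℂ)) =
        tV M ((χ.act ModularGroup.S⁻¹).v τ) := by
      rw [tV, tV, div_right_comm, Finset.sum_div]
      simp only [hva]
    have hS := Gf_bV_S hM _ (ModularGroup.S⁻¹ • τ).im_pos hθ l hu2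
    have hy := u_div_sub_tV hM χ (ε / autFactor ModularGroup.S⁻¹ τ)
      ((ModularGroup.S⁻¹ • τ : ℍ) : ℂ)
    rw [Phi_eq hM χ l (ModularGroup.S⁻¹ • τ).im_pos hu2, hS, jacS, hy]
    rw [hτ] at hua ⊢
    have huτ : χ.u (ε / autFactor ModularGroup.S⁻¹ τ) (-1 / (τ : ℂ)) / (-1 / (τ : ℂ)) =
        (χ.act ModularGroup.S⁻¹).u ε τ := by
      rw [hua, h1]; field_simp
    simp only [huτ, hta, hva]
    rw [show -1 / (-1 / (τ : ℂ)) = τ by field_simp]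
    have ha0 : (χ.act ModularGroup.S⁻¹).a₀ = -χ.b₀ := by
      simp only [a₀, b₀, act, h00, h10]
      push_cast
      simp only [mul_zero, mul_neg, mul_one, zero_add, Finset.sum_neg_distrib]
      ring
    have hb0 : (χ.act ModularGroup.S⁻¹).b₀ = χ.a₀ := by
      simp only [a₀, b₀, act, h01, h11]
      push_cast
      simp only [mul_zero, mul_one, add_zero]
    -- The prefactor of `Phi` absorbs the part of the Jacobi exponential that involves the
    -- characteristic and leaves only the ε² term.
    have hE : e (-(M * χ.a₀ * (χ.a₀ * (-1 / (τ : ℂ)) + χ.b₀ +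
        2 * (ε / autFactor ModularGroup.S⁻¹ τ)))) *
        e ((2 * M : ℕ) * (ε / autFactor ModularGroup.S⁻¹ τ + χ.a₀ * (-1 / (τ : ℂ)) + χ.b₀) ^ 2 /
          (2 * (-1 / (τ : ℂ)))) =
        e (-((-1 : ℤ) * M * ε ^ 2 / autFactor ModularGroup.S⁻¹ τ)) *
          e (-(M * (χ.act ModularGroup.S⁻¹).a₀ * ((χ.act ModularGroup.S⁻¹).a₀ * τ +
            (χ.act ModularGroup.S⁻¹).b₀ + 2 * ε))) := by
      rw [← e_add, ← e_add, ha0, hb0, h1]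
      congr 1
      push_cast
      field_simp
      ring
    rw [h10]
    have hP : ∀ r : ℕ, (χ.act ModularGroup.S⁻¹).Phi r ε τ = _ := fun r =>
      Phi_eq hM (χ.act ModularGroup.S⁻¹) r τ.im_pos hu
    simp only [hP]
    have hsum : ∀ (B : ℂ) (G : ℕ → ℂ), ∑ r ∈ Finset.range (2 * M),
        c⁻¹ * ((-1) ^ l * (-1) ^ r) * e (-((r : ℂ) * l) / (2 * M : ℕ)) *
          (B * ((-1) ^ (r : ℤ) * G r)) = c⁻¹ * (-1) ^ l * B *
        ∑ r ∈ Finset.range (2 * M), e (-((r : ℂ) * (l : ℤ)) / (2 * M : ℕ)) * G r := by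
      intro B G
      rw [Finset.mul_sum]
      refine Finset.sum_congr rfl fun r _ => ?_
      have hsq : ((-1 : ℂ)) ^ r * (-1) ^ (r : ℤ) = 1 := by
        rw [zpow_natCast, ← mul_pow]; simp
      rw [Int.cast_natCast]
      linear_combination c⁻¹ * (-1) ^ l * e (-((r : ℂ) * l) / (2 * M : ℕ)) * B * G r * hsq
    rw [hsum]
    set S := ∑ r ∈ Finset.range (2 * M), e (-((r : ℂ) * (l : ℤ)) / (2 * M : ℕ)) *
      Gf (2 * M) (bV M ((χ.act ModularGroup.S⁻¹).v τ) τ) r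
        (tV M ((χ.act ModularGroup.S⁻¹).v τ)) ((χ.act ModularGroup.S⁻¹).u ε τ) τ with hS'
    rw [show (-1 / (τ : ℂ))⁻¹ = -τ by field_simp, zpow_natCast]
    generalize rootFactor (2 * M) (-1 / (τ : ℂ)) = ρ
    have haux : ∀ E₁ E₂ E₃ E₄ : ℂ, E₁ * E₂ = E₃ * E₄ →
        E₁ * ((-1) ^ l * (-(τ : ℂ) * ρ * E₂ * S)) =
          c * (-τ * ρ) * E₃ * (c⁻¹ * (-1) ^ l * E₄ * S) := by
      intro E₁ E₂ E₃ E₄ h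
      have hcc := mul_inv_cancel₀ hc0
      linear_combination ((-1) ^ l * (-(τ : ℂ) * ρ) * S) * h -
        ((-1) ^ l * (-(τ : ℂ) * ρ) * S) * E₃ * E₄ * hcc
    exact haux _ _ _ _ hE

lemma law (hM : 0 < M) (γ : SL(2, ℤ)) : Law M γ := by
  have hγ : γ ∈ Subgroup.closure {ModularGroup.S, ModularGroup.T} := by
    rw [SpecialLinearGroup.SL2Z_generators]; trivial
  have hS := Law.S_inv hM
  induction hγ using Subgroup.closure_induction'' with
  | mem x hx =>
    rcases hx with rfl | rfl
    -- S has order four, so S is the cube of its inverse.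
    · have : ModularGroup.S = ModularGroup.S⁻¹ * ModularGroup.S⁻¹ * ModularGroup.S⁻¹ := by decide
      rw [this]
      exact (hS.mul hS).mul hS
    · exact Law.T hM
  | inv_mem x hx =>
    rcases hx with rfl | rfl
    · exact hS
    · exact Law.T_inv hM
  | one => exact Law.one
  | mul x y _ _ hx hy => exact hx.mul hy

end Chr

end

section
namespace Chr

variable {M : ℕ}

/-! #### Integral shifts of the characteristic -/

lemma Good.Phi_add (hM : 0 < M) {χ : Chr M} (hχ : χ.Good) (l : ℤ) {ε : ℂ} {τ : ℍ}
    (hu : LatticeFree τ (χ.u ε τ)) : χ.Phi (l + (2 * M : ℕ)) ε τ = χ.Phi l ε τ := by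
  have hf : fB (2 * M) (bV M (χ.v τ) τ) (tV M (χ.v τ)) τ ≠ 0 := by
    rw [fB_bV_zero hM _ τ.im_pos]
    exact hχ.theta_ne_zero τ
  rw [Phi_eq hM χ _ τ.im_pos hu, Phi_eq hM χ _ τ.im_pos hu,
    Gf_add_n (by omega) (bV_add hM _ _) l τ.im_pos hf hu, zpow_add₀ (by norm_num), zpow_natCast,
    pow_mul]
  simp

lemma Good.Phi_emod (hM : 0 < M) {χ : Chr M} (hχ : χ.Good) (l : ℤ) {ε : ℂ} {τ : ℍ}
    (hu : LatticeFree τ (χ.u ε τ)) :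
    χ.Phi ((l % (2 * M : ℕ)).toNat : ℕ) ε τ = χ.Phi l ε τ := by
  have hn : (0 : ℤ) < (2 * M : ℕ) := by omega
  have hper : ∀ (p a : ℤ), χ.Phi (p + a * (2 * M : ℕ)) ε τ = χ.Phi p ε τ := by
    intro p a
    induction a using Int.induction_on with
    | zero => simp
    | succ k ih => rw [add_mul, one_mul, ← add_assoc, hχ.Phi_add hM _ hu, ih]
    | pred k ih =>
      rw [← ih, ← hχ.Phi_add hM (p + (-(k : ℤ) - 1) * (2 * M : ℕ)) hu]; congr 1; ring
  rw [Int.toNat_of_nonneg (Int.emod_nonneg _ hn.ne'), ← hper (l % (2 * M : ℕ)) (l / (2 * M : ℕ)),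
    mul_comm (l / ((2 * M : ℕ) : ℤ)), Int.emod_add_mul_ediv]

/-- When u moves by the sum of the shifts of the v_j, the quantities u - |v|, a₀ and b₀ stay fixed,
and μ̂ is invariant by `muHat_add_int` and `muHat_add_int_mul`. -/
lemma Phi_shift_v {χ χ' : Chr M} (m k : Fin (2 * M) → ℤ)
    (ha : χ'.a = χ.a + ∑ j, (m j : ℝ)) (hb : χ'.b = χ.b + ∑ j, (k j : ℝ))
    (hva : ∀ j, χ'.va j = χ.va j + m j) (hvb : ∀ j, χ'.vb j = χ.vb j + k j) (l : ℤ) (ε τ : ℂ) :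
    χ'.Phi l ε τ = χ.Phi l ε τ := by
  have h1 : χ'.a₀ = χ.a₀ := by
    rw [a₀, a₀, ha]
    simp only [hva, Finset.sum_add_distrib]
    ring
  have h2 : χ'.b₀ = χ.b₀ := by
    rw [b₀, b₀, hb]
    simp only [hvb, Finset.sum_add_distrib]
    ring
  have h3 : χ'.u ε τ = χ.u ε τ + (∑ j, (m j : ℂ)) * τ + ∑ j, (k j : ℂ) := by
    rw [u, u, ha, hb]
    push_cast
    ring
  have h4 : χ'.v τ = fun j => (χ.v τ j + m j * τ) + k j := by
    funext j
    rw [v, v, hva, hvb]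
    push_cast
    ring
  have h5 : χ'.u ε τ - ∑ j, χ'.v τ j = χ.u ε τ - ∑ j, χ.v τ j := by
    rw [h3, h4]
    simp only [Finset.sum_add_distrib, ← Finset.sum_mul]
    ring
  rw [Phi, Phi, h1, h2, muHatShift, muHatShift, h5, h3, h4, muHat_add_int]
  congr 2
  rw [← muHat_add_int_mul (χ.u ε τ + _) _ _ m]
  congr 1
  ring

/-- The characteristic with shifted `u`. -/
def addU (χ : Chr M) (m k : ℝ) : Chr M := { χ with a := χ.a + m, b := χ.b + k }

lemma addU_u (χ : Chr M) (m k : ℝ) (ε τ : ℂ) : (χ.addU m k).u ε τ = χ.u ε τ + m * τ + k := by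
  rw [u, u, addU]
  push_cast
  ring

lemma addU_u_latticeFree {χ : Chr M} {ε τ : ℂ} (h : LatticeFree τ (χ.u ε τ)) (m k : ℤ) :
    LatticeFree τ ((χ.addU m k).u ε τ) := by
  rw [addU_u]
  simpa using h.add_int_mul_add_int m k

lemma addU_addU (χ : Chr M) (m k m' k' : ℝ) :
    (χ.addU m k).addU m' k' = χ.addU (m + m') (k + k') := by
  simp only [addU, add_assoc]

lemma addU_zero (χ : Chr M) : χ.addU 0 0 = χ := by
  simp only [addU, add_zero]

lemma addU_b₀ (χ : Chr M) (m k : ℝ) : (χ.addU m k).b₀ = χ.b₀ + k / (2 * M) := by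
  simp only [b₀, addU]
  ring

lemma addU_a₀ (χ : Chr M) (m k : ℝ) : (χ.addU m k).a₀ = χ.a₀ + m / (2 * M) := by
  simp only [a₀, addU]
  ring

lemma Phi_addU_one_right (hM : 0 < M) (χ : Chr M) (l : ℤ) {ε τ : ℂ} (hτ : 0 < τ.im)
    (hu : LatticeFree τ (χ.u ε τ)) :
    (χ.addU 0 1).Phi l ε τ = e (-(χ.a₀ / 2) - l / (2 * M)) * χ.Phi l ε τ := by
  have hM' : (M : ℂ) ≠ 0 := by exact_mod_cast hM.ne'
  have hu' : LatticeFree τ ((χ.addU 0 1).u ε τ) := by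
    simpa using addU_u_latticeFree hu 0 1
  have h1 : (χ.addU 0 1).u ε τ = χ.u ε τ + 1 := by rw [addU_u]; simp
  have hv : (χ.addU 0 1).v τ = χ.v τ := rfl
  rw [Phi_eq hM _ l hτ hu', Phi_eq hM χ l hτ hu, h1, hv, Gf_add_one (by omega), addU_a₀, addU_b₀]
  have haux : ∀ A B C D x G : ℂ, e (A + B) = e (C + D) →
      e A * (x * (e B * G)) = e C * (e D * (x * G)) := by
    intro A B C D x G h
    simp only [e_add] at h
    linear_combination x * G * h
  apply haux
  congr 1
  push_cast
  field_simp
  ring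

lemma Phi_addU_one_left (hM : 0 < M) (χ : Chr M) (l : ℤ) {ε τ : ℂ} (hτ : 0 < τ.im)
    (hu : LatticeFree τ (χ.u ε τ)) :
    (χ.addU 1 0).Phi l ε τ = e (1 / 2 + χ.b₀ / 2) * χ.Phi (l + 1) ε τ := by
  have hM' : (M : ℂ) ≠ 0 := by exact_mod_cast hM.ne'
  have hu' : LatticeFree τ ((χ.addU 1 0).u ε τ) := by
    simpa using addU_u_latticeFree hu 1 0
  have h1 : (χ.addU 1 0).u ε τ = χ.u ε τ + τ := by rw [addU_u]; simp
  have hv : (χ.addU 1 0).v τ = χ.v τ := rfl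
  rw [Phi_eq hM _ l hτ hu', Phi_eq hM χ _ hτ hu, h1, hv, Gf_add_tau (by omega) _ _ _ _ hτ, addU_a₀,
    addU_b₀, u_div_sub_tV hM, zpow_add₀ (by norm_num), zpow_one, ← e_half]
  have haux : ∀ A B C D F x G : ℂ, e (A + B) = e (C + D + F) →
      e A * (x * (e B * G)) = e C * (e D * (x * e F * G)) := by
    intro A B C D F x G h
    simp only [e_add] at h
    linear_combination x * G * h
  apply haux
  rw [← e_add_int _ 1]
  congr 1
  push_cast
  field_simp
  ring

lemma exists_Phi_addU_right (hM : 0 < M) (χ : Chr M) (k : ℤ) : ∃ c : ℤ → ℂ, ∀ l ε τ,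
    0 < Complex.im τ → LatticeFree τ (χ.u ε τ) → (χ.addU 0 k).Phi l ε τ = c l * χ.Phi l ε τ := by
  induction k using Int.induction_on with
  | zero => exact ⟨fun _ => 1, fun l ε τ _ _ => by rw [Int.cast_zero, addU_zero, one_mul]⟩
  | succ k ih =>
    obtain ⟨c, hc⟩ := ih
    refine ⟨fun l => e (-((χ.addU 0 (k : ℤ)).a₀ / 2) - l / (2 * M)) * c l, fun l ε τ hτ hu => ?_⟩
    have h1 : LatticeFree τ ((χ.addU 0 (k : ℤ)).u ε τ) := by
      simpa using addU_u_latticeFree hu 0 k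
    have h2 := Phi_addU_one_right hM (χ.addU 0 (k : ℤ)) l hτ h1
    rw [addU_addU, add_zero] at h2
    push_cast at h2 hc ⊢
    rw [h2, hc l ε τ hτ hu, mul_assoc]
  | pred k ih =>
    obtain ⟨c, hc⟩ := ih
    refine ⟨fun l => e (-(-((χ.addU 0 ((-(k : ℤ) - 1 : ℤ) : ℝ)).a₀ / 2) - l / (2 * M))) * c l,
      fun l ε τ hτ hu => ?_⟩
    have h1 : LatticeFree τ ((χ.addU 0 ((-(k : ℤ) - 1 : ℤ) : ℝ)).u ε τ) := by
      simpa using addU_u_latticeFree hu 0 (-(k : ℤ) - 1)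
    have h2 := Phi_addU_one_right hM (χ.addU 0 ((-(k : ℤ) - 1 : ℤ) : ℝ)) l hτ h1
    rw [addU_addU, add_zero, show ((-(k : ℤ) - 1 : ℤ) : ℝ) + 1 = ((-(k : ℤ) : ℤ) : ℝ) by
      push_cast; ring, hc l ε τ hτ hu] at h2
    rw [mul_assoc, h2, ← mul_assoc, ← e_add, neg_add_cancel, e_zero, one_mul]

lemma exists_Phi_addU (hM : 0 < M) (χ : Chr M) (m k : ℤ) : ∃ c : ℤ → ℂ, ∀ l ε τ,
    0 < Complex.im τ → LatticeFree τ (χ.u ε τ) →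
      (χ.addU m k).Phi l ε τ = c l * χ.Phi (l + m) ε τ := by
  induction m using Int.induction_on with
  | zero => simpa using exists_Phi_addU_right hM χ k
  | succ m ih =>
    obtain ⟨c, hc⟩ := ih
    refine ⟨fun l => e (1 / 2 + (χ.addU (m : ℤ) k).b₀ / 2) * c (l + 1), fun l ε τ hτ hu => ?_⟩
    have h1 : LatticeFree τ ((χ.addU (m : ℤ) k).u ε τ) := addU_u_latticeFree hu m k
    have h2 := Phi_addU_one_left hM (χ.addU (m : ℤ) k) l hτ h1
    rw [addU_addU, add_zero] at h2
    push_cast at h2 hc ⊢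
    rw [h2, hc _ ε τ hτ hu, mul_assoc, add_assoc l 1, add_comm (1 : ℤ)]
  | pred m ih =>
    obtain ⟨c, hc⟩ := ih
    refine ⟨fun l => e (-(1 / 2 + (χ.addU ((-(m : ℤ) - 1 : ℤ) : ℝ) k).b₀ / 2)) * c (l - 1),
      fun l ε τ hτ hu => ?_⟩
    have h1 : LatticeFree τ ((χ.addU ((-(m : ℤ) - 1 : ℤ) : ℝ) k).u ε τ) :=
      addU_u_latticeFree hu _ k
    have h2 := Phi_addU_one_left hM (χ.addU ((-(m : ℤ) - 1 : ℤ) : ℝ) k) (l - 1) hτ h1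
    rw [addU_addU, add_zero, show ((-(m : ℤ) - 1 : ℤ) : ℝ) + 1 = ((-(m : ℤ) : ℤ) : ℝ) by
      push_cast; ring, hc _ ε τ hτ hu, sub_add_cancel] at h2
    rw [show l + (-(m : ℤ) - 1) = l - 1 + -(m : ℤ) by ring, mul_assoc, h2, ← mul_assoc, ← e_add,
      neg_add_cancel, e_zero, one_mul]

/-- Shifting the v_j together with u by their sum costs nothing. The residual shift of u, by A - Σm
and B - Σk, moves l by A - Σm and multiplies by constants, so the matrix is monomial modulo 2M. -/
lemma exists_matrix_of_int_shift (hM : 0 < M) {χ χ' : Chr M} (hχ : χ.Good) (A B : ℤ)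
    (m k : Fin (2 * M) → ℤ) (ha : χ'.a = χ.a + A) (hb : χ'.b = χ.b + B)
    (hva : ∀ j, χ'.va j = χ.va j + m j) (hvb : ∀ j, χ'.vb j = χ.vb j + k j) :
    ∃ U : ℕ → ℕ → ℂ, ∀ l : ℕ, ∀ (τ : ℍ) (ε : ℂ), LatticeFree τ (χ.u ε τ) →
      χ'.Phi l ε τ = ∑ p ∈ Finset.range (2 * M), U l p * χ.Phi p ε τ := by
  obtain ⟨c, hc⟩ := exists_Phi_addU hM χ (A - ∑ j, m j) (B - ∑ j, k j)
  refine ⟨fun l p => if p = ((l + (A - ∑ j, m j)) % (2 * M : ℕ)).toNat then c l else 0,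
    fun l τ ε hu => ?_⟩
  have h1 := Phi_shift_v (χ := χ.addU ((A - ∑ j, m j : ℤ) : ℝ) ((B - ∑ j, k j : ℤ) : ℝ))
    (χ' := χ') m k (by rw [ha]; simp only [addU]; push_cast; ring)
    (by rw [hb]; simp only [addU]; push_cast; ring) hva hvb l ε τ
  rw [h1, hc l ε τ τ.im_pos hu]
  have hn : (0 : ℤ) < (2 * M : ℕ) := by omega
  have hlt : ((l + (A - ∑ j, m j)) % (2 * M : ℕ)).toNat < 2 * M := by
    have := Int.emod_lt_of_pos (l + (A - ∑ j, m j)) hn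
    have := Int.emod_nonneg (l + (A - ∑ j, m j)) hn.ne'
    omega
  simp only [ite_mul, zero_mul, Finset.sum_ite_eq', Finset.mem_range, hlt, if_true]
  rw [hχ.Phi_emod hM _ hu]

/-- The transformation law when `γ` preserves the characteristic modulo integers. -/
lemma exists_law (hM : 0 < M) {χ : Chr M} (hχ : χ.Good) (γ : SL(2, ℤ)) (A B : ℤ)
    (m k : Fin (2 * M) → ℤ) (ha : (χ.act γ).a = χ.a + A) (hb : (χ.act γ).b = χ.b + B)
    (hva : ∀ j, (χ.act γ).va j = χ.va j + m j) (hvb : ∀ j, (χ.act γ).vb j = χ.vb j + k j) :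
    ∃ μ : ℍ → ℂ, Continuous μ ∧ (∀ τ, μ τ ^ 2 = autFactor γ τ) ∧ ∃ U : ℕ → ℕ → ℂ,
      ∀ l < 2 * M, ∀ (τ : ℍ) (ε : ℂ), LatticeFree τ (χ.u ε τ) →
        χ.Phi l (ε / autFactor γ τ) (γ • τ : ℍ) =
          μ τ * e (-((γ 1 0 : ℤ) * M * ε ^ 2 / autFactor γ τ)) *
            ∑ p ∈ Finset.range (2 * M), U l p * χ.Phi p ε τ := by
  obtain ⟨μ, hμ, hμ2, h⟩ := law hM γ
  obtain ⟨U, hU⟩ := h χ hχ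
  obtain ⟨V, hV⟩ := exists_matrix_of_int_shift hM hχ A B m k ha hb hva hvb
  refine ⟨μ, hμ, hμ2, fun l p => ∑ r ∈ Finset.range (2 * M), U l r * V r p,
    fun l hl τ ε hu => ?_⟩
  have hu' : LatticeFree τ ((χ.act γ).u ε τ) := by
    have := hu.add_int_mul_add_int A B
    rw [u, ha, hb]
    rw [u] at this
    push_cast
    convert this using 1
    ring
  rw [hU l hl τ ε hu', Finset.sum_congr rfl fun r _ => by rw [hV r τ ε hu]]
  congr 1
  simp only [Finset.sum_mul, Finset.mul_sum]
  rw [Finset.sum_comm]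
  refine Finset.sum_congr rfl fun p _ => Finset.sum_congr rfl fun r _ => ?_
  ring

end Chr
end

section

/-! ### Holomorphy of the Appell function -/

variable {n : ℕ}

/-- The Appell sum with the `j`-th powers of the polar factors. -/
def pS (j : ℕ) (v : Fin n → ℂ) (τ u : ℂ) : ℂ :=
  ∑' k : Fin n → ℤ, aT v τ k * ((1 - e (u + (∑ i, k i : ℤ) * τ))⁻¹) ^ j

lemma mu_eq_pS (u : ℂ) (v : Fin n → ℂ) (τ : ℂ) :
    mu n u v τ = e (u / 2) / (∏ j, theta (v j) τ) * pS 1 v τ u := by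
  rw [mu_eq_tsum, pS]
  simp only [pow_one]

lemma norm_pS_term_le {a : ℂ} {X : ℂ} {m δ : ℝ} (hδ : 0 < δ) (ha : ‖a‖ ≤ m)
    (hX : δ ≤ ‖1 - X‖) (j : ℕ) : ‖a * ((1 - X)⁻¹) ^ j‖ ≤ m * (δ⁻¹) ^ j := by
  rw [norm_mul, norm_pow, norm_inv]
  have := (norm_nonneg a).trans ha
  gcongr

lemma summable_pS (j : ℕ) (v : Fin n → ℂ) {τ u : ℂ} (hτ : 0 < τ.im) (hu : LatticeFree τ u) :
    Summable fun k : Fin n → ℤ => aT v τ k * ((1 - e (u + (∑ i, k i : ℤ) * τ))⁻¹) ^ j := by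
  obtain ⟨δ, hδ, h⟩ := exists_lower_bound u hτ
  exact Summable.of_norm_bounded ((summable_norm_aT v hτ).mul_right ((δ⁻¹) ^ j)) fun k =>
    norm_pS_term_le hδ le_rfl ((h.self_of_nhds _).resolve_left (hu _)) j

/-- With X = 1 - (1 - X), the derivative of (1 - X)⁻¹ is 2πi times (1 - X)⁻² - (1 - X)⁻¹. This is
the reason for admitting powers j in `pS`. -/
lemma hasDerivAt_pS (v : Fin n → ℂ) {τ u₀ : ℂ} (hτ : 0 < τ.im) (hu : LatticeFree τ u₀) :
    HasDerivAt (fun u => pS 1 v τ u)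
      (2 * Real.pi * Complex.I * (pS 2 v τ u₀ - pS 1 v τ u₀)) u₀ := by
  obtain ⟨δ, hδ, h⟩ := exists_lower_bound u₀ hτ
  have hc : ContinuousAt (fun u : ℂ => (u, τ)) u₀ := by fun_prop
  obtain ⟨r, hr, hball⟩ := Metric.eventually_nhds_iff_ball.mp (hc.eventually h)
  have hne : ∀ u ∈ Metric.ball u₀ r, ∀ m : ℤ, δ ≤ ‖1 - e (u + m * τ)‖ := fun u hu' m =>
    (hball u hu' m).resolve_left (hu m)
  have hne' : ∀ u ∈ Metric.ball u₀ r, ∀ m : ℤ, 1 - e (u + m * τ) ≠ 0 := fun u hu' m h0 => by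
    have := hne u hu' m
    rw [h0, norm_zero] at this
    linarith
  have hder : ∀ u ∈ Metric.ball u₀ r, ∀ k : Fin n → ℤ,
      HasDerivAt (fun u => aT v τ k * ((1 - e (u + (∑ i, k i : ℤ) * τ))⁻¹) ^ 1)
        (2 * Real.pi * Complex.I * (aT v τ k * ((1 - e (u + (∑ i, k i : ℤ) * τ))⁻¹) ^ 2 -
          aT v τ k * ((1 - e (u + (∑ i, k i : ℤ) * τ))⁻¹) ^ 1)) u := by
    intro u hu' k
    have h0 := hne' u hu' (∑ i, k i)
    have h1 : HasDerivAt (fun u : ℂ => u + ((∑ i, k i : ℤ) : ℂ) * τ) 1 u :=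
      (hasDerivAt_id u).add_const _
    have h2 := (HasDerivAt.const_sub (1 : ℂ) (HasDerivAt.comp u
      (h := fun u : ℂ => u + ((∑ i, k i : ℤ) : ℂ) * τ) (hasDerivAt_e _) h1)).fun_inv h0
    simp only [pow_one]
    refine (h2.const_mul (aT v τ k)).congr_deriv ?_
    simp only [Function.comp_apply]
    field_simp
    ring
  have hs := Complex.hasSum_deriv_of_summable_norm (U := Metric.ball u₀ r)
    ((summable_norm_aT v hτ).mul_right ((δ⁻¹) ^ 1))
    (fun k u hu' => (hder u hu' k).differentiableAt.differentiableWithinAt) Metric.isOpen_ball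
    (fun k u hu' => norm_pS_term_le hδ le_rfl (hne u hu' _) 1) (Metric.mem_ball_self hr)
  have hd := Complex.differentiableOn_tsum_of_summable_norm (U := Metric.ball u₀ r)
    ((summable_norm_aT v hτ).mul_right ((δ⁻¹) ^ 1))
    (fun k u hu' => (hder u hu' k).differentiableAt.differentiableWithinAt) Metric.isOpen_ball
    (fun k u hu' => norm_pS_term_le hδ le_rfl (hne u hu' _) 1)
  have hd0 := (hd u₀ (Metric.mem_ball_self hr)).differentiableAt
    (Metric.isOpen_ball.mem_nhds (Metric.mem_ball_self hr))
  refine hd0.hasDerivAt.congr_deriv ?_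
  rw [← hs.tsum_eq]
  rw [pS, pS, ← (summable_pS 2 v hτ hu).tsum_sub (summable_pS 1 v hτ hu), ← tsum_mul_left]
  exact tsum_congr fun k => (hder u₀ (Metric.mem_ball_self hr) k).deriv

lemma im_char (r s : ℝ) (τ : ℂ) : ((r : ℂ) * τ + s).im = r * τ.im := by
  rw [Complex.add_im, Complex.im_ofReal_mul, Complex.ofReal_im, add_zero]

lemma exists_local_bound_aT (va vb : Fin n → ℝ) {τ₀ : ℂ} (hτ : 0 < τ₀.im) :
    ∃ m : (Fin n → ℤ) → ℝ, Summable m ∧ ∀ᶠ τ in nhds τ₀, ∀ k,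
      ‖aT (fun j => va j * τ + vb j) τ k‖ ≤ m k := by
  set A := Real.pi * (τ₀.im / 2) with hA
  have hA0 : 0 < A := by positivity
  set B : Fin n → ℝ := fun j => Real.pi * (2 * τ₀.im) + 2 * Real.pi * (|va j| * (2 * τ₀.im))
    with hB
  have hs := summable_and_tsum_pi_prod
    (fun (j : Fin n) (m : ℤ) => ((Real.exp (-A * (m : ℝ) ^ 2 + B j * |(m : ℝ)|) : ℝ) : ℂ))
    fun j => by
      have := summable_gauss' 0 hA0 (B j)
      simp only [add_zero] at this
      simpa only [Complex.norm_real, Real.norm_of_nonneg (Real.exp_pos _).le] using this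
  refine ⟨_, hs.1, ?_⟩
  have h1 : ∀ᶠ τ : ℂ in nhds τ₀, τ₀.im / 2 < τ.im :=
    Complex.continuous_im.continuousAt.eventually_const_lt (by linarith)
  have h2 : ∀ᶠ τ : ℂ in nhds τ₀, τ.im < 2 * τ₀.im :=
    Complex.continuous_im.continuousAt.eventually_lt_const (by linarith)
  filter_upwards [h1, h2] with τ h1 h2 k
  have hπ := Real.pi_pos
  rw [aT, norm_prod, norm_prod]
  refine Finset.prod_le_prod (fun _ _ => norm_nonneg _) fun j _ => ?_
  rw [Complex.norm_real, Real.norm_of_nonneg (Real.exp_pos _).le]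
  refine norm_tT_le (by linarith) (by rw [hA]; gcongr) ?_ _
  rw [im_char, abs_mul, abs_of_pos (by linarith : 0 < τ.im), hB]
  simp only
  gcongr

lemma differentiableAt_pS (j : ℕ) (va vb : Fin n → ℝ) (A B : ℝ) {τ₀ : ℂ} (hτ : 0 < τ₀.im)
    (hu : LatticeFree τ₀ (A * τ₀ + B)) :
    DifferentiableAt ℂ (fun τ => pS j (fun i => va i * τ + vb i) τ (A * τ + B)) τ₀ := by
  obtain ⟨δ, hδ, h⟩ := exists_lower_bound (A * τ₀ + B : ℂ) hτ
  obtain ⟨m, hm, hm'⟩ := exists_local_bound_aT va vb hτ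
  have hc : ContinuousAt (fun τ : ℂ => ((A * τ + B : ℂ), τ)) τ₀ := by fun_prop
  obtain ⟨r, hr, hball⟩ := Metric.eventually_nhds_iff_ball.mp ((hc.eventually h).and hm')
  have hne : ∀ τ ∈ Metric.ball τ₀ r, ∀ m : ℤ, δ ≤ ‖1 - e ((A * τ + B) + m * τ)‖ :=
    fun τ hτ' m => ((hball τ hτ').1 m).resolve_left (hu m)
  have hd := Complex.differentiableOn_tsum_of_summable_norm (U := Metric.ball τ₀ r)
    (F := fun k τ => aT (fun i => (va i : ℂ) * τ + vb i) τ k *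
      ((1 - e ((A * τ + B) + (∑ i, k i : ℤ) * τ))⁻¹) ^ j)
    (hm.mul_right ((δ⁻¹) ^ j))
    (fun k τ hτ' => by
      have h0 : 1 - e ((A * τ + B) + (∑ i, k i : ℤ) * τ) ≠ 0 := fun h0 => by
        have := hne τ hτ' (∑ i, k i)
        rw [h0, norm_zero] at this
        linarith
      have h1 : DifferentiableAt ℂ (fun τ => aT (fun i => (va i : ℂ) * τ + vb i) τ k) τ := by
        unfold aT tT
        fun_prop
      have h2 : DifferentiableAt ℂ
          (fun τ : ℂ => 1 - e ((A * τ + B) + (∑ i, k i : ℤ) * τ)) τ := by fun_prop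
      exact (h1.mul ((h2.inv h0).pow j)).differentiableWithinAt) Metric.isOpen_ball
    (fun k τ hτ' => norm_pS_term_le hδ ((hball τ hτ').2 k) (hne τ hτ' _) j)
  exact (hd τ₀ (Metric.mem_ball_self hr)).differentiableAt
    (Metric.isOpen_ball.mem_nhds (Metric.mem_ball_self hr))

lemma differentiableAt_theta (r s : ℝ) {τ : ℂ} (hτ : 0 < τ.im) :
    DifferentiableAt ℂ (fun τ => theta (r * τ + s) τ) τ := by
  simp only [theta_eq, tsum_tT_eq]
  have h1 : DifferentiableAt ℂ (fun τ : ℂ => ((r * τ + s + 1 / 2 + τ / 2 : ℂ), τ)) τ := by fun_prop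
  have h2 := (hasFDerivAt_jacobiTheta₂ (r * τ + s + 1 / 2 + τ / 2) hτ).differentiableAt
  have h3 := DifferentiableAt.comp τ (f := fun τ : ℂ => ((r * τ + s + 1 / 2 + τ / 2 : ℂ), τ)) h2 h1
  have h4 : DifferentiableAt ℂ (fun τ : ℂ => e (τ / 8 + (r * τ + s) / 2 + 1 / 4)) τ := by fun_prop
  exact h4.mul h3

/-! ### Exponential growth -/

/-- At most linear exponential growth as `Im τ → ∞`. -/
def ExpGrowth (f : ℂ → ℂ) : Prop :=
  ∃ K C : ℝ, 0 ≤ K ∧ ∀ τ : ℂ, 1 ≤ τ.im → ‖f τ‖ ≤ K * Real.exp (C * τ.im)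

namespace ExpGrowth

variable {f g : ℂ → ℂ}

lemma of_le (hf : ExpGrowth f) (h : ∀ τ : ℂ, 1 ≤ τ.im → ‖g τ‖ ≤ ‖f τ‖) : ExpGrowth g := by
  obtain ⟨K, C, hK, hf⟩ := hf
  exact ⟨K, C, hK, fun τ hτ => (h τ hτ).trans (hf τ hτ)⟩

lemma const (c : ℂ) : ExpGrowth fun _ => c := ⟨‖c‖, 0, norm_nonneg _, fun τ _ => by simp⟩

lemma mul (hf : ExpGrowth f) (hg : ExpGrowth g) : ExpGrowth fun τ => f τ * g τ := by
  obtain ⟨K, C, hK, hf⟩ := hf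
  obtain ⟨K', C', hK', hg⟩ := hg
  refine ⟨K * K', C + C', mul_nonneg hK hK', fun τ hτ => ?_⟩
  rw [norm_mul, add_mul, Real.exp_add, mul_mul_mul_comm]
  exact mul_le_mul (hf τ hτ) (hg τ hτ) (norm_nonneg _) ((norm_nonneg _).trans (hf τ hτ))

lemma add (hf : ExpGrowth f) (hg : ExpGrowth g) : ExpGrowth fun τ => f τ + g τ := by
  obtain ⟨K, C, hK, hf⟩ := hf
  obtain ⟨K', C', hK', hg⟩ := hg
  refine ⟨K + K', max C C', add_nonneg hK hK', fun τ hτ => (norm_add_le _ _).trans ?_⟩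
  have h0 : 0 ≤ τ.im := by linarith
  rw [add_mul]
  refine add_le_add ((hf τ hτ).trans ?_) ((hg τ hτ).trans ?_)
  · gcongr; exact le_max_left _ _
  · gcongr; exact le_max_right _ _

lemma neg (hf : ExpGrowth f) : ExpGrowth fun τ => -f τ :=
  hf.of_le fun τ _ => by rw [norm_neg]

lemma sub (hf : ExpGrowth f) (hg : ExpGrowth g) : ExpGrowth fun τ => f τ - g τ := by
  simpa only [sub_eq_add_neg] using hf.add hg.neg

lemma prod {ι : Type*} {s : Finset ι} {F : ι → ℂ → ℂ} (h : ∀ i ∈ s, ExpGrowth (F i)) :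
    ExpGrowth fun τ => ∏ i ∈ s, F i τ := by
  classical
  induction s using Finset.induction_on with
  | empty => simpa using const 1
  | insert a s ha ih =>
    simp only [Finset.prod_insert ha]
    exact (h a (Finset.mem_insert_self a s)).mul
      (ih fun i hi => h i (Finset.mem_insert_of_mem hi))

lemma sum {ι : Type*} {s : Finset ι} {F : ι → ℂ → ℂ} (h : ∀ i ∈ s, ExpGrowth (F i)) :
    ExpGrowth fun τ => ∑ i ∈ s, F i τ := by
  classical
  induction s using Finset.induction_on with
  | empty => simpa using const 0
  | insert a s ha ih =>
    simp only [Finset.sum_insert ha]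
    exact (h a (Finset.mem_insert_self a s)).add
      (ih fun i hi => h i (Finset.mem_insert_of_mem hi))

lemma e_char (r s : ℝ) : ExpGrowth fun τ => e (r * τ + s) :=
  ⟨1, -2 * Real.pi * r, zero_le_one, fun τ _ => by rw [norm_e, im_char, one_mul, ← mul_assoc]⟩

end ExpGrowth

lemma expGrowth_inv_theta {r s : ℝ}
    (h : ∃ m k : ℤ, r = m / 2 ∧ s = k / 2 ∧ ¬ (Even m ∧ Even k)) :
    ExpGrowth fun τ => (theta (r * τ + s) τ)⁻¹ := by
  obtain ⟨m, k, rfl, rfl, hmk⟩ := h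
  obtain ⟨K, hK⟩ := exists_theta_half_lower hmk
  refine ⟨3, K, by norm_num, fun τ hτ => ?_⟩
  have h1 := hK τ (by linarith)
  simp only
  rw [show (((m / 2 : ℝ) : ℂ) * τ + ((k / 2 : ℝ) : ℂ)) = (m * τ + k) / 2 by push_cast; ring, norm_inv]
  rw [inv_le_comm₀ (lt_of_lt_of_le (by positivity) h1) (by positivity), mul_inv, ← Real.exp_neg]
  refine le_trans (le_of_eq ?_) h1
  rw [neg_mul]
  norm_num

/-- Either A + N = 0, and then B is not an integer; or |A + N| is at least some fixed d > 0, and for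
Im τ ≥ 1 the modulus of e is bounded away from 1. -/
lemma exists_global_lower_bound {A B : ℝ} (h : ∀ m k : ℤ, ¬ (A = m ∧ B = k)) :
    ∃ δ > 0, ∀ τ : ℂ, 1 ≤ τ.im → ∀ N : ℤ, δ ≤ ‖1 - e ((A * τ + B) + N * τ)‖ := by
  obtain ⟨d, hd, hd'⟩ : ∃ d > 0, ∀ N : ℤ, A + N = 0 ∨ d ≤ |A + N| := by
    by_cases hA : ∃ m : ℤ, A = m
    · obtain ⟨m, rfl⟩ := hA
      refine ⟨1, one_pos, fun N => ?_⟩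
      rw [← Int.cast_add]
      by_cases h0 : m + N = 0
      · left; rw [h0]; simp
      · right
        exact_mod_cast Int.one_le_abs h0
    · refine ⟨|A - round A|, abs_pos.mpr (sub_ne_zero.mpr fun h => hA ⟨_, h⟩), fun N => ?_⟩
      right
      have := round_le A (-N)
      push_cast at this
      rwa [sub_neg_eq_add] at this
  have hexp : Real.exp (-(2 * Real.pi * d)) < 1 := by
    rw [Real.exp_lt_one_iff]
    have := Real.pi_pos
    nlinarith [mul_pos this hd]
  obtain ⟨δ₀, hδ₀, hδ₀'⟩ : ∃ δ₀ > 0, (∃ N : ℤ, A + N = 0) → δ₀ ≤ ‖1 - e B‖ := by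
    by_cases hA : ∃ N : ℤ, A + N = 0
    · obtain ⟨N, hN⟩ := hA
      refine ⟨‖1 - e B‖, norm_pos_iff.mpr fun h0 => ?_, fun _ => le_rfl⟩
      obtain ⟨k, hk⟩ := (e_eq_one_iff _).mp (sub_eq_zero.mp h0).symm
      exact h (-N) k ⟨by push_cast; linarith, by exact_mod_cast hk⟩
    · exact ⟨1, one_pos, fun h => absurd h hA⟩
  refine ⟨min δ₀ (1 - Real.exp (-(2 * Real.pi * d))), lt_min hδ₀ (by linarith), fun τ hτ N => ?_⟩
  have him : (A * τ + B : ℂ) + N * τ = ((A + N : ℝ) : ℂ) * τ + B := by push_cast; ring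
  rw [him]
  rcases hd' N with h0 | h1
  · rw [h0, Complex.ofReal_zero, zero_mul, zero_add]
    exact (min_le_left _ _).trans (hδ₀' ⟨N, h0⟩)
  · refine (min_le_right _ _).trans ?_
    have hπ := Real.pi_pos
    have hnorm : ‖e (((A + N : ℝ) : ℂ) * τ + B)‖ = Real.exp (-2 * Real.pi * ((A + N) * τ.im)) := by
      rw [norm_e, im_char]
    rcases le_abs.mp h1 with h2 | h2
    · have h3 : ‖e (((A + N : ℝ) : ℂ) * τ + B)‖ ≤ Real.exp (-(2 * Real.pi * d)) := by
        rw [hnorm]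
        apply Real.exp_le_exp.mpr
        have : d ≤ (A + N) * τ.im := by nlinarith
        nlinarith
      have h4 := norm_sub_norm_le (1 : ℂ) (e (((A + N : ℝ) : ℂ) * τ + B))
      rw [norm_one] at h4
      linarith
    · have h3 : Real.exp (2 * Real.pi * d) ≤ ‖e (((A + N : ℝ) : ℂ) * τ + B)‖ := by
        rw [hnorm]
        apply Real.exp_le_exp.mpr
        have : d ≤ -(A + N) * τ.im := by nlinarith
        nlinarith
      have h4 := norm_sub_norm_le (e (((A + N : ℝ) : ℂ) * τ + B)) 1
      rw [norm_one, norm_sub_rev] at h4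
      have h5 : 1 - Real.exp (-(2 * Real.pi * d)) ≤ Real.exp (2 * Real.pi * d) - 1 := by
        have h6 : 2 ≤ Real.exp (2 * Real.pi * d) + Real.exp (-(2 * Real.pi * d)) := by
          have := Real.add_one_le_exp (2 * Real.pi * d)
          have := Real.add_one_le_exp (-(2 * Real.pi * d))
          linarith
        linarith
      linarith

lemma expGrowth_pS (j : ℕ) (va vb : Fin n → ℝ) {A B : ℝ} (h : ∀ m k : ℤ, ¬ (A = m ∧ B = k)) :
    ExpGrowth fun τ => pS j (fun i => va i * τ + vb i) τ (A * τ + B) := by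
  obtain ⟨δ, hδ, hδ'⟩ := exists_global_lower_bound h
  -- The square m² + m + 2m·va_i is completed as (m + c_i)² - c_i². For Im τ ≥ 1 the first part is
  -- summable uniformly in τ, and the second gives the growth exponent.
  set c : Fin n → ℝ := fun i => 1 / 2 + va i with hc
  have hs := summable_and_tsum_pi_prod
    (fun (i : Fin n) (m : ℤ) => ((Real.exp (-Real.pi * ((m : ℝ) + c i) ^ 2) : ℝ) : ℂ))
    fun i => by
      have := summable_gauss' (c i) Real.pi_pos 0
      simp only [zero_mul, add_zero] at this
      simpa only [Complex.norm_real, Real.norm_of_nonneg (Real.exp_pos _).le] using this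
  set K := ∑' k : Fin n → ℤ,
    ‖∏ i, ((Real.exp (-Real.pi * ((k i : ℝ) + c i) ^ 2) : ℝ) : ℂ)‖ with hK
  refine ⟨K * (δ⁻¹) ^ j, Real.pi * ∑ i, c i ^ 2, by positivity, fun τ hτ => ?_⟩
  have hbound : ∀ k : Fin n → ℤ, ‖aT (fun i => (va i : ℂ) * τ + vb i) τ k‖ ≤
      Real.exp (Real.pi * (∑ i, c i ^ 2) * τ.im) *
        ‖∏ i, ((Real.exp (-Real.pi * ((k i : ℝ) + c i) ^ 2) : ℝ) : ℂ)‖ := by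
    intro k
    rw [aT, norm_prod, norm_prod, Finset.mul_sum, Finset.sum_mul, Real.exp_sum,
      ← Finset.prod_mul_distrib]
    refine Finset.prod_le_prod (fun _ _ => norm_nonneg _) fun i _ => ?_
    rw [norm_tT_char, Complex.norm_real, Real.norm_of_nonneg (Real.exp_pos _).le, ← Real.exp_add]
    apply Real.exp_le_exp.mpr
    have h1 : (k i : ℝ) ^ 2 + k i + 2 * k i * va i = ((k i : ℝ) + c i) ^ 2 - c i ^ 2 := by
      rw [hc]; ring
    rw [h1]
    have h2 : 0 ≤ Real.pi * ((k i : ℝ) + c i) ^ 2 := by positivity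
    nlinarith
  simp only [pS]
  refine (tsum_of_norm_bounded (hs.1.hasSum.mul_left
    (Real.exp (Real.pi * (∑ i, c i ^ 2) * τ.im) * (δ⁻¹) ^ j)) fun k => ?_).trans (le_of_eq ?_)
  · refine (norm_pS_term_le hδ (hbound k) (hδ' τ hτ _) j).trans (le_of_eq ?_)
    ring
  · rw [← hK]; ring

end

section

/-! ### Harmonicity -/

lemma HasWirtinger.of_eq {f g : ℂ → ℂ} {α β α' β' x : ℂ} (h : HasWirtinger f α β x)
    (hf : g = f) (hα : α' = α) (hβ : β' = β) : HasWirtinger g α' β' x := by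
  subst hf hα hβ
  exact h

lemma HasWirtinger.fderiv_apply {f : ℂ → ℂ} {α β x : ℂ} (h : HasWirtinger f α β x) (z : ℂ) :
    fderiv ℝ f x z = α * z + β * (starRingEnd ℂ) z := by
  have h1 : fderiv ℝ f x = _ := HasFDerivAt.fderiv h
  rw [h1]
  simp

lemma hasWirtinger_im {g : ℝ → ℝ} {g' : ℝ} {τ : ℂ} (h : HasDerivAt g g' τ.im) :
    HasWirtinger (fun τ => (g τ.im : ℂ)) (-Complex.I / 2 * g') (Complex.I / 2 * g') τ := by
  have h1 := h.hasFDerivAt.comp τ Complex.imCLM.hasFDerivAt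
  have h2 := Complex.ofRealCLM.hasFDerivAt.comp τ h1
  refine HasWirtinger.of_hasFDerivAt h2 fun z => ?_
  simp only [ContinuousLinearMap.comp_apply, Complex.ofRealCLM_apply, Complex.imCLM_apply,
    ContinuousLinearMap.toSpanSingleton_apply, smul_eq_mul, Complex.ofReal_mul, im_eq_conj]
  ring

/-- A smooth function with `∂F/∂τ̄ = v^{-k} · conj(holomorphic)` is harmonic of weight `k`. -/
lemma laplacian_eq_zero {F β : ℂ → ℂ} {k : ℝ} (hF : ContDiffOn ℝ 2 F {z | 0 < z.im})
    (hβ : ∀ z : ℂ, 0 < z.im → fderiv ℝ F z 1 + Complex.I * fderiv ℝ F z Complex.I = 2 * β z)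
    (hβ' : ∀ z : ℂ, 0 < z.im → ∃ β₂, HasWirtinger β (Complex.I * k / (2 * z.im) * β z) β₂ z)
    (τ : ℍ) : laplacian k (fun τ : ℍ => F τ) τ = 0 := by
  have hopen : IsOpen {z : ℂ | 0 < z.im} := isOpen_lt continuous_const Complex.continuous_im
  have hat : ∀ z : ℂ, 0 < z.im → ContDiffAt ℝ 2 F z := fun z hz => hF.contDiffAt (hopen.mem_nhds hz)
  have hD : ∀ z : ℂ, 0 < z.im → HasFDerivAt F (fderiv ℝ F z) z := fun z hz =>
    ((hat z hz).differentiableAt (by norm_num)).hasFDerivAt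
  have hD2 : ∀ z : ℂ, 0 < z.im →
      HasFDerivAt (fderiv ℝ F) (fderiv ℝ (fderiv ℝ F) z) z := fun z hz =>
    (((hat z hz).fderiv_right (m := 1) (by norm_num)).differentiableAt (by norm_num)).hasFDerivAt
  have hτ := τ.im_pos
  have hcoe : ((τ.re : ℂ) + (τ.im : ℂ) * Complex.I) = τ := Complex.re_add_im _
  have hlu : ∀ u v : ℝ, HasDerivAt (fun u : ℝ => (u : ℂ) + (v : ℂ) * Complex.I) 1 u := fun u v =>
    (Complex.ofRealCLM.hasDerivAt (x := u)).add_const _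
  have hlv : ∀ u v : ℝ, HasDerivAt (fun v : ℝ => (u : ℂ) + (v : ℂ) * Complex.I) Complex.I v :=
    fun u v => by
      have := ((Complex.ofRealCLM.hasDerivAt (x := v)).mul_const Complex.I).const_add (u : ℂ)
      simpa using this
  have him : ∀ u v : ℝ, ((u : ℂ) + (v : ℂ) * Complex.I).im = v := fun u v => by simp
  have hin : ∀ u v : ℝ, 0 < v →
      inCoords (fun τ : ℍ => F τ) u v = F ((u : ℂ) + (v : ℂ) * Complex.I) := fun u v hv => by
    rw [inCoords, UpperHalfPlane.ofComplex_apply_of_im_pos (by rwa [him])]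
  have hfu : (fun u => inCoords (fun τ : ℍ => F τ) u τ.im) =
      fun u : ℝ => F ((u : ℂ) + (τ.im : ℂ) * Complex.I) := funext fun u => hin u _ hτ
  have hfv : (fun v => inCoords (fun τ : ℍ => F τ) τ.re v) =ᶠ[nhds τ.im]
      fun v : ℝ => F ((τ.re : ℂ) + (v : ℂ) * Complex.I) :=
    Filter.eventuallyEq_of_mem (Ioi_mem_nhds hτ) fun v hv => hin _ v hv
  have hdu : ∀ u v : ℝ, 0 < v → HasDerivAt (fun u : ℝ => F ((u : ℂ) + (v : ℂ) * Complex.I))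
      (fderiv ℝ F ((u : ℂ) + (v : ℂ) * Complex.I) 1) u := fun u v hv =>
    (hD _ (by rwa [him])).comp_hasDerivAt u (hlu u v)
  have hdv : ∀ u v : ℝ, 0 < v → HasDerivAt (fun v : ℝ => F ((u : ℂ) + (v : ℂ) * Complex.I))
      (fderiv ℝ F ((u : ℂ) + (v : ℂ) * Complex.I) Complex.I) v := fun u v hv =>
    (hD _ (by rwa [him])).comp_hasDerivAt v (hlv u v)
  have hduu : HasDerivAt (fun u : ℝ => fderiv ℝ F ((u : ℂ) + (τ.im : ℂ) * Complex.I) 1)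
      (fderiv ℝ (fderiv ℝ F) τ 1 1) τ.re := by
    have h1 := (hD2 _ (by rwa [him])).comp_hasDerivAt τ.re (hlu τ.re τ.im)
    rw [hcoe] at h1
    simpa using h1.clm_apply (hasDerivAt_const τ.re (1 : ℂ))
  have hdvv : HasDerivAt (fun v : ℝ => fderiv ℝ F ((τ.re : ℂ) + (v : ℂ) * Complex.I) Complex.I)
      (fderiv ℝ (fderiv ℝ F) τ Complex.I Complex.I) τ.im := by
    have h1 := (hD2 _ (by rwa [him])).comp_hasDerivAt τ.im (hlv τ.re τ.im)
    rw [hcoe] at h1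
    simpa using h1.clm_apply (hasDerivAt_const τ.im (Complex.I : ℂ))
  have hsym := (hat τ hτ).isSymmSndFDerivAt (by simp) Complex.I 1
  obtain ⟨β₂, hW⟩ := hβ' τ hτ
  have hβD : fderiv ℝ (fun z => fderiv ℝ F z 1 + Complex.I * fderiv ℝ F z Complex.I) τ =
      fderiv ℝ (fun z => 2 * β z) τ :=
    Filter.EventuallyEq.fderiv_eq (Filter.eventuallyEq_of_mem (hopen.mem_nhds hτ) hβ)
  have hap : ∀ w : ℂ, HasFDerivAt (fun z => fderiv ℝ F z w)
      ((fderiv ℝ (fderiv ℝ F) τ).flip w) (τ : ℂ) := fun w => by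
    have := (hD2 τ hτ).clm_apply (hasFDerivAt_const w (τ : ℂ))
    simpa using this
  have h3 := ((hap 1).add ((hap Complex.I).const_mul Complex.I)).fderiv
  have h4 := fun w => (hW.const_mul 2).fderiv_apply w
  have h5 : ∀ w : ℂ, fderiv ℝ (fderiv ℝ F) τ w 1 +
      Complex.I * fderiv ℝ (fderiv ℝ F) τ w Complex.I =
      2 * (Complex.I * k / (2 * τ.im) * β τ) * w + 2 * β₂ * (starRingEnd ℂ) w := fun w => by
    rw [← UpperHalfPlane.coe_im, ← h4 w, ← hβD]
    have : fderiv ℝ (fun z => fderiv ℝ F z 1 + Complex.I * fderiv ℝ F z Complex.I) (τ : ℂ) = _ := h3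
    rw [this]
    simp
  have h6 := h5 1
  have h7 := h5 Complex.I
  have h8 := hβ τ hτ
  simp only [map_one, Complex.conj_I, mul_one] at h6 h7
  have hfu1 : deriv (fun u => inCoords (fun τ : ℍ => F τ) u τ.im) τ.re = fderiv ℝ F τ 1 := by
    rw [hfu, (hdu _ _ hτ).deriv, hcoe]
  have hfv1 : deriv (fun v => inCoords (fun τ : ℍ => F τ) τ.re v) τ.im =
      fderiv ℝ F τ Complex.I := by
    rw [hfv.deriv_eq, (hdv _ _ hτ).deriv, hcoe]
  have hfu2 : iteratedDeriv 2 (fun u => inCoords (fun τ : ℍ => F τ) u τ.im) τ.re =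
      fderiv ℝ (fderiv ℝ F) τ 1 1 := by
    rw [iteratedDeriv_succ, iteratedDeriv_one, hfu]
    have : deriv (fun u : ℝ => F ((u : ℂ) + (τ.im : ℂ) * Complex.I)) =
        fun u : ℝ => fderiv ℝ F ((u : ℂ) + (τ.im : ℂ) * Complex.I) 1 :=
      funext fun u => (hdu u _ hτ).deriv
    rw [this, hduu.deriv]
  have hfv2 : iteratedDeriv 2 (fun v => inCoords (fun τ : ℍ => F τ) τ.re v) τ.im =
      fderiv ℝ (fderiv ℝ F) τ Complex.I Complex.I := by
    rw [iteratedDeriv_succ, iteratedDeriv_one]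
    have : deriv (fun v => inCoords (fun τ : ℍ => F τ) τ.re v) =ᶠ[nhds τ.im]
        fun v : ℝ => fderiv ℝ F ((τ.re : ℂ) + (v : ℂ) * Complex.I) Complex.I := by
      filter_upwards [hfv.eventuallyEq_nhds, Ioi_mem_nhds hτ] with v h1 h2
      rw [h1.deriv_eq, (hdv _ _ h2).deriv]
    rw [this.deriv_eq, hdvv.deriv]
  have hne : (τ.im : ℂ) ≠ 0 := by exact_mod_cast hτ.ne'
  rw [laplacian, hfu1, hfv1, hfu2, hfv2, h8]
  -- Applying ∂_u - i∂_v to (∂_u + i∂_v)F = 2β gives the Euclidean Laplacian: the mixed derivatives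
  -- cancel by symmetry and β₂ drops out.
  have h9 : fderiv ℝ (fderiv ℝ F) τ 1 1 + fderiv ℝ (fderiv ℝ F) τ Complex.I Complex.I =
      4 * (Complex.I * k / (2 * τ.im) * β τ) := by
    linear_combination h6 - Complex.I * h7 + Complex.I * hsym +
      (fderiv ℝ (fderiv ℝ F) τ Complex.I Complex.I + 2 * β₂ -
        2 * (Complex.I * k / (2 * τ.im) * β τ)) * Complex.I_sq
  rw [h9]
  field_simp
  ring

/-! ### Growth of the error-function series -/

variable {n : ℕ}

lemma exp_gauss_le {A v : ℝ} (hA : 0 ≤ A) (hv : 1 ≤ v) (x : ℝ) :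
    Real.exp (-(A * v) * x ^ 2) ≤ Real.exp (-A * x ^ 2) := by
  rw [Real.exp_le_exp]
  nlinarith [mul_nonneg hA (sq_nonneg x)]

lemma expGrowth_Wf (hn : 0 < n) (ρ : ℝ) (j : ℕ) (b : ℝ) :
    ExpGrowth fun τ => Wf n ρ j (b, τ) := by
  have hn' : (0 : ℝ) < n := by exact_mod_cast hn
  have hA : 0 < Real.pi * n := by positivity
  have hs := summable_gauss ρ hA 0 j
  simp only [zero_mul, add_zero] at hs
  refine ⟨2 * ∑' m : ℤ, |(m : ℝ) + ρ| ^ j * Real.exp (-(Real.pi * n) * (m + ρ) ^ 2),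
    2 * Real.pi * n * (2 * |ρ - 1 / 2|) ^ 2, by positivity, fun τ hτ => ?_⟩
  have hτ0 : 0 < τ.im := by linarith
  refine (tsum_of_norm_bounded (hs.hasSum.mul_left
    (2 * Real.exp (2 * Real.pi * n * (2 * |ρ - 1 / 2|) ^ 2 * τ.im))) fun m => ?_).trans
    (le_of_eq (by ring))
  refine (norm_wT_le (n := n) (ρ := ρ) j m (p := ((b : ℂ), τ)) hτ0 (A := 2 * |ρ - 1 / 2|)
    (by simp)).trans ?_
  simp only [Complex.ofReal_im, abs_zero, mul_zero, add_zero, sub_zero]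
  have hexp := exp_gauss_le hA.le hτ (m + ρ)
  gcongr ?_ * (?_ * ?_)
  exact (le_of_eq (by ring_nf)).trans hexp

lemma expGrowth_Bf (hn : 0 < n) (ρ : ℝ) (j : ℕ) (b : ℝ) :
    ExpGrowth fun τ => Bf n ρ j (b, τ) := by
  have hn' : (0 : ℝ) < n := by exact_mod_cast hn
  have hA : 0 < Real.pi * n := by positivity
  have hs := summable_gauss ρ hA 0 j
  simp only [zero_mul, add_zero] at hs
  refine ⟨∑' m : ℤ, |(m : ℝ) + ρ| ^ j * Real.exp (-(Real.pi * n) * (m + ρ) ^ 2),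
    0, by positivity, fun τ hτ => ?_⟩
  have hτ0 : 0 < τ.im := by linarith
  rw [zero_mul, Real.exp_zero, mul_one]
  refine tsum_of_norm_bounded hs.hasSum fun m => ?_
  rw [norm_bT]
  simp only [Complex.ofReal_im, mul_zero, sub_zero]
  have hexp := exp_gauss_le hA.le hτ (m + ρ)
  gcongr ?_ * ?_
  exact (le_of_eq (by ring_nf)).trans hexp

lemma gaussFactor_ofReal (n : ℕ) (b : ℝ) (τ : ℂ) :
    gaussFactor n (b, τ) = 2 * (Real.sqrt (2 * n * τ.im) / τ.im) := by
  simp [gaussFactor]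

lemma expGrowth_gaussFactor (hn : 0 < n) (b : ℝ) :
    ExpGrowth fun τ => (gaussFactor n (b, τ) : ℂ) := by
  have hn' : (1 : ℝ) ≤ n := by exact_mod_cast hn
  refine ⟨4 * n, 0, by positivity, fun τ hτ => ?_⟩
  have hτ0 : 0 < τ.im := by linarith
  simp only [gaussFactor_ofReal]
  rw [Complex.norm_real, Real.norm_of_nonneg (by positivity), zero_mul,
    Real.exp_zero, mul_one]
  have h1 : Real.sqrt (2 * n * τ.im) ≤ 2 * n * τ.im := by
    rw [Real.sqrt_le_left (by positivity)]
    have : 1 ≤ 2 * n * τ.im := by nlinarith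
    nlinarith
  rw [← le_div_iff₀' (by norm_num), div_le_iff₀ hτ0]
  linarith

lemma ExpGrowth.conj {f : ℂ → ℂ} (hf : ExpGrowth f) : ExpGrowth fun τ => (starRingEnd ℂ) (f τ) :=
  hf.of_le fun τ _ => by rw [RCLike.norm_conj]

/-! ### The antiholomorphic derivatives -/

lemma hasDerivAt_gauss (n : ℕ) (hn : 0 < n) {v : ℝ} (hv : 0 < v) :
    HasDerivAt (fun v => 2 * (Real.sqrt (2 * n * v) / v))
      (-(2 * (Real.sqrt (2 * n * v) / v)) / (2 * v)) v := by
  have hn' : (0 : ℝ) < n := by exact_mod_cast hn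
  have h1 : HasDerivAt (fun v : ℝ => 2 * n * v) (2 * n) v := by
    simpa using (hasDerivAt_id v).const_mul (2 * (n : ℝ))
  have h2 := ((h1.sqrt (by positivity)).div (hasDerivAt_id v) hv.ne').const_mul 2
  refine h2.congr_deriv ?_
  have hs : 0 < Real.sqrt (2 * n * v) := by positivity
  have hsq : Real.sqrt (2 * n * v) ^ 2 = 2 * n * v := Real.sq_sqrt (by positivity)
  simp only [id]
  field_simp
  rw [hsq]
  ring

lemma hasWirtinger_gaussFactor (hn : 0 < n) (b : ℝ) {τ : ℂ} (hτ : 0 < τ.im) :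
    HasWirtinger (fun τ => (gaussFactor n (b, τ) : ℂ))
      (Complex.I / (4 * τ.im) * gaussFactor n (b, τ))
      (-(Complex.I / (4 * τ.im) * gaussFactor n (b, τ))) τ := by
  have hne : (τ.im : ℂ) ≠ 0 := by exact_mod_cast hτ.ne'
  have h := hasWirtinger_im (hasDerivAt_gauss n hn hτ)
  simp only [gaussFactor_ofReal]
  convert! h using 1
  · push_cast
    field_simp
    ring
  · push_cast
    field_simp
    ring

lemma hasWirtinger_conj_Bf (hn : 0 < n) (ρ : ℝ) (j : ℕ) (b : ℝ) {τ : ℂ} (hτ : 0 < τ.im) :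
    HasWirtinger (fun τ => (starRingEnd ℂ) (Bf n ρ j (b, τ))) 0
      (-(Real.pi * Complex.I * n) * (starRingEnd ℂ) (Bf n ρ (j + 2) (b, τ))) τ := by
  have h := HasWirtinger.conj (hasDerivAt_Bf_snd hn ρ j b hτ)
  convert h using 1
  simp

/-- The `τ̄`-derivative of the value at `ε = 0`. -/
def betaVal (n : ℕ) (ρ b : ℝ) (τ : ℂ) : ℂ :=
  -(Complex.I / 4 * gaussFactor n (b, τ) * (starRingEnd ℂ) (Bf n ρ 1 (b, τ)))

/-- For real b the Gaussian prefactor is a constant times v^{-1/2}, so `betaVal` is v^{-1/2} times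
an antiholomorphic function, as weight 1/2 requires. -/
lemma hasWirtinger_betaVal (hn : 0 < n) (ρ b : ℝ) {τ : ℂ} (hτ : 0 < τ.im) :
    ∃ β₂, HasWirtinger (betaVal n ρ b)
      (Complex.I * ((1 / 2 : ℝ) : ℂ) / (2 * τ.im) * betaVal n ρ b τ) β₂ τ := by
  have hne : (τ.im : ℂ) ≠ 0 := by exact_mod_cast hτ.ne'
  have h := ((hasWirtinger_gaussFactor hn b hτ).mul (hasWirtinger_conj_Bf hn ρ 1 b hτ)).const_mul
    (-(Complex.I / 4))
  refine ⟨_, h.of_eq ?_ ?_ rfl⟩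
  · funext τ; rw [betaVal]; ring
  · rw [betaVal]; push_cast; field_simp; ring

/-- The derivative of `Wf` in `ε`. -/
def dWf (n : ℕ) (ρ b : ℝ) (τ : ℂ) : ℂ :=
  -(2 * Real.pi * Complex.I * n) * Wf n ρ 1 (b, τ) +
    Complex.I / 2 * gaussFactor n (b, τ) * (starRingEnd ℂ) (Bf n ρ 0 (b, τ))

/-- The `τ̄`-derivative of `dWf`. -/
def betaDer (n : ℕ) (ρ b : ℝ) (τ : ℂ) : ℂ :=
  1 / (8 * τ.im) * gaussFactor n (b, τ) * (starRingEnd ℂ) (Bf n ρ 0 (b, τ))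

/-- The conjugated series with index 2 coming from the two summands of `dWf` cancel. Only the
derivative of v^{-1/2} survives, and it supplies the v^{-3/2} of weight 3/2. -/
lemma hasWirtinger_dWf (hn : 0 < n) (ρ b : ℝ) {τ : ℂ} (hτ : 0 < τ.im) :
    ∃ α, HasWirtinger (dWf n ρ b) α (betaDer n ρ b τ) τ := by
  have hne : (τ.im : ℂ) ≠ 0 := by exact_mod_cast hτ.ne'
  have h1 := (hasWirtinger_Wf_snd hn ρ 1 b hτ).const_mul (-(2 * Real.pi * Complex.I * n))
  have h2 := ((hasWirtinger_gaussFactor hn b hτ).mul (hasWirtinger_conj_Bf hn ρ 0 b hτ)).const_mul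
    (Complex.I / 2)
  refine ⟨_, (h1.add h2).of_eq ?_ rfl ?_⟩
  · funext τ; rw [dWf]; ring
  · rw [betaDer]
    field_simp
    ring_nf
    simp only [Complex.I_sq]
    ring

lemma hasWirtinger_betaDer (hn : 0 < n) (ρ b : ℝ) {τ : ℂ} (hτ : 0 < τ.im) :
    ∃ β₂, HasWirtinger (betaDer n ρ b)
      (Complex.I * ((3 / 2 : ℝ) : ℂ) / (2 * τ.im) * betaDer n ρ b τ) β₂ τ := by
  have hne : (τ.im : ℂ) ≠ 0 := by exact_mod_cast hτ.ne'
  have h0 := hasWirtinger_im (hasDerivAt_inv hτ.ne')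
  have h := ((h0.mul (hasWirtinger_gaussFactor hn b hτ)).mul
    (hasWirtinger_conj_Bf hn ρ 0 b hτ)).const_mul (1 / 8)
  refine ⟨_, h.of_eq ?_ ?_ rfl⟩
  · funext τ
    rw [betaDer]
    push_cast
    rw [one_div, mul_inv]
    ring
  · rw [betaDer]
    push_cast
    field_simp
    ring

end

section

/-! ### Smoothness of the error-function series -/

lemma isOpen_im_pos : IsOpen {z : ℂ | 0 < z.im} := isOpen_lt continuous_const Complex.continuous_im

lemma contDiffOn_infty_of_nat {f : ℂ × ℂ → ℂ}
    (h : ∀ k : ℕ, ContDiffOn ℝ k f {p : ℂ × ℂ | 0 < p.2.im}) (b : ℝ) :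
    ContDiffOn ℝ ∞ (fun τ : ℂ => f (b, τ)) {z : ℂ | 0 < z.im} := by
  refine contDiffOn_infty.mpr fun k => (h k).comp (g := f) ?_ fun z hz => hz
  fun_prop

lemma contDiffOn_Wf_snd {n : ℕ} (hn : 0 < n) (ρ : ℝ) (j : ℕ) (b : ℝ) :
    ContDiffOn ℝ ∞ (fun τ : ℂ => Wf n ρ j (b, τ)) {z : ℂ | 0 < z.im} :=
  contDiffOn_infty_of_nat (fun k => contDiffOn_Wf hn ρ k j) b

lemma contDiffOn_dWf {n : ℕ} (hn : 0 < n) (ρ b : ℝ) :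
    ContDiffOn ℝ ∞ (dWf n ρ b) {z : ℂ | 0 < z.im} := by
  have h1 : ContDiffOn ℝ ∞ (fun τ : ℂ => (gaussFactor n (b, τ) : ℂ)) {z : ℂ | 0 < z.im} :=
    contDiffOn_infty_of_nat (f := fun p => (gaussFactor n p : ℂ)) (fun k p hp =>
      (Complex.ofRealCLM.contDiff.contDiffAt.comp p
        (contDiffAt_gaussFactor hn hp)).contDiffWithinAt) b
  have h2 : ContDiffOn ℝ ∞ (fun τ : ℂ => (starRingEnd ℂ) (Bf n ρ 0 (b, τ))) {z : ℂ | 0 < z.im} :=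
    Complex.conjCLE.contDiff.comp_contDiffOn
      (contDiffOn_infty_of_nat (fun k => contDiffOn_Bf hn ρ k 0) b)
  exact (contDiffOn_const.mul (contDiffOn_Wf_snd hn ρ 1 b)).add ((contDiffOn_const.mul h1).mul h2)

lemma contDiffOn_of_differentiableAt {H : ℂ → ℂ}
    (hH : ∀ z : ℂ, 0 < z.im → DifferentiableAt ℂ H z) :
    ContDiffOn ℝ ∞ H {z : ℂ | 0 < z.im} := by
  have h : DifferentiableOn ℂ H {z : ℂ | 0 < z.im} := fun z hz => (hH z hz).differentiableWithinAt
  exact (h.contDiffOn isOpen_im_pos).restrict_scalars ℝ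

lemma laplacian_holomorphic_add {H W β : ℂ → ℂ} {k : ℝ} (c : ℂ)
    (hH : ∀ z : ℂ, 0 < z.im → DifferentiableAt ℂ H z)
    (hWs : ContDiffOn ℝ ∞ W {z : ℂ | 0 < z.im})
    (hW : ∀ z : ℂ, 0 < z.im → ∃ α, HasWirtinger W α (β z) z)
    (hβ : ∀ z : ℂ, 0 < z.im → ∃ β₂, HasWirtinger β (Complex.I * k / (2 * z.im) * β z) β₂ z)
    (τ : ℍ) : laplacian k (fun τ : ℍ => H τ + c * W τ) τ = 0 := by
  refine laplacian_eq_zero (F := fun z => H z + c * W z) (β := fun z => c * β z)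
    (contDiffOn_infty.mp ((contDiffOn_of_differentiableAt hH).add (contDiffOn_const.mul hWs)) 2)
    (fun z hz => ?_) (fun z hz => ?_) τ
  · obtain ⟨α, hα⟩ := hW z hz
    have h := (HasWirtinger.of_hasDerivAt (hH z hz).hasDerivAt).add (hα.const_mul c)
    rw [h.fderiv_apply, h.fderiv_apply]
    simp only [map_one, Complex.conj_I]
    linear_combination (deriv H z + c * α - c * β z) * Complex.I_sq
  · obtain ⟨β₂, h⟩ := hβ z hz
    exact ⟨c * β₂, (h.const_mul c).of_eq rfl (by ring) rfl⟩

lemma expGrowth_dWf {n : ℕ} (hn : 0 < n) (ρ b : ℝ) : ExpGrowth (dWf n ρ b) :=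
  ((ExpGrowth.const _).mul (expGrowth_Wf hn ρ 1 b)).add
    (((ExpGrowth.const _).mul (expGrowth_gaussFactor hn b)).mul (expGrowth_Bf hn ρ 0 b).conj)

namespace Chr

variable {M : ℕ}

/-! ### Values and derivatives at `ε = 0` -/

/-- The elliptic shift of the error-function series. -/
def rho (χ : Chr M) (l : ℤ) : ℝ := (l : ℝ) / (2 * M : ℕ) + χ.a₀

/-- The coefficient of the error-function series. -/
def coef (χ : Chr M) (l : ℤ) : ℂ := (-1) ^ l / 2 * e (M * χ.a₀ * χ.b₀)

/-- The exponent of `q` in the holomorphic part. -/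
def expQ (χ : Chr M) (l : ℤ) : ℝ :=
  -(M * χ.a₀ ^ 2) - (l - M) ^ 2 / (4 * M) - (l - M) * χ.a₀ + χ.a / 2 + (l - M) / 2

/-- The constant exponent in the holomorphic part. -/
def expC (χ : Chr M) (l : ℤ) : ℝ := -(M * χ.a₀ * χ.b₀) - (l - M) * χ.b₀ + χ.b / 2

/-- The frequency in `ε` of the holomorphic part. -/
def expE (χ : Chr M) (l : ℤ) : ℝ := -(2 * M * χ.a₀) - (l - M) + M

/-- The `τ`-coordinate of the argument of the Appell sum. -/
def arg (χ : Chr M) (l : ℤ) : ℝ := χ.a + (l - M : ℤ)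

/-- The prefactor of the Appell sum. -/
def pre (χ : Chr M) (l : ℤ) (τ : ℂ) : ℂ :=
  (-1) ^ (l - M) * (e (χ.expQ l * τ + χ.expC l) * ∏ j, (theta (χ.va j * τ + χ.vb j) τ)⁻¹)

/-- The Appell sum at `ε = 0` with the `j`-th powers of the polar factors. -/
def appell (χ : Chr M) (j : ℕ) (l : ℤ) (τ : ℂ) : ℂ :=
  pS j (fun i => χ.va i * τ + χ.vb i) τ (χ.arg l * τ + χ.b)

/-- Moving a₀τ out of the first argument of `Wf` into the lattice shift ρ leaves the real number b₀
at ε = 0, where the τ̄-derivative is simple. The other summand is an Appell sum with a prefactor. -/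
lemma Phi_eq_add (hM : 0 < M) (χ : Chr M) (l : ℤ) (ε : ℂ) {τ : ℂ} (hτ : 0 < τ.im) :
    χ.Phi l ε τ =
      χ.pre l τ * (e (χ.expE l * ε) * pS 1 (χ.v τ) τ (2 * M * ε + (χ.arg l * τ + χ.b))) +
      χ.coef l * Wf (2 * M) (χ.rho l) 0 (ε + χ.b₀, τ) := by
  have hM' : (M : ℂ) ≠ 0 := by exact_mod_cast hM.ne'
  have hu := u_div_sub_tV hM χ ε τ
  have hu2 : χ.u ε τ - 2 * M * tV M (χ.v τ) = 2 * M * (ε + χ.a₀ * τ + χ.b₀) := by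
    rw [← hu]; push_cast; field_simp
  have hR := R_eq_Wf hM l (χ.u ε τ) (tV M (χ.v τ)) hτ
  have hW := Wf_add_mul (n := 2 * M) (by omega) ((l : ℝ) / (2 * M : ℕ)) χ.a₀ (ε + χ.b₀) hτ
  rw [hu, show ε + χ.a₀ * τ + χ.b₀ = ε + χ.b₀ + χ.a₀ * τ by ring, hW] at hR
  rw [Phi, muHatShift, muHat, mul_sub, sum_eq_tV hM, hR, mul_sub, sub_eq_add_neg, hu2]
  congr 1
  · rw [mu_eq_pS, pre, show χ.u ε τ + ((l - M : ℤ) : ℂ) * τ =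
      2 * M * ε + (χ.arg l * τ + χ.b) by rw [u, arg]; push_cast; ring]
    have he : e (-(M * χ.a₀ * (χ.a₀ * τ + χ.b₀ + 2 * ε))) *
        (e (-((l - M : ℤ) : ℂ) ^ 2 / (2 * ((2 * M : ℕ) : ℂ)) * τ) *
        (e (-((l - M : ℤ) : ℂ) / ((2 * M : ℕ) : ℂ) * (2 * M * (ε + χ.a₀ * τ + χ.b₀))) *
        e ((2 * M * ε + (χ.arg l * τ + χ.b)) / 2))) =
        e (χ.expQ l * τ + χ.expC l) * e (χ.expE l * ε) := by
      rw [← e_add, ← e_add, ← e_add, ← e_add]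
      congr 1
      rw [expQ, expC, expE, arg]
      push_cast
      field_simp
      ring
    have hv : ∏ j, (theta (χ.va j * τ + χ.vb j) τ)⁻¹ = (∏ j, theta (χ.v τ j) τ)⁻¹ := by
      rw [← Finset.prod_inv_distrib]; rfl
    rw [hv, div_eq_mul_inv (e _)]
    linear_combination ((-1) ^ (l - M) * (∏ j, theta (χ.v τ j) τ)⁻¹ *
      pS 1 (χ.v τ) τ (2 * M * ε + (χ.arg l * τ + χ.b))) * he
  · have he : e (-(M * χ.a₀ * (χ.a₀ * τ + χ.b₀ + 2 * ε))) *
        e (((2 * M : ℕ) : ℂ) / 2 * χ.a₀ ^ 2 * τ + ((2 * M : ℕ) : ℂ) * χ.a₀ * (ε + χ.b₀)) =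
        e (M * χ.a₀ * χ.b₀) := by
      rw [← e_add]
      congr 1
      push_cast
      ring
    rw [coef, rho]
    linear_combination ((-1) ^ l * (1 / 2 *
      Wf (2 * M) ((l : ℝ) / (2 * M : ℕ) + χ.a₀) 0 (ε + χ.b₀, τ))) * he

lemma Phi_zero (hM : 0 < M) (χ : Chr M) (l : ℤ) {τ : ℂ} (hτ : 0 < τ.im) :
    χ.Phi l 0 τ = χ.pre l τ * χ.appell 1 l τ +
      χ.coef l * Wf (2 * M) (χ.rho l) 0 (χ.b₀, τ) := by
  rw [Phi_eq_add hM χ l 0 hτ, mul_zero, e_zero, one_mul, mul_zero, zero_add, zero_add]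
  rfl

lemma Good.arg_not_int {χ : Chr M} (hχ : χ.Good) (l : ℤ) (m k : ℤ) :
    ¬ (χ.arg l = m ∧ χ.b = k) := fun ⟨h1, h2⟩ => by
  refine hχ.not_int (m - (l - M : ℤ)) k ⟨?_, h2⟩
  rw [arg] at h1
  push_cast at h1 ⊢
  linear_combination h1

lemma Good.latticeFree_arg {χ : Chr M} (hχ : χ.Good) (l : ℤ) {τ : ℂ} (hτ : 0 < τ.im) :
    LatticeFree τ (χ.arg l * τ + χ.b) := by
  have h := (hχ.latticeFree ⟨τ, hτ⟩).add_int_mul_add_int (l - M) 0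
  have h2 : χ.u 0 τ + ((l - M : ℤ) : ℂ) * τ + ((0 : ℤ) : ℂ) = χ.arg l * τ + χ.b := by
    rw [u, arg]; push_cast; ring
  rw [← h2]
  exact h

/-- The holomorphic part of the derivative at `ε = 0`. -/
def derHol (χ : Chr M) (l : ℤ) (τ : ℂ) : ℂ :=
  χ.pre l τ * (2 * Real.pi * Complex.I * χ.expE l * χ.appell 1 l τ +
    2 * Real.pi * Complex.I * (2 * M) * (χ.appell 2 l τ - χ.appell 1 l τ))

lemma Good.hasWirtinger_Phi (hM : 0 < M) {χ : Chr M} (hχ : χ.Good) (l : ℤ) {τ : ℂ}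
    (hτ : 0 < τ.im) : ∃ β, HasWirtinger (fun ε => χ.Phi l ε τ)
      (χ.derHol l τ + χ.coef l * dWf (2 * M) (χ.rho l) χ.b₀ τ) β 0 := by
  have h1 : HasDerivAt (fun ε : ℂ => e (χ.expE l * ε))
      (2 * Real.pi * Complex.I * χ.expE l) 0 := by
    have := (hasDerivAt_e ((χ.expE l : ℂ) * 0)).comp (0 : ℂ)
      ((hasDerivAt_id (0 : ℂ)).const_mul (χ.expE l : ℂ))
    refine this.congr_deriv ?_
    rw [mul_zero, e_zero]
    ring
  have h2 : HasDerivAt (fun ε : ℂ => pS 1 (χ.v τ) τ (2 * M * ε + (χ.arg l * τ + χ.b)))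
      (2 * Real.pi * Complex.I * (2 * M) * (χ.appell 2 l τ - χ.appell 1 l τ)) 0 := by
    have hlin : HasDerivAt (fun ε : ℂ => 2 * M * ε + (χ.arg l * τ + χ.b)) (2 * M) 0 := by
      simpa using ((hasDerivAt_id (0 : ℂ)).const_mul (2 * M : ℂ)).add_const (χ.arg l * τ + χ.b : ℂ)
    have h0 : (2 * M * 0 + (χ.arg l * τ + χ.b) : ℂ) = χ.arg l * τ + χ.b := by ring
    have h3 := hasDerivAt_pS (χ.v τ) hτ (hχ.latticeFree_arg l hτ)
    rw [← h0] at h3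
    refine (h3.comp (0 : ℂ) hlin).congr_deriv ?_
    rw [h0]
    change _ = _ * (pS 2 (χ.v τ) τ _ - pS 1 (χ.v τ) τ _)
    ring
  have h3 := (HasWirtinger.comp_add_const (x := 0) (χ.b₀ : ℂ) (by
    rw [zero_add]
    exact hasWirtinger_Wf_fst (n := 2 * M) (by omega) (χ.rho l) 0 (y := χ.b₀) hτ)).const_mul
      (χ.coef l)
  have h4 := (HasWirtinger.of_hasDerivAt ((h1.mul h2).const_mul (χ.pre l τ))).add h3
  refine ⟨_, h4.of_eq (funext fun ε => Phi_eq_add hM χ l ε hτ) ?_ rfl⟩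
  rw [derHol, mul_zero, mul_zero, zero_add, e_zero, one_mul]
  rfl

lemma Good.differentiableAt_pre {χ : Chr M} (hχ : χ.Good) (l : ℤ) {τ : ℂ} (hτ : 0 < τ.im) :
    DifferentiableAt ℂ (χ.pre l) τ := by
  have hne := fun j => Finset.prod_ne_zero_iff.mp (hχ.theta_ne_zero ⟨τ, hτ⟩) j (Finset.mem_univ j)
  have h1 : DifferentiableAt ℂ
      (fun τ => ∏ j, (theta (χ.va j * τ + χ.vb j) τ)⁻¹) τ :=
    DifferentiableAt.fun_finsetProd fun j _ => (differentiableAt_theta _ _ hτ).fun_inv (hne j)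
  have h2 : DifferentiableAt ℂ (fun τ : ℂ => e (χ.expQ l * τ + χ.expC l)) τ := by fun_prop
  exact (h2.mul h1).const_mul _

lemma Good.differentiableAt_appell {χ : Chr M} (hχ : χ.Good) (j : ℕ) (l : ℤ) {τ : ℂ}
    (hτ : 0 < τ.im) : DifferentiableAt ℂ (χ.appell j l) τ :=
  differentiableAt_pS j χ.va χ.vb _ _ hτ (hχ.latticeFree_arg l hτ)

lemma Good.differentiableAt_derHol {χ : Chr M} (hχ : χ.Good) (l : ℤ) {τ : ℂ}
    (hτ : 0 < τ.im) : DifferentiableAt ℂ (χ.derHol l) τ :=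
  (hχ.differentiableAt_pre l hτ).mul (((hχ.differentiableAt_appell 1 l hτ).const_mul _).add
    (((hχ.differentiableAt_appell 2 l hτ).sub (hχ.differentiableAt_appell 1 l hτ)).const_mul _))

lemma Good.expGrowth_pre {χ : Chr M} (hχ : χ.Good) (l : ℤ) : ExpGrowth (χ.pre l) :=
  (ExpGrowth.const _).mul ((ExpGrowth.e_char _ _).mul
    (ExpGrowth.prod fun j _ => expGrowth_inv_theta (hχ.half j)))

lemma Good.expGrowth_appell {χ : Chr M} (hχ : χ.Good) (j : ℕ) (l : ℤ) :
    ExpGrowth (χ.appell j l) := expGrowth_pS j _ _ (hχ.arg_not_int l)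

lemma Good.expGrowth_derHol {χ : Chr M} (hχ : χ.Good) (l : ℤ) : ExpGrowth (χ.derHol l) :=
  (hχ.expGrowth_pre l).mul (((ExpGrowth.const _).mul (hχ.expGrowth_appell 1 l)).add
    ((ExpGrowth.const _).mul ((hχ.expGrowth_appell 2 l).sub (hχ.expGrowth_appell 1 l))))

/-- The function of weight `1/2`. -/
def val (χ : Chr M) (l : ℤ) (τ : ℂ) : ℂ :=
  χ.pre l τ * χ.appell 1 l τ + χ.coef l * Wf (2 * M) (χ.rho l) 0 (χ.b₀, τ)

/-- The function of weight `3/2`. -/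
def der (χ : Chr M) (l : ℤ) (τ : ℂ) : ℂ :=
  χ.derHol l τ + χ.coef l * dWf (2 * M) (χ.rho l) χ.b₀ τ

lemma Good.contDiffOn_val (hM : 0 < M) {χ : Chr M} (hχ : χ.Good) (l : ℤ) :
    ContDiffOn ℝ ∞ (χ.val l) {z : ℂ | 0 < z.im} :=
  (contDiffOn_of_differentiableAt fun _ hz =>
    (hχ.differentiableAt_pre l hz).mul (hχ.differentiableAt_appell 1 l hz)).add
    (contDiffOn_const.mul (contDiffOn_Wf_snd (by omega) _ 0 _))

lemma Good.contDiffOn_der (hM : 0 < M) {χ : Chr M} (hχ : χ.Good) (l : ℤ) :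
    ContDiffOn ℝ ∞ (χ.der l) {z : ℂ | 0 < z.im} :=
  (contDiffOn_of_differentiableAt fun _ hz => hχ.differentiableAt_derHol l hz).add
    (contDiffOn_const.mul (contDiffOn_dWf (by omega) _ _))

lemma Good.expGrowth_val (hM : 0 < M) {χ : Chr M} (hχ : χ.Good) (l : ℤ) : ExpGrowth (χ.val l) :=
  ((hχ.expGrowth_pre l).mul (hχ.expGrowth_appell 1 l)).add
    ((ExpGrowth.const _).mul (expGrowth_Wf (by omega) _ 0 _))

lemma Good.expGrowth_der (hM : 0 < M) {χ : Chr M} (hχ : χ.Good) (l : ℤ) : ExpGrowth (χ.der l) :=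
  (hχ.expGrowth_derHol l).add ((ExpGrowth.const _).mul (expGrowth_dWf (by omega) _ _))

lemma Good.laplacian_val (hM : 0 < M) {χ : Chr M} (hχ : χ.Good) (l : ℤ) (τ : ℍ) :
    laplacian (1 / 2) (fun τ : ℍ => χ.val l τ) τ = 0 :=
  laplacian_holomorphic_add (χ.coef l)
    (fun _ hz => (hχ.differentiableAt_pre l hz).mul (hχ.differentiableAt_appell 1 l hz))
    (contDiffOn_Wf_snd (by omega) _ 0 _)
    (fun _ hz => ⟨_, hasWirtinger_Wf_snd (by omega) (χ.rho l) 0 χ.b₀ hz⟩)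
    (fun _ hz => hasWirtinger_betaVal (by omega) _ _ hz) τ

lemma Good.laplacian_der (hM : 0 < M) {χ : Chr M} (hχ : χ.Good) (l : ℤ) (τ : ℍ) :
    laplacian (3 / 2) (fun τ : ℍ => χ.der l τ) τ = 0 :=
  laplacian_holomorphic_add (χ.coef l) (fun _ hz => hχ.differentiableAt_derHol l hz)
    (contDiffOn_dWf (by omega) _ _)
    (fun _ hz => hasWirtinger_dWf (by omega) (χ.rho l) χ.b₀ hz)
    (fun _ hz => hasWirtinger_betaDer (by omega) _ _ hz) τ

end Chr

end

section

/-! ### The principal branch of the automorphy factor -/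

/-- If c ≠ 0 then cτ + d is never real; if c = 0 it is constant, possibly negative on the branch
cut, so that case is separate. -/
lemma continuous_autFactor_cpow (γ : SL(2, ℤ)) (k : ℂ) : Continuous fun τ => autFactor γ τ ^ k := by
  by_cases hc : γ 1 0 = 0
  · have h : (fun τ => autFactor γ τ ^ k) = fun _ => ((γ 1 1 : ℤ) : ℂ) ^ k := by
      funext τ
      simp [autFactor, hc]
    rw [h]
    exact continuous_const
  · refine (Chr.continuous_autFactor γ).cpow continuous_const fun τ => Or.inr ?_
    have h : (autFactor γ τ).im = (γ 1 0 : ℤ) * τ.im := by simp [autFactor]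
    rw [h]
    exact mul_ne_zero (by exact_mod_cast hc) τ.im_pos.ne'

/-- Two continuous square roots of a nowhere vanishing function on the connected space ℍ differ by a
global sign. -/
lemma exists_eq_mul_cpow_half {γ : SL(2, ℤ)} {μ : ℍ → ℂ} (hμ : Continuous μ)
    (hμ2 : ∀ τ, μ τ ^ 2 = autFactor γ τ) :
    ∃ c : ℂ, ∀ τ, μ τ = c * autFactor γ τ ^ (((1 / 2 : ℝ) : ℝ) : ℂ) := by
  have hsq : ∀ τ, (autFactor γ τ ^ (((1 / 2 : ℝ) : ℝ) : ℂ)) ^ 2 = autFactor γ τ := fun τ => by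
    have := Complex.cpow_nat_inv_pow (autFactor γ τ) two_ne_zero
    convert this using 3
    push_cast
    norm_num
  have h := (isPreconnected_univ (α := ℍ)).eq_or_eq_neg_of_sq_eq
    (f := μ) (g := fun τ => autFactor γ τ ^ (((1 / 2 : ℝ) : ℝ) : ℂ)) hμ.continuousOn
    (continuous_autFactor_cpow γ _).continuousOn (fun τ _ => by
      rw [Pi.pow_apply, Pi.pow_apply, hμ2, hsq]) (fun {τ} _ h0 => by
      have h1 := hsq τ
      have h2 : autFactor γ τ ^ (((1 / 2 : ℝ) : ℝ) : ℂ) = 0 := h0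
      rw [h2, zero_pow two_ne_zero] at h1
      exact autFactor_ne_zero γ τ h1.symm)
  rcases h with h | h
  · exact ⟨1, fun τ => by rw [one_mul]; exact h (Set.mem_univ τ)⟩
  · exact ⟨-1, fun τ => by rw [neg_one_mul]; exact h (Set.mem_univ τ)⟩

lemma cpow_three_halves {x : ℂ} (hx : x ≠ 0) :
    x ^ ((3 / 2 : ℝ) : ℂ) = x ^ ((1 / 2 : ℝ) : ℂ) * x := by
  rw [show ((3 / 2 : ℝ) : ℂ) = ((1 / 2 : ℝ) : ℂ) + 1 by push_cast; norm_num, Complex.cpow_add _ _ hx,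
    Complex.cpow_one]

lemma ExpGrowth.isBigO {f : ℂ → ℂ} (hf : ExpGrowth f) :
    ∃ C : ℝ, (fun τ : ℍ => f τ) =O[UpperHalfPlane.atImInfty]
      fun τ : ℍ => Real.exp (C * τ.im) := by
  obtain ⟨K, C, -, h⟩ := hf
  refine ⟨C, Asymptotics.IsBigO.of_bound K ?_⟩
  refine (UpperHalfPlane.atImInfty_mem _).mpr ⟨1, fun τ hτ => ?_⟩
  have := h τ hτ
  rwa [Set.mem_ofPred_eq, Real.norm_of_nonneg (Real.exp_pos _).le]

/-! ### Laws for the value and the derivative at ε = 0, and the resulting Maass forms. -/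

namespace Chr

variable {M : ℕ}

lemma Good.eventually_latticeFree {χ : Chr M} (hχ : χ.Good) (τ : ℍ) :
    ∀ᶠ ε in nhds (0 : ℂ), LatticeFree τ (χ.u ε τ) := by
  have hc : ContinuousAt (fun ε : ℂ => χ.u ε τ) 0 := by unfold u; fun_prop
  exact hc.eventually (MaassRho.eventually_latticeFree τ.im_pos (hχ.latticeFree τ))

lemma Good.complexPartial_Phi (hM : 0 < M) {χ : Chr M} (hχ : χ.Good) (l : ℤ) (τ : ℍ) :
    complexPartial (fun ε => χ.Phi l ε τ) 0 = χ.der l τ := by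
  obtain ⟨β, h⟩ := hχ.hasWirtinger_Phi hM l τ.im_pos
  exact h.complexPartial_eq

lemma Good.val_add (hM : 0 < M) {χ : Chr M} (hχ : χ.Good) (l : ℤ) (τ : ℍ) :
    χ.val (l + (2 * M : ℕ)) τ = χ.val l τ := by
  have h := hχ.Phi_add hM l (hχ.latticeFree τ)
  rwa [Phi_zero hM _ _ τ.im_pos, Phi_zero hM _ _ τ.im_pos] at h

lemma Good.der_add (hM : 0 < M) {χ : Chr M} (hχ : χ.Good) (l : ℤ) (τ : ℍ) :
    χ.der (l + (2 * M : ℕ)) τ = χ.der l τ := by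
  obtain ⟨β, h⟩ := hχ.hasWirtinger_Phi hM l τ.im_pos
  rw [← hχ.complexPartial_Phi hM]
  refine (h.congr ?_).complexPartial_eq
  filter_upwards [hχ.eventually_latticeFree τ] with ε hε using hχ.Phi_add hM l hε

/-- A transformation law in `ε` gives transformation laws at `ε = 0`. -/
lemma Good.val_der_smul (hM : 0 < M) {χ χ' : Chr M} (hχ : χ.Good) (hχ' : χ'.Good) {γ : SL(2, ℤ)}
    {μ : ℍ → ℂ} {U : ℕ → ℕ → ℂ} (h : ∀ l < 2 * M, ∀ (τ : ℍ) (ε : ℂ), LatticeFree τ (χ'.u ε τ) →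
      χ.Phi l (ε / autFactor γ τ) (γ • τ : ℍ) =
        μ τ * e (-((γ 1 0 : ℤ) * M * ε ^ 2 / autFactor γ τ)) *
          ∑ p ∈ Finset.range (2 * M), U l p * χ'.Phi p ε τ) {l : ℕ} (hl : l < 2 * M) (τ : ℍ) :
    χ.val l (γ • τ : ℍ) = μ τ * ∑ p ∈ Finset.range (2 * M), U l p * χ'.val p τ ∧
    χ.der l (γ • τ : ℍ) =
      μ τ * autFactor γ τ * ∑ p ∈ Finset.range (2 * M), U l p * χ'.der p τ := by
  have hj := autFactor_ne_zero γ τ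
  constructor
  · have h0 := h l hl τ 0 (hχ'.latticeFree τ)
    rw [zero_div, Phi_zero hM χ l (γ • τ).im_pos, zero_pow two_ne_zero, mul_zero, zero_div, neg_zero,
      e_zero, mul_one] at h0
    refine h0.trans ?_
    congr 1
    exact Finset.sum_congr rfl fun p _ => by rw [Phi_zero hM χ' p τ.im_pos]; rfl
  · obtain ⟨β, h1⟩ := hχ.hasWirtinger_Phi hM l (γ • τ).im_pos
    have h2 : HasWirtinger (fun ε => χ.Phi l ((autFactor γ τ)⁻¹ * ε) (γ • τ : ℍ))
        (χ.der l (γ • τ : ℍ) * (autFactor γ τ)⁻¹) (β * (starRingEnd ℂ) (autFactor γ τ)⁻¹) 0 :=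
      HasWirtinger.comp_mul_left (autFactor γ τ)⁻¹ (by rw [mul_zero]; exact h1)
    choose B hB using fun p : ℕ => hχ'.hasWirtinger_Phi hM p τ.im_pos
    -- The exponent is quadratic in ε, so its derivative at 0 vanishes and no multiple of the value
    -- enters the derivative law.
    have h3 : HasDerivAt (fun ε : ℂ => e (-((γ 1 0 : ℤ) * M * ε ^ 2 / autFactor γ τ))) 0 0 := by
      have h4 : HasDerivAt (fun ε : ℂ => -((γ 1 0 : ℤ) * M * ε ^ 2 / autFactor γ τ)) 0 0 := by
        have := ((((hasDerivAt_id (0 : ℂ)).pow 2).const_mul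
          (((γ 1 0 : ℤ) : ℂ) * M)).div_const (autFactor γ τ)).neg
        refine this.congr_deriv ?_
        simp
      refine ((hasDerivAt_e _).comp (0 : ℂ) h4).congr_deriv ?_
      rw [mul_zero]
    have h5 := ((HasWirtinger.of_hasDerivAt h3).const_mul (μ τ)).mul
      (HasWirtinger.sum (s := Finset.range (2 * M)) fun p _ => (hB p).const_mul (U l p))
    have h6 := (h5.congr (f₁ := fun ε => χ.Phi l ((autFactor γ τ)⁻¹ * ε) (γ • τ : ℍ)) (by
      filter_upwards [hχ'.eventually_latticeFree τ] with ε hε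
      rw [← h l hl τ ε hε, div_eq_inv_mul])).complexPartial_eq
    rw [h2.complexPartial_eq] at h6
    rw [mul_zero, zero_mul, zero_add, zero_pow two_ne_zero, mul_zero, zero_div, neg_zero, e_zero,
      mul_one, mul_inv_eq_iff_eq_mul₀ hj] at h6
    rw [h6, mul_right_comm]
    rfl

/-- The laws under `γ` connecting the values and derivatives at `ε = 0` for `χ` and `χ'`. -/
def SmulLaw (χ χ' : Chr M) (γ : SL(2, ℤ)) : Prop :=
  ∃ U : ℕ → ℕ → ℂ, ∀ l < 2 * M, ∀ τ : ℍ,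
    χ.val l (γ • τ : ℍ) = autFactor γ τ ^ ((1 / 2 : ℝ) : ℂ) *
      ∑ p ∈ Finset.range (2 * M), U l p * χ'.val p τ ∧
    χ.der l (γ • τ : ℍ) = autFactor γ τ ^ ((3 / 2 : ℝ) : ℂ) *
      ∑ p ∈ Finset.range (2 * M), U l p * χ'.der p τ

lemma Good.smulLaw (hM : 0 < M) {χ χ' : Chr M} (hχ : χ.Good) (hχ' : χ'.Good)
    {γ : SL(2, ℤ)} (h : ∃ μ : ℍ → ℂ, Continuous μ ∧ (∀ τ, μ τ ^ 2 = autFactor γ τ) ∧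
      ∃ U : ℕ → ℕ → ℂ, ∀ l < 2 * M, ∀ (τ : ℍ) (ε : ℂ), LatticeFree τ (χ'.u ε τ) →
      χ.Phi l (ε / autFactor γ τ) (γ • τ : ℍ) =
        μ τ * e (-((γ 1 0 : ℤ) * M * ε ^ 2 / autFactor γ τ)) *
          ∑ p ∈ Finset.range (2 * M), U l p * χ'.Phi p ε τ) :
    SmulLaw χ χ' γ := by
  obtain ⟨μ, hμ, hμ2, U, hU⟩ := h
  obtain ⟨c, hc⟩ := exists_eq_mul_cpow_half hμ hμ2
  refine ⟨fun l p => c * U l p, fun l hl τ => ?_⟩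
  obtain ⟨h1, h2⟩ := hχ.val_der_smul hM hχ' hU hl τ
  rw [h1, h2, cpow_three_halves (autFactor_ne_zero γ τ), hc]
  simp only [mul_assoc c, ← Finset.mul_sum]
  constructor <;> ring

/-- The transformation behaviour preserving `χ` modulo integers. -/
def Invariant (χ : Chr M) (Γ : Subgroup SL(2, ℤ)) : Prop :=
  ∀ γ ∈ Γ, ∃ (A B : ℤ) (m k : Fin (2 * M) → ℤ), (χ.act γ).a = χ.a + A ∧ (χ.act γ).b = χ.b + B ∧
    (∀ j, (χ.act γ).va j = χ.va j + m j) ∧ ∀ j, (χ.act γ).vb j = χ.vb j + k j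

/-- Periodic families with transformation laws under all of `SL₂(ℤ)` are harmonic Maass forms. -/
lemma isVectorHarmonicMaass_of_laws (hM : 0 < M) {k : ℝ} {Γ : Subgroup SL(2, ℤ)} {f : ℤ → ℂ → ℂ}
    (hper : ∀ l (τ : ℍ), f (l + (2 * M : ℕ)) τ = f l τ)
    (hsm : ∀ l, ContDiffOn ℝ ∞ (f l) {z : ℂ | 0 < z.im})
    (hmod : ∀ γ ∈ Γ, ∃ U : ℕ → ℕ → ℂ, ∀ l : ℕ, l < 2 * M → ∀ τ : ℍ, f l (γ • τ : ℍ) =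
      autFactor γ τ ^ (k : ℂ) * ∑ p ∈ Finset.range (2 * M), U l p * f p τ)
    (hharm : ∀ l (τ : ℍ), laplacian k (fun τ : ℍ => f l τ) τ = 0)
    (hgr : ∀ σ : SL(2, ℤ), ∃ (g : ℕ → ℂ → ℂ) (U : ℕ → ℕ → ℂ), (∀ p, ExpGrowth (g p)) ∧
      ∀ l : ℕ, l < 2 * M → ∀ τ : ℍ, f l (σ • τ : ℍ) =
        autFactor σ τ ^ (k : ℂ) * ∑ p ∈ Finset.range (2 * M), U l p * g p τ) :
    IsVectorHarmonicMaass (2 * M) k Γ (fun l τ => f l τ) where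
  periodic l := funext fun τ => hper l τ
  smooth l := (hsm l).congr fun z hz => by
    rw [Function.comp_apply, UpperHalfPlane.ofComplex_apply_of_im_pos hz]
  modular γ hγ := by
    obtain ⟨U, hU⟩ := hmod γ hγ
    refine ⟨Matrix.of fun l p => U l p, fun l τ => ?_⟩
    rw [hU l l.2 τ, Finset.sum_range]
    rfl
  harmonic := hharm
  -- The law cancels the power of cτ + d and leaves a finite combination of the functions g at i∞.
  -- As it is given only for 0 ≤ l < 2M, l is first replaced by its residue r.
  growth l σ := by
    obtain ⟨g, U, hg, hU⟩ := hgr σ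
    have hpos : (0 : ℤ) < (2 * M : ℕ) := by omega
    obtain ⟨r, hr⟩ : ∃ r : ℕ, (r : ℤ) = l % (2 * M : ℕ) :=
      ⟨(l % (2 * M : ℕ)).toNat, Int.toNat_of_nonneg (Int.emod_nonneg _ hpos.ne')⟩
    have hr2 : r < 2 * M := by
      have := Int.emod_lt_of_pos l hpos
      omega
    have hmul : ∀ (a : ℤ) (p : ℤ) (τ : ℍ), f (p + (2 * M : ℕ) * a) τ = f p τ := fun a p τ => by
      induction a using Int.induction_on with
      | zero => simp
      | succ a ih => rw [mul_add, mul_one, ← add_assoc, hper, ih]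
      | pred a ih => 
        rw [← ih, ← hper (p + (2 * M : ℕ) * (-(a : ℤ) - 1))]
        exact congrArg (fun x => f x τ) (by ring)
    have hl : ∀ τ : ℍ, f l τ = f r τ := fun τ => by
      rw [hr, ← hmul (l / (2 * M : ℕ)) (l % (2 * M : ℕ)) τ, Int.emod_add_mul_ediv]
    obtain ⟨C, hC⟩ := (ExpGrowth.sum (s := Finset.range (2 * M)) fun p _ =>
      (ExpGrowth.const (U r p)).mul (hg p)).isBigO
    refine ⟨C, hC.congr_left fun τ => ?_⟩
    rw [hl, hU r hr2, ← mul_assoc, ← Complex.cpow_add _ _ (autFactor_ne_zero σ τ), neg_add_cancel,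
      Complex.cpow_zero, one_mul]

/-- Modularity uses only elements fixing χ modulo integers. Growth at σ∞ uses the law for arbitrary
σ, which leads to the characteristic χσ; this is again admissible and hence has exponential growth
at i∞. -/
lemma Good.isVectorHarmonicMaass (hM : 0 < M) {χ : Chr M} (hχ : χ.Good) {Γ : Subgroup SL(2, ℤ)}
    (hΓ : χ.Invariant Γ) :
    IsVectorHarmonicMaass (2 * M) (1 / 2) Γ (fun l τ => χ.val l τ) ∧
    IsVectorHarmonicMaass (2 * M) (3 / 2) Γ (fun l τ => χ.der l τ) := by
  have hmod : ∀ γ ∈ Γ, SmulLaw χ χ γ := fun γ hγ => by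
    obtain ⟨A, B, m, k, ha, hb, hva, hvb⟩ := hΓ γ hγ
    exact hχ.smulLaw hM hχ (exists_law hM hχ γ A B m k ha hb hva hvb)
  have hgr : ∀ σ : SL(2, ℤ), SmulLaw χ (χ.act σ) σ := fun σ => by
    obtain ⟨μ, hμ, hμ2, h⟩ := law hM σ
    exact hχ.smulLaw hM (hχ.act σ) ⟨μ, hμ, hμ2, h χ hχ⟩
  constructor
  · refine isVectorHarmonicMaass_of_laws hM (hχ.val_add hM) (hχ.contDiffOn_val hM)
      (fun γ hγ => ?_) (hχ.laplacian_val hM) fun σ => ?_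
    · obtain ⟨U, hU⟩ := hmod γ hγ
      exact ⟨U, fun l hl τ => (hU l hl τ).1⟩
    · obtain ⟨U, hU⟩ := hgr σ
      exact ⟨fun p => (χ.act σ).val p, U, fun p => (hχ.act σ).expGrowth_val hM p,
        fun l hl τ => (hU l hl τ).1⟩
  · refine isVectorHarmonicMaass_of_laws hM (hχ.der_add hM) (hχ.contDiffOn_der hM)
      (fun γ hγ => ?_) (hχ.laplacian_der hM) fun σ => ?_
    · obtain ⟨U, hU⟩ := hmod γ hγ
      exact ⟨U, fun l hl τ => (hU l hl τ).2⟩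
    · obtain ⟨U, hU⟩ := hgr σ
      exact ⟨fun p => (χ.act σ).der p, U, fun p => (hχ.act σ).expGrowth_der hM p,
        fun l hl τ => (hU l hl τ).2⟩

end Chr

end

section

/-! ### The functions `ρ̂` -/

/-- The real form of `vecV`. -/
def vecR (M : ℕ) (j : Fin (2 * M)) : ℝ := if (j : ℕ) % 2 = 0 then -1 / 2 else 1 / 2

lemma ofReal_vecR (M : ℕ) (j : Fin (2 * M)) : (vecR M j : ℂ) = vecV M j := by
  rw [vecR, vecV]
  split_ifs <;> push_cast <;> rfl

lemma sum_vecR (M : ℕ) : ∑ j, vecR M j = 0 := by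
  have h : ∀ M : ℕ, ∑ j ∈ Finset.range (2 * M), (if j % 2 = 0 then -1 / 2 else 1 / 2 : ℝ) = 0 := by
    intro M
    induction M with
    | zero => simp
    | succ M ih =>
      rw [show 2 * (M + 1) = 2 * M + 1 + 1 by ring, Finset.sum_range_succ, Finset.sum_range_succ, ih,
        if_pos (by omega), if_neg (by omega)]
      norm_num
  rw [← h M, Finset.sum_range]
  rfl

lemma sum_ite_zero {M : ℕ} (hM : 0 < M) :
    ∑ j : Fin (2 * M), (if (j : ℕ) = 0 then 1 / 2 else 0 : ℝ) = 1 / 2 := by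
  rw [← Finset.sum_range fun j => (if j = 0 then 1 / 2 else 0 : ℝ)]
  rw [Finset.sum_ite_eq', if_pos (Finset.mem_range.mpr (by omega))]

/-- The characteristic of `ρ̂^{(s)}`. -/
def chr (M : ℕ) (s : ℚ × ℚ) : Chr M :=
  if s = 0 then ⟨1 / 2, 0, fun j => if (j : ℕ) = 0 then 1 / 2 else 0, vecR M⟩
  else ⟨2 * M * s.1, 2 * M * s.2, 0, vecR M⟩

lemma chr_half {M : ℕ} (s : ℚ × ℚ) (j : Fin (2 * M)) :
    ∃ m k : ℤ, (chr M s).va j = m / 2 ∧ (chr M s).vb j = k / 2 ∧ ¬ (Even m ∧ Even k) := by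
  have ha : ∃ m : ℤ, (chr M s).va j = m / 2 := by
    rw [chr]
    split_ifs
    · by_cases hj : (j : ℕ) = 0
      · exact ⟨1, by simp [hj]⟩
      · exact ⟨0, by simp [hj]⟩
    · exact ⟨0, by simp⟩
  have hb : ∃ k : ℤ, (chr M s).vb j = k / 2 ∧ ¬ Even k := by
    have h : (chr M s).vb j = vecR M j := by rw [chr]; split_ifs <;> rfl
    rw [h, vecR]
    split_ifs
    · exact ⟨-1, by norm_num, by decide⟩
    · exact ⟨1, by norm_num, by decide⟩
  obtain ⟨m, hm⟩ := ha
  obtain ⟨k, hk, hk2⟩ := hb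
  exact ⟨m, k, hm, hk, fun h => hk2 h.2⟩

lemma chr_good {M : ℕ} {s : ℚ × ℚ}
    (h : s ≠ 0 → ¬ ∃ a b : ℤ, 2 * (M : ℚ) * s.1 = a ∧ 2 * (M : ℚ) * s.2 = b) : (chr M s).Good := by
  refine ⟨fun m k hmk => ?_, chr_half s⟩
  rw [chr] at hmk
  split_ifs at hmk with hs
  · obtain ⟨h1, -⟩ := hmk
    have h2 : (1 : ℝ) = ((2 * m : ℤ) : ℝ) := by push_cast; linarith
    have h3 : (1 : ℤ) = 2 * m := by exact_mod_cast h2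
    omega
  · obtain ⟨h1, h2⟩ := hmk
    dsimp only at h1 h2
    exact h hs ⟨m, k, by exact_mod_cast h1, by exact_mod_cast h2⟩

/-- For s ≠ 0 the entries of v cancel, so a₀ = α, b₀ = β, and the exponentials in `rhoHat` are
exactly the normalization of `Phi`. For s = 0 the shift τ/2 of u equals the τ-part of |w|, so a₀ = 0
and the normalization is trivial. -/
lemma rhoHat_eq {M : ℕ} (hM : 0 < M) (s : ℚ × ℚ) (l : ℤ) (ε : ℂ) (τ : ℍ) :
    rhoHat M s l ε τ = (chr M s).Phi l ε τ := by
  have hM' : (M : ℝ) ≠ 0 := by exact_mod_cast hM.ne'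
  by_cases hs : s = 0
  · have h1 : (chr M s).a₀ = 0 := by
      rw [Chr.a₀, chr, if_pos hs]
      simp only [sum_ite_zero hM, sub_self, zero_div]
    have hu : (chr M s).u ε τ = 2 * (M : ℂ) * ε + (τ : ℂ) / 2 := by
      rw [Chr.u, chr, if_pos hs]
      push_cast
      ring
    have hv : (chr M s).v τ = vecW M τ := by
      funext j
      rw [Chr.v, chr, if_pos hs, vecW, ofReal_vecR]
      by_cases hj : (j : ℕ) = 0
      · simp only [if_pos hj]
        push_cast
        ring
      · simp only [if_neg hj]
        push_cast
        ring
    rw [rhoHat, if_pos hs, Chr.Phi, h1, hu, hv]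
    simp [e_zero]
  · have h1 : (chr M s).a₀ = s.1 := by
      rw [Chr.a₀, chr, if_neg hs]
      simp
      field_simp
    have h2 : (chr M s).b₀ = s.2 := by
      rw [Chr.b₀, chr, if_neg hs]
      simp only [sum_vecR]
      field_simp
      ring
    have hu : (chr M s).u ε τ = 2 * (M : ℂ) * (ε + (s.1 : ℂ) * (τ : ℂ) + (s.2 : ℂ)) := by
      rw [Chr.u, chr, if_neg hs]
      push_cast
      ring
    have hv : (chr M s).v τ = vecV M := by
      funext j
      rw [Chr.v, chr, if_neg hs, ofReal_vecR]
      simp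
    rw [rhoHat, if_neg hs, Chr.Phi, h1, h2, hu, hv, ← e_add, ← e_add]
    congr 2
    push_cast
    ring

/-- The coordinates of the v_j, and those of u when s = 0, are half-integers, which matrices
congruent to 1 mod 2 move by integers. For s ≠ 0 the coordinates of u are 2Ms, and s moves by
integers because Γ preserves it modulo ℤ². -/
lemma chr_invariant {M : ℕ} {s : ℚ × ℚ} {Γ : Subgroup SL(2, ℤ)}
    (h : ∀ γ ∈ Γ, ∃ a b : ℤ,
      s.1 = s.1 * (γ 0 0 : ℤ) + s.2 * (γ 1 0 : ℤ) + a ∧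
      s.2 = s.1 * (γ 0 1 : ℤ) + s.2 * (γ 1 1 : ℤ) + b) :
    (chr M s).Invariant (Γ ⊓ CongruenceSubgroup.Gamma 2) := by
  rintro γ ⟨hγ, hγ2⟩
  obtain ⟨h00, h01, h10, h11⟩ := CongruenceSubgroup.Gamma_mem.mp hγ2
  obtain ⟨x, hx⟩ := (ZMod.intCast_eq_intCast_iff_dvd_sub 1 (γ 0 0) 2).mp (by simpa using h00.symm)
  obtain ⟨y, hy⟩ := (ZMod.intCast_zmod_eq_zero_iff_dvd (γ 0 1) 2).mp h01
  obtain ⟨z, hz⟩ := (ZMod.intCast_zmod_eq_zero_iff_dvd (γ 1 0) 2).mp h10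
  obtain ⟨w, hw⟩ := (ZMod.intCast_eq_intCast_iff_dvd_sub 1 (γ 1 1) 2).mp (by simpa using h11.symm)
  have hx' : γ 0 0 = 1 + 2 * x := by push_cast at hx; linarith
  have hy' : γ 0 1 = 2 * y := by push_cast at hy; linarith
  have hz' : γ 1 0 = 2 * z := by push_cast at hz; linarith
  have hw' : γ 1 1 = 1 + 2 * w := by push_cast at hw; linarith
  have hab : ∃ A B : ℤ, ((chr M s).act γ).a = (chr M s).a + A ∧
      ((chr M s).act γ).b = (chr M s).b + B := by
    by_cases hs : s = 0
    · refine ⟨x, y, ?_, ?_⟩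
      · rw [Chr.act, chr, if_pos hs, hx', hz']
        push_cast
        ring
      · rw [Chr.act, chr, if_pos hs, hy', hw']
        push_cast
        ring
    · obtain ⟨a, b, ha, hb⟩ := h γ hγ
      have ha' : (s.1 : ℝ) = s.1 * (γ 0 0 : ℤ) + s.2 * (γ 1 0 : ℤ) + a := by exact_mod_cast ha
      have hb' : (s.2 : ℝ) = s.1 * (γ 0 1 : ℤ) + s.2 * (γ 1 1 : ℤ) + b := by exact_mod_cast hb
      refine ⟨-(2 * M * a), -(2 * M * b), ?_, ?_⟩
      · rw [Chr.act, chr, if_neg hs]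
        push_cast
        linear_combination -(2 * (M : ℝ)) * ha'
      · rw [Chr.act, chr, if_neg hs]
        push_cast
        linear_combination -(2 * (M : ℝ)) * hb'
  obtain ⟨A, B, hA, hB⟩ := hab
  choose m k hm hk _ using chr_half (M := M) s
  refine ⟨A, B, fun j => m j * x + k j * z, fun j => m j * y + k j * w, hA, hB, fun j => ?_,
    fun j => ?_⟩
  · simp only [Chr.act, hm, hk, hx', hz']
    push_cast
    ring
  · simp only [Chr.act, hm, hk, hy', hw']
    push_cast
    ring

end

end MaassRho

end

/-! ### The proposition, by translating `rhoHat` into `Phi`. -/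

theorem proposition6p4 (M : ℕ) (hM : 0 < M) (S : Set (ℚ × ℚ)) (hS : S.Finite)
    -- each nonzero `s ∈ S` lies in the domain of definition: `2M(ατ + β)` is not in `ℤτ + ℤ`
    (hdom : ∀ s ∈ S, s ≠ 0 → ¬ ∃ a b : ℤ, 2 * (M : ℚ) * s.1 = a ∧ 2 * (M : ℚ) * s.2 = b)
    (Γ : Subgroup SL(2, ℤ)) (hΓ : CongruenceSubgroup.IsCongruenceSubgroup Γ)
    (hpres : MaassRho.PreservedModInt S Γ) :
    ∀ s ∈ S,
      MaassRho.IsVectorHarmonicMaass (2 * M) (1 / 2) (Γ ⊓ CongruenceSubgroup.Gamma 2)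
        (fun l τ => MaassRho.rhoHat M s l 0 τ) ∧
      (∀ (l : ℤ) (τ : ℍ), DifferentiableAt ℝ (fun ε : ℂ => MaassRho.rhoHat M s l ε τ) 0) ∧
      MaassRho.IsVectorHarmonicMaass (2 * M) (3 / 2) (Γ ⊓ CongruenceSubgroup.Gamma 2)
        (fun l τ => MaassRho.complexPartial (fun ε : ℂ => MaassRho.rhoHat M s l ε τ) 0) := by
  intro s hs
  have hχ := MaassRho.chr_good (hdom s hs)
  obtain ⟨h1, h2⟩ := hχ.isVectorHarmonicMaass hM
    (MaassRho.chr_invariant (M := M) (hpres s hs))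
  simp only [MaassRho.rhoHat_eq hM]
  refine ⟨?_, fun l τ => ?_, ?_⟩
  · convert h1 using 3 with l τ
    exact MaassRho.Chr.Phi_zero hM _ _ τ.im_pos
  · obtain ⟨β, h⟩ := hχ.hasWirtinger_Phi hM l τ.im_pos
    exact h.differentiableAt
  · convert h2 using 3 with l τ
    exact hχ.complexPartial_Phi hM l τ
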